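/- Let $n,N\ge 1$ be integers, write $\langle n\rangle=\{1,\dots,n\}$, let $\lambda=(\lambda_1\ge\dots\ge\lambda_\ell>0)$ be a partition of $n$, and let $\theta\in S_n$ have cycle type $\lambda$ (fixed points counted as parts $1$). Let $\Xi_N$ be a standard $N\times N$ GUE matrix: a random hermitian matrix whose entries on or above the diagonal are independent centered Gaussians with $\mathbf E\,\Xi(i,j)^2=\delta_{ij}$ and $\mathbf E|\Xi(i,j)|^2=1$. Put $$\mathfrak M_{\lambda,N}=\kappa\big(\mathrm{tr}\,\Xi_N^{\lambda_1},\dots,\mathrm{tr}\,\Xi_N^{\lambda_\ell}\big),$$ where $\kappa$ is the joint cumulant, $\kappa(X_1,\dots,X_\ell)=\sum_{\Pi}(-1)^{|\Pi|-1}(|\Pi|-1)!\prod_{B\in\Pi}\mathbf E\prod_{i\in B}X_i$, summed over the set partitions $\Pi$ of $\langle \ell\rangle$. Notation. For $\sigma\in S_n$ let $\ell(\sigma)$ be the number of $\sigma$-orbits on $\langle n\rangle$ and $\mathrm{supp}\,\sigma$ the set of non-fixed points. * $\mathrm{GJ}_n(\theta)$ is the set of $\sigma\in S_n$ with $\ell(\theta)+\ell(\sigma)=n+1$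 and $\ell(\theta\sigma)=1$. A *cycle-cutting* of $\sigma$ is a subset $A\subset\mathrm{supp}\,\sigma$ meeting every $\sigma$-orbit contained in $\mathrm{supp}\,\sigma$ in exactly one point, and $\mathrm{LF}(\sigma,A)=\{\{i,\sigma(i)\}: i\in(\mathrm{supp}\,\sigma)\setminus A\}$. * $\widetilde{\mathrm{Motz}}{}_n^N(\theta,\sigma)$ is the set of $h:\langle n\rangle\to\{1,\dots,N\}$ such that $h\circ\sigma=h$ and $g=h\circ\theta-h$ satisfies: $|g|\le1$; $g$ sums to $0$ over each $\theta$-orbit; $g\circ\sigma=g$; $g\ne-1$ on $\mathrm{supp}\,\sigma$; $g\neq 0$ on $\mathrm{supp}\,\sigma^2$. * For such $h$ let $J_h(\epsilon)=\{i: h(\theta(i))=h(i)+\epsilon\}$ and, in the polynomial ring over $\mathbb R$ in variables $z_{ij}$ ($1\le i\le n$, $0\le j\le 2N$), $$f^h=\prod_{i\in J_h(0)}z_{i0}\cdot\prod_{i\in J_h(1)}\sum_{j=1}^{2h(i)}\frac{z_{ij}^2}{2}.$$ * For a set $\Gamma$ of two-element subsets of $\langle n\rangle$ let $D^\Gamma=\prod_{\{i,i'\}\in\Gamma}\sum_{j=0}^{2N}\frac{\partial^2}{\partial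 z_{ij}\,\partial z_{i'j}}$. * Let $\{\xi_{ij}\}$ be i.i.d. standard normal and $\zeta^h_{ij}=\xi_{h(i),j}$ ($1\le i\le n$, $0\le j\le 2N$). For a positive semidefinite $n\times n$ matrix $Q$ with entries in $[0,1]$ and unit diagonal, $\zeta^h\star Q$ is a centered Gaussian family with covariances $\mathbf E(\zeta^h\star Q)_{ij}(\zeta^h\star Q)_{i'j'}=Q(i,i')\,\mathbf E\,\zeta^h_{ij}\zeta^h_{i'j'}$. * Let $\Theta$ be the partition of $\langle n\rangle$ into $\theta$-orbits and $k=|\Theta|$. For a set $E$ of two-element subsets let $E\vee\Theta$ be the finest partition that is coarser than or equal to $\Theta$ and has each member of $E$ inside a block; for a partition $\Pi$ let $[\Pi]$ be the $n\times n$ matrix with $(i,j)$ entry $1$ if $i,j$ lie in the same block and $0$ otherwise. For $\Gamma$ with $|\Gamma|=k-1$ and $\Gamma\vee\Theta=\{\langle n\rangle\}$, the probability measure $\mathbb P^\Theta_\Gamma$ is given by $$\int f\,d\mathbb P^\Theta_\Gamma=\sum_{(e_1,\dots,e_{k-1})}\ \int\limits_{1>t_1>\dots>t_{k-1}>0} f\Big([\Theta]+\sum_{\alpha=1}^{k-1}t_\alpha\big([\{e_1,\dots,e_\alpha\}\vee\Theta]-[\{e_1,\dots,e_{\alpha-1}\}\vee\Theta]\big)\Big)\,dt_1\cdots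 dt_{k-1},$$ the sum being over all sequences with $\{e_1,\dots,e_{k-1}\}=\Gamma$. Then $$\mathfrak M_{\lambda,N}=\sum_{(\sigma,A,h,\Gamma)}\int 2^{-|A|}\,\mathbf E\big[(D^\Gamma f^h)(\zeta^h\star Q)\big]\,\mathbb P^\Theta_\Gamma(dQ),$$ where the sum is over all quadruples with $\sigma\in\mathrm{GJ}_n(\theta)$, $A$ a cycle-cutting of $\sigma$, $h\in\widetilde{\mathrm{Motz}}{}_n^N(\theta,\sigma)$ and $\Gamma=\mathrm{LF}(\sigma,A)$. -/

import Mathlib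

open MeasureTheory ProbabilityTheory
open scoped Classical

noncomputable section

namespace TriGUE

/-! ### Joint cumulants and GUE matrices -/

/-- The joint cumulant of a nonempty finite family of real random variables:
`κ({X_i}) = ∑_Π (-1)^(|Π|-1) (|Π|-1)! ∏_{B ∈ Π} E ∏_{i ∈ B} X_i`, summed over the set partitions
`Π` of the index set. -/
def jointCumulant {Ω : Type*} [MeasurableSpace Ω] (P : Measure Ω) {ι : Type*} [Fintype ι]
    (X : ι → Ω → ℝ) : ℝ :=
  ∑ π : Finpartition (Finset.univ : Finset ι),
    (-1 : ℝ) ^ (π.parts.card - 1) * ((π.parts.card - 1).factorial : ℝ) *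
      ∏ B ∈ π.parts, ∫ ω, ∏ i ∈ B, X i ω ∂P

/-- A standard `N`-by-`N` GUE matrix: a random hermitian matrix whose entries on or above the
diagonal are independent, the diagonal ones being standard normal and the others being centered
complex Gaussian with `E Z² = 0` and `E |Z|² = 1`, i.e. with independent real and imaginary parts
of variance `1/2`. -/
structure IsStandardGUE {Ω : Type*} [MeasurableSpace Ω] (P : Measure Ω) {N : ℕ}
    (Ξ : Ω → Matrix (Fin N) (Fin N) ℂ) : Prop where
  measurable : ∀ i j, Measurable fun ω => Ξ ω i j
  isHermitian : ∀ ω, (Ξ ω).IsHermitian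
  indep : iIndepFun (fun (p : {p : Fin N × Fin N // p.1 ≤ p.2}) ω => Ξ ω p.1.1 p.1.2) P
  diag : ∀ i, P.map (fun ω => (Ξ ω i i).re) = gaussianReal 0 1
  offDiag : ∀ i j, i < j → P.map (fun ω => ((Ξ ω i j).re, (Ξ ω i j).im)) =
    (gaussianReal 0 (1 / 2)).prod (gaussianReal 0 (1 / 2))

/-- `𝔐_{λ,N} = κ(tr Ξ^{λ_1}, …, tr Ξ^{λ_ℓ})`, where `λ_1 ≥ ⋯ ≥ λ_ℓ` are the parts of `λ`. (The
traces are real since `Ξ` is hermitian.) -/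
def frakM {Ω : Type*} [MeasurableSpace Ω] (P : Measure Ω) {N : ℕ}
    (Ξ : Ω → Matrix (Fin N) (Fin N) ℂ) {n : ℕ} (lam : n.Partition) : ℝ :=
  jointCumulant P (fun (i : Fin (lam.parts.sort (· ≥ ·)).length) ω =>
    ((Ξ ω ^ ((lam.parts.sort (· ≥ ·)).get i)).trace).re)

/-! ### Set partitions, bonds and the measures `ℙ_Γ^Θ`

Set partitions of `⟨n⟩` are equivalence relations on `Fin n`, ordered by refinement; bonds are
non-diagonal elements of `Sym2 (Fin n)`. -/

/-- The partition into orbits of `σ`. -/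
def orb {n : ℕ} (σ : Equiv.Perm (Fin n)) : Setoid (Fin n) := Equiv.Perm.SameCycle.setoid σ

/-- The number `|Θ|` of blocks. -/
def numBlocks {n : ℕ} (Θ : Setoid (Fin n)) : ℕ := Nat.card (Quotient Θ)

/-- `Γ ∨ Θ`: the finest partition coarser than `Θ` such that each bond in `Γ` lies in a block. -/
def joinBonds {n : ℕ} (Γ : Finset (Sym2 (Fin n))) (Θ : Setoid (Fin n)) : Setoid (Fin n) :=
  sInf {Ψ | Θ ≤ Ψ ∧ ∀ e ∈ Γ, ∀ i ∈ e, ∀ j ∈ e, Ψ.r i j}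

/-- The 0-1 matrix `[Ψ]` representing a partition `Ψ`. -/
def partMatrix {n : ℕ} (Ψ : Setoid (Fin n)) : Fin n → Fin n → ℝ :=
  fun i j => if Ψ.r i j then 1 else 0

/-- For an enumeration `e_1, …, e_m` of bonds (here indexed by `Fin m`, so from `0`), the matrix
`[Θ] + ∑_α t_α ([{e_1,…,e_α} ∨ Θ] - [{e_1,…,e_{α-1}} ∨ Θ])`. -/
def interpMatrix {n m : ℕ} (Θ : Setoid (Fin n)) (e : Fin m → Sym2 (Fin n)) (t : Fin m → ℝ) :
    Fin n → Fin n → ℝ :=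
  partMatrix Θ + ∑ α : Fin m, t α •
    (partMatrix (joinBonds ((Finset.univ.filter (· ≤ α)).image e) Θ) -
      partMatrix (joinBonds ((Finset.univ.filter (· < α)).image e) Θ))

/-- The simplex `1 > t_1 > ⋯ > t_m > 0`. -/
def decSimplex (m : ℕ) : Set (Fin m → ℝ) :=
  {t | (∀ α, 0 < t α ∧ t α < 1) ∧ StrictAnti t}

/-- The measure `ℙ_Γ^Θ`, with `k = |Θ|`: integration against it is the sum over the enumerations
`(e_1, …, e_{k-1})` of `Γ` of the integral over the simplex `1 > t_1 > ⋯ > t_{k-1} > 0`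
(Lebesgue measure) of the integrand at the interpolating matrix. It is a probability measure
carried by the set of positive semidefinite matrices with unit diagonal and entries in `[0,1]`
whenever `Γ` makes the blocks of `Θ` into a tree. -/
def bkarMeasure {n : ℕ} (Θ : Setoid (Fin n)) (Γ : Finset (Sym2 (Fin n))) :
    Measure (Fin n → Fin n → ℝ) :=
  ∑ e ∈ (Finset.univ : Finset (Fin (numBlocks Θ - 1) → Sym2 (Fin n))).filter
      (fun e => Finset.univ.image e = Γ),
    ((volume : Measure (Fin (numBlocks Θ - 1) → ℝ)).restrict
      (decSimplex (numBlocks Θ - 1))).map (interpMatrix Θ e)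

/-! ### Differential operators -/

/-- The polynomial ring in the variables `z_{ij}`, `1 ≤ i ≤ n`, `0 ≤ j ≤ 2N`. -/
abbrev ZPoly (n N : ℕ) : Type := MvPolynomial (Fin n × Fin (2 * N + 1)) ℝ

/-- The partial derivative `∂/∂z_a` as a linear operator. -/
def partialZ {n N : ℕ} (a : Fin n × Fin (2 * N + 1)) : Module.End ℝ (ZPoly n N) :=
  (MvPolynomial.pderiv a : Derivation ℝ (ZPoly n N) (ZPoly n N)).toLinearMap

lemma partialZ_commute {n N : ℕ} (a b : Fin n × Fin (2 * N + 1)) :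
    Commute (partialZ a) (partialZ b) := by
  have h : ⁅(MvPolynomial.pderiv a : Derivation ℝ (ZPoly n N) (ZPoly n N)),
      (MvPolynomial.pderiv b : Derivation ℝ (ZPoly n N) (ZPoly n N))⁆ = 0 := by
    apply MvPolynomial.derivation_ext
    intro i
    simp [Derivation.commutator_apply, MvPolynomial.pderiv_X, Pi.single_apply,
      apply_ite]
  refine LinearMap.ext fun p => ?_
  have h2 := congrArg (fun D : Derivation ℝ (ZPoly n N) (ZPoly n N) => D p) h
  simpa [partialZ, Derivation.commutator_apply, sub_eq_zero] using h2

/-- `D_e = ∑_j ∂²/∂z_{ij}∂z_{i'j}` for `e = {i,i'}`. -/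
def bondOp {n : ℕ} (N : ℕ) : Sym2 (Fin n) → Module.End ℝ (ZPoly n N) :=
  Sym2.lift ⟨fun i i' => ∑ j : Fin (2 * N + 1), partialZ (i, j) * partialZ (i', j),
    fun i i' => Finset.sum_congr rfl fun j _ => (partialZ_commute (i, j) (i', j)).eq⟩

lemma bondOp_commute {n : ℕ} (N : ℕ) (e e' : Sym2 (Fin n)) :
    Commute (bondOp N e) (bondOp N e') := by
  refine Sym2.ind (fun a b => ?_) e
  refine Sym2.ind (fun c d => ?_) e'
  have key : ∀ a b c d : Fin n × Fin (2 * N + 1),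
      Commute (partialZ a * partialZ b) (partialZ c * partialZ d) := fun a b c d =>
    ((partialZ_commute a c).mul_right (partialZ_commute a d)).mul_left
      ((partialZ_commute b c).mul_right (partialZ_commute b d))
  have h : ∀ u v : Fin n, bondOp N s(u, v) =
      ∑ j : Fin (2 * N + 1), partialZ (u, j) * partialZ (v, j) := fun _ _ => rfl
  rw [h, h]
  exact Commute.sum_left _ _ _ fun j _ => Commute.sum_right _ _ _ fun j' _ => key _ _ _ _

/-- `D^Γ = ∏_{e ∈ Γ} D_e`. -/
def bondsOp {n : ℕ} (N : ℕ) (Γ : Finset (Sym2 (Fin n))) : Module.End ℝ (ZPoly n N) :=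
  Γ.noncommProd (bondOp N) fun e _ e' _ _ => bondOp_commute N e e'

/-! ### Motzkin paths, the polynomial `f^h` and the Gaussian family `ζ^h ⋆ Q` -/

/-- `Motz_n^N(θ)`: the functions `h : ⟨n⟩ → {1, …, N}` with `|h(θ(i)) - h(i)| ≤ 1`. -/
def motzN {n : ℕ} (N : ℕ) (θ : Equiv.Perm (Fin n)) : Finset (Fin n → ℤ) :=
  (Fintype.piFinset fun _ => Finset.Icc (1 : ℤ) N).filter fun h => ∀ i, |h (θ i) - h i| ≤ 1

/-- `J_h(ε) = {i | h(θ(i)) = h(i) + ε}`. -/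
def jSet {n : ℕ} (θ : Equiv.Perm (Fin n)) (h : Fin n → ℤ) (ε : ℤ) : Finset (Fin n) :=
  Finset.univ.filter fun i => h (θ i) = h i + ε

/-- `f^h = ∏_{i ∈ J_h(0)} z_{i0} · ∏_{i ∈ J_h(1)} ∑_{j=1}^{2h(i)} z_{ij}²/2`. -/
def fPoly {n : ℕ} (N : ℕ) (θ : Equiv.Perm (Fin n)) (h : Fin n → ℤ) : ZPoly n N :=
  (∏ i ∈ jSet θ h 0, (MvPolynomial.X (i, 0) : ZPoly n N)) *
    ∏ i ∈ jSet θ h 1,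
      ∑ j ∈ (Finset.univ : Finset (Fin (2 * N + 1))).filter
          (fun j : Fin (2 * N + 1) => 1 ≤ (j : ℕ) ∧ ((j : ℕ) : ℤ) ≤ 2 * h i),
        (1 / 2 : ℝ) • (MvPolynomial.X (i, j) : ZPoly n N) ^ 2

/-- The law of an i.i.d. family `ξ_{ij}` of standard normal random variables. -/
def iidNormal : Measure (ℤ × ℕ → ℝ) := Measure.infinitePi fun _ => gaussianReal 0 1

/-- `ζ^h_{ij} = ξ_{h(i),j}`. -/
def zeta {n : ℕ} (N : ℕ) (h : Fin n → ℤ) (p : Fin n × Fin (2 * N + 1)) (ξ : ℤ × ℕ → ℝ) : ℝ :=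
  ξ (h p.1, (p.2 : ℕ))

/-- The law of `ζ^h ⋆ Q`: the centered Gaussian law for which the `(i,j)` and `(i',j')` coordinates
have covariance `Q(i,i') E ζ^h_{ij} ζ^h_{i'j'}`. -/
def recoupledLaw {n : ℕ} (N : ℕ) (h : Fin n → ℤ) (Q : Fin n → Fin n → ℝ) :
    Measure (EuclideanSpace ℝ (Fin n × Fin (2 * N + 1))) :=
  multivariateGaussian 0
    (Matrix.of fun p p' => Q p.1 p'.1 * ∫ ξ, zeta N h p ξ * zeta N h p' ξ ∂iidNormal)

/-- `E[g(ζ^h ⋆ Q)]`. -/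
def recoupledExp {n N : ℕ} (h : Fin n → ℤ) (Q : Fin n → Fin n → ℝ) (g : ZPoly n N) : ℝ :=
  ∫ x, MvPolynomial.eval (fun p => x p) g ∂recoupledLaw N h Q

/-! ### Goulden-Jackson pairs and cycle-cuttings -/

/-- `GJ_n(θ)`: the `σ` with `ℓ(θ) + ℓ(σ) = n + 1` and `ℓ(θσ) = 1`. -/
def gj {n : ℕ} (θ : Equiv.Perm (Fin n)) : Finset (Equiv.Perm (Fin n)) :=
  Finset.univ.filter fun σ =>
    numBlocks (orb θ) + numBlocks (orb σ) = n + 1 ∧ numBlocks (orb (θ * σ)) = 1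

/-- `A ⊆ supp σ` meets each `σ`-orbit contained in `supp σ` in exactly one point. -/
def IsCycleCutting {n : ℕ} (σ : Equiv.Perm (Fin n)) (A : Finset (Fin n)) : Prop :=
  A ⊆ σ.support ∧ ∀ i ∈ σ.support, ∃! a, a ∈ A ∧ σ.SameCycle i a

/-- `LF(σ,A) = {{i, σ(i)} | i ∈ supp σ \ A}`. -/
def linForest {n : ℕ} (σ : Equiv.Perm (Fin n)) (A : Finset (Fin n)) : Finset (Sym2 (Fin n)) :=
  (σ.support \ A).image fun i => s(i, σ i)

/-- The set `dMotz~_n(θ,σ)`. -/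
structure IsTildeDMotz {n : ℕ} (θ σ : Equiv.Perm (Fin n)) (g : Fin n → ℤ) : Prop where
  abs_le : ∀ i, |g i| ≤ 1
  orbit_sum : ∀ i, ∑ j ∈ Finset.univ.filter (fun j => θ.SameCycle i j), g j = 0
  comp_eq : g ∘ σ = g
  neg_one : ∀ i, g i = -1 → i ∉ σ.support
  zero : ∀ i, g i = 0 → i ∉ (σ ^ 2).support

/-- The set `Motz~_n^N(θ,σ)`. -/
def tildeMotzN {n : ℕ} (N : ℕ) (θ σ : Equiv.Perm (Fin n)) : Finset (Fin n → ℤ) :=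
  (motzN N θ).filter fun h => h ∘ σ = h ∧ IsTildeDMotz θ σ (h ∘ θ - h)

end TriGUE

end

noncomputable section

namespace TriGUE

/-! ### Moments of the standard normal law -/

/-! A cumulant is an alternating sum, over set partitions, of products of joint moments. Three ideas
turn it into the asserted sum.

Tridiagonal model. Only traces of powers occur, so the matrix may be conjugated freely. View a GUE
matrix as a smaller GUE matrix with an independent border. A unitary chosen from the last column
rotates it onto the last basis vector without changing the law of the smaller block. A scalar
rescaling then leaves `1` below the diagonal and the squared length of the column above it.
Iterating (`ConjInvariant.lintegral_eq`, `iidNormal_map_triMat`) gives a tridiagonal matrix in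
i.i.d. normals. A product of traces of its powers is a sum over closed walks, one on each `θ`-orbit,
that is over Motzkin paths `h` weighted by `f^h` at `ζ^h` (`prod_trace_pow_eq_sum`,
`prod_triEntry`). A product of moments over the blocks of a partition `Ψ ≥ Θ` is a single moment in
which each block has its own independent copy of the normals, which is `E f^h(ζ^h ⋆ [Ψ])`. Hence the
cumulant is `∑_h ∑_{Ψ ≥ Θ} (-1)^(|Ψ|-1) (|Ψ|-1)! E f^h(ζ^h ⋆ [Ψ])` (`IsStandardGUE.frakM_eq`).

Forest formula. Gaussian expectations of polynomials are the algebraic functional `wick C p = (exp(½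
∑ C_{ab} ∂_a ∂_b) p)(0)`, differentiable in `C`. Moving from `[Θ]` to `[Ψ]` differentiates by the
bond operators `D_e` of the bonds inside `Ψ` but not inside `Θ`. When `Θ` has at least two blocks
the cumulant weights sum to zero, so the value at `[Θ]` can be subtracted from every term; the
fundamental theorem of calculus then adjoins one bond, and induction on the number of blocks yields
all enumerated trees on the blocks of `Θ`, integrated over a simplex (`sum_cumWeight_eq_sum_trees`).
These integrals are the ones defining `ℙ_Γ^Θ`.

From trees to permutations. The polynomial `f^h` has degree at most two in the variables of each
point, so `D^Γ f^h ≠ 0` forces every point to have degree at most two in `Γ`. Hence `Γ` is a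
disjoint union of paths; orienting and closing up each path gives a permutation `σ` together with
the cut points `A`. Each nontrivial path has two orientations, so there are `2^|A|` such pairs, and
the factor `2^(-|A|)` makes their total weight one (`sum_cycleCuttings`). The tree condition says
that `σ` lies in `GJ_n(θ)` (`IsTransversal.orb_mul_eq`), and finer degree considerations give the
side conditions on `h` (`IsTransversal.mem_gj_and_mem_tildeMotzN`). -/

lemma integrable_pow_gaussianReal (k : ℕ) :
    Integrable (fun x : ℝ => x ^ k) (gaussianReal 0 1) := by
  have h := (memLp_id_gaussianReal' (μ := 0) (v := 1) (k : ENNReal) (by simp))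
  rcases Nat.eq_zero_or_pos k with rfl | hk
  · simp
  · refine (h.integrable_norm_pow hk.ne').mono' (by fun_prop) ?_
    simp

/-- The moments of the standard normal law. -/
def normalMoment (k : ℕ) : ℝ := ∫ x, x ^ k ∂gaussianReal 0 1

lemma normalMoment_zero : normalMoment 0 = 1 := by simp [normalMoment]

lemma hasDerivAt_gaussianPDFReal (x : ℝ) :
    HasDerivAt (fun x => -gaussianPDFReal 0 1 x) (x * gaussianPDFReal 0 1 x) x := by
  have h : HasDerivAt (fun x : ℝ => -(x - 0) ^ 2 / (2 * ((1 : NNReal) : ℝ))) (-x) x := by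
    have := ((((hasDerivAt_id x).sub_const 0).pow 2).neg).div_const (2 * ((1 : NNReal) : ℝ))
    refine this.congr_deriv ?_
    simp only [id, sub_zero, NNReal.coe_one]
    ring
  have h2 := ((h.exp.const_mul (√(2 * Real.pi * ((1 : NNReal) : ℝ)))⁻¹)).neg
  simp only [gaussianPDFReal_def]
  refine h2.congr_deriv ?_
  ring

lemma integrable_pow_mul_gaussianPDFReal (k : ℕ) :
    Integrable (fun x : ℝ => x ^ k * gaussianPDFReal 0 1 x) := by
  have h := integrable_pow_gaussianReal k
  rw [gaussianReal_of_var_ne_zero _ one_ne_zero,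
    integrable_withDensity_iff (measurable_gaussianPDF _ _)
      (ae_of_all _ fun _ => gaussianPDF_lt_top)] at h
  simpa using h

lemma normalMoment_eq (k : ℕ) : normalMoment k = ∫ x, x ^ k * gaussianPDFReal 0 1 x := by
  rw [normalMoment, integral_gaussianReal_eq_integral_smul one_ne_zero]
  simp [mul_comm]

/-- Integration by parts, the density times `x` being minus the derivative of the density. For `k =
0` the truncated `k - 1` is harmless because of the factor `k`. -/
lemma normalMoment_succ (k : ℕ) : normalMoment (k + 1) = k * normalMoment (k - 1) := by
  have h := integral_mul_deriv_eq_deriv_mul_of_integrable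
    (u := fun x : ℝ => x ^ k) (v := fun x => -gaussianPDFReal 0 1 x)
    (u' := fun x : ℝ => k * x ^ (k - 1)) (v' := fun x => x * gaussianPDFReal 0 1 x)
    (fun x _ => by simpa using hasDerivAt_pow k x) (fun x _ => hasDerivAt_gaussianPDFReal x)
    (by
      have := integrable_pow_mul_gaussianPDFReal (k + 1)
      refine this.congr (ae_of_all _ fun x => ?_)
      simp only [Pi.mul_apply]; ring)
    (by
      have := (integrable_pow_mul_gaussianPDFReal (k - 1)).const_mul (-(k : ℝ))
      refine this.congr (ae_of_all _ fun x => ?_)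
      simp only [Pi.mul_apply]; ring)
    (by
      have := (integrable_pow_mul_gaussianPDFReal k).neg
      refine this.congr (ae_of_all _ fun x => ?_)
      simp only [Pi.mul_apply, Pi.neg_apply]; ring)
  rw [normalMoment_eq, normalMoment_eq, ← integral_const_mul]
  have e1 : ∀ x : ℝ, x ^ (k + 1) * gaussianPDFReal 0 1 x = x ^ k * (x * gaussianPDFReal 0 1 x) :=
    fun x => by ring
  simp_rw [e1]
  rw [h, ← integral_neg]
  congr 1
  ext x
  ring

/-! ### The Wick functional on polynomials -/

section Wick

variable {ι : Type*}

open MvPolynomial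

/-- The partial derivative as a linear operator. -/
def dz (a : ι) : Module.End ℝ (MvPolynomial ι ℝ) :=
  (pderiv a : Derivation ℝ (MvPolynomial ι ℝ) (MvPolynomial ι ℝ)).toLinearMap

lemma dz_apply (a : ι) (p : MvPolynomial ι ℝ) : dz a p = pderiv a p := rfl

lemma dz_commute (a b : ι) : Commute (dz a) (dz b) := by
  have h : ⁅(pderiv a : Derivation ℝ (MvPolynomial ι ℝ) (MvPolynomial ι ℝ)),
      (pderiv b : Derivation ℝ (MvPolynomial ι ℝ) (MvPolynomial ι ℝ))⁆ = 0 := by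
    apply MvPolynomial.derivation_ext
    intro i
    simp [Derivation.commutator_apply, MvPolynomial.pderiv_X, Pi.single_apply,
      apply_ite]
  refine LinearMap.ext fun p => ?_
  have h2 := congrArg (fun D : Derivation ℝ (MvPolynomial ι ℝ) (MvPolynomial ι ℝ) => D p) h
  simpa [dz, Derivation.commutator_apply, sub_eq_zero] using h2

lemma pderiv_comm (a b : ι) (p : MvPolynomial ι ℝ) :
    pderiv a (pderiv b p) = pderiv b (pderiv a p) :=
  LinearMap.congr_fun (dz_commute a b).eq p

lemma totalDegree_pderiv_le (a : ι) (p : MvPolynomial ι ℝ) :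
    (pderiv a p).totalDegree ≤ p.totalDegree - 1 := by
  refine Finset.sup_le fun m hm => ?_
  rw [mem_support_iff, coeff_pderiv] at hm
  have h1 := le_totalDegree (mem_support_iff.2 (left_ne_zero_of_mul hm))
  rw [Finsupp.sum_add_index' (fun _ => rfl) (fun _ _ _ => rfl),
    Finsupp.sum_single_index rfl] at h1
  omega

variable [Fintype ι]

/-- The second order operator `½ ∑ C_{ab} ∂_a ∂_b`. -/
def lap (C : ι → ι → ℝ) : Module.End ℝ (MvPolynomial ι ℝ) :=
  ∑ a, ∑ b, (C a b / 2) • (dz a * dz b)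

lemma lap_apply (C : ι → ι → ℝ) (p : MvPolynomial ι ℝ) :
    lap C p = ∑ a, ∑ b, (C a b / 2) • pderiv a (pderiv b p) := by
  simp [lap, LinearMap.sum_apply, dz_apply]

lemma lap_add (C D : ι → ι → ℝ) : lap (C + D) = lap C + lap D := by
  simp [lap, add_div, add_smul, Finset.sum_add_distrib]

lemma lap_smul (r : ℝ) (C : ι → ι → ℝ) : lap (r • C) = r • lap C := by
  simp [lap, Finset.smul_sum, smul_smul, mul_div_assoc]

lemma dz_commute_lap (C : ι → ι → ℝ) (a : ι) : Commute (dz a) (lap C) :=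
  Commute.sum_right _ _ _ fun _ _ => Commute.sum_right _ _ _ fun _ _ =>
    ((dz_commute _ _).mul_right (dz_commute _ _)).smul_right _

lemma lap_commute (C D : ι → ι → ℝ) : Commute (lap C) (lap D) :=
  Commute.sum_left _ _ _ fun _ _ => Commute.sum_left _ _ _ fun _ _ =>
    ((dz_commute_lap _ _).mul_left (dz_commute_lap _ _)).smul_left _

lemma totalDegree_lap_le (C : ι → ι → ℝ) (p : MvPolynomial ι ℝ) :
    (lap C p).totalDegree ≤ p.totalDegree - 1 := by
  rw [lap_apply]
  refine totalDegree_finsetSum_le fun a _ => totalDegree_finsetSum_le fun b _ => ?_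
  refine (totalDegree_smul_le _ _).trans ((totalDegree_pderiv_le _ _).trans ?_)
  have := totalDegree_pderiv_le b p
  omega

lemma lap_pow_eq_zero (C : ι → ι → ℝ) (m : ℕ) (p : MvPolynomial ι ℝ) (hp : p.totalDegree < m) :
    (lap C ^ m) p = 0 := by
  induction m generalizing p with
  | zero => omega
  | succ m ih =>
    rw [pow_succ, Module.End.mul_apply]
    rcases Nat.eq_zero_or_pos p.totalDegree with h0 | h0
    · have : lap C p = 0 := by
        rw [totalDegree_eq_zero_iff_eq_C.1 h0, lap_apply]
        simp
      rw [this, map_zero]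
    · refine ih _ ((totalDegree_lap_le C p).trans_lt ?_)
      omega

/-- `lap C` lowers the degree, so the exponential series is finite and every cutoff beyond the
degree gives the same value. This is why `wick` is linear although its cutoff depends on the
polynomial. -/
lemma sum_range_lap_eq (C : ι → ι → ℝ) (p : MvPolynomial ι ℝ) {K L : ℕ}
    (hK : p.totalDegree < K) (hL : p.totalDegree < L) :
    ∑ m ∈ Finset.range K, ((m.factorial : ℝ)⁻¹ * constantCoeff ((lap C ^ m) p)) =
      ∑ m ∈ Finset.range L, ((m.factorial : ℝ)⁻¹ * constantCoeff ((lap C ^ m) p)) := by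
  wlog h : K ≤ L generalizing K L
  · exact (this hL hK (le_of_not_ge h)).symm
  refine Finset.sum_subset (Finset.range_mono h) fun m _ hm => ?_
  rw [lap_pow_eq_zero C m p (by simp at hm; omega)]
  simp

/-- The Wick functional `p ↦ (exp(½ ∑ C_{ab} ∂_a ∂_b) p)(0)`: the expectation of `p` at a centered
Gaussian family with covariance `C`. -/
def wick (C : ι → ι → ℝ) : MvPolynomial ι ℝ →ₗ[ℝ] ℝ where
  toFun p := ∑ m ∈ Finset.range (p.totalDegree + 1),
    ((m.factorial : ℝ)⁻¹ * constantCoeff ((lap C ^ m) p))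
  map_add' p q := by
    have hK := totalDegree_add p q
    rw [sum_range_lap_eq C (p + q) (L := max p.totalDegree q.totalDegree + 1) (by omega) (by omega),
      sum_range_lap_eq C p (L := max p.totalDegree q.totalDegree + 1) (by omega) (by omega),
      sum_range_lap_eq C q (L := max p.totalDegree q.totalDegree + 1) (by omega) (by omega),
      ← Finset.sum_add_distrib]
    refine Finset.sum_congr rfl fun m _ => ?_
    rw [map_add, map_add, mul_add]
  map_smul' r p := by
    have hK := totalDegree_smul_le r p
    rw [sum_range_lap_eq C (r • p) (L := p.totalDegree + 1) (by omega) (by omega),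
      RingHom.id_apply, smul_eq_mul, Finset.mul_sum]
    refine Finset.sum_congr rfl fun m _ => ?_
    rw [map_smul, constantCoeff_smul, smul_eq_mul]
    ring

lemma wick_eq (C : ι → ι → ℝ) (p : MvPolynomial ι ℝ) {K : ℕ} (hK : p.totalDegree < K) :
    wick C p = ∑ m ∈ Finset.range K, ((m.factorial : ℝ)⁻¹ * constantCoeff ((lap C ^ m) p)) :=
  sum_range_lap_eq C p (by omega) hK

lemma wick_one (C : ι → ι → ℝ) : wick C 1 = 1 := by
  rw [wick_eq C 1 (K := 1) (by simp)]
  simp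

/-- The commutator of `lap C` with multiplication by `X a` is a first-order operator; by symmetry of
`C` its two halves coincide and cancel the factor `½`. -/
lemma lap_X_mul {C : ι → ι → ℝ} (hC : ∀ a b, C a b = C b a) (a : ι) (p : MvPolynomial ι ℝ) :
    lap C (X a * p) = X a * lap C p + ∑ b, C a b • pderiv b p := by
  have h : ∀ c d, pderiv c (pderiv d (X a * p)) = X a * pderiv c (pderiv d p) +
      ((if a = c then pderiv d p else 0) + if a = d then pderiv c p else 0) := by
    intro c d
    rw [pderiv_mul, map_add, pderiv_mul, pderiv_mul]
    simp only [pderiv_X, Pi.single_apply]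
    split_ifs <;> simp <;> ring
  rw [lap_apply, lap_apply, Finset.mul_sum]
  simp_rw [h, smul_add, Finset.sum_add_distrib, Finset.mul_sum, mul_smul_comm]
  congr 1
  simp only [smul_ite, smul_zero, Finset.sum_ite_eq, Finset.mem_univ, if_true]
  rw [Finset.sum_comm]
  simp only [Finset.sum_ite_eq, Finset.mem_univ, if_true]
  rw [← Finset.sum_add_distrib]
  refine Finset.sum_congr rfl fun b _ => ?_
  rw [hC b a, ← add_smul, add_halves]

/-- The commutator in `lap_X_mul` has constant coefficients, hence commutes with `lap C`; so
commuting `X a` past a power only produces the exponent as a factor. -/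
lemma lap_pow_X_mul {C : ι → ι → ℝ} (hC : ∀ a b, C a b = C b a) (a : ι) (m : ℕ)
    (p : MvPolynomial ι ℝ) :
    (lap C ^ (m + 1)) (X a * p) = X a * (lap C ^ (m + 1)) p +
      ((m + 1 : ℕ) : ℝ) • ∑ b, C a b • (lap C ^ m) (pderiv b p) := by
  have hc : ∀ b q, lap C (pderiv b q) = pderiv b (lap C q) := fun b q =>
    (LinearMap.congr_fun (dz_commute_lap C b).eq q).symm
  induction m generalizing p with
  | zero => simp [lap_X_mul hC]
  | succ m ih =>
    rw [pow_succ, Module.End.mul_apply, lap_X_mul hC, map_add, ih, map_sum]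
    simp only [map_smul, Module.End.mul_apply]
    rw [add_assoc]
    congr 1
    have : ∀ b, (lap C ^ m) (pderiv b (lap C p)) = (lap C ^ (m + 1)) (pderiv b p) := fun b => by
      rw [pow_succ, Module.End.mul_apply, hc]
    simp only [this]
    push_cast
    module

/-- Gaussian integration by parts for the Wick functional. -/
lemma wick_X_mul {C : ι → ι → ℝ} (hC : ∀ a b, C a b = C b a) (a : ι) (p : MvPolynomial ι ℝ) :
    wick C (X a * p) = ∑ b, C a b * wick C (pderiv b p) := by
  have h1 : (X a * p).totalDegree < p.totalDegree + 2 := by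
    have := totalDegree_mul (X a) p
    rw [totalDegree_X] at this
    omega
  have h2 : ∀ b, (pderiv b p).totalDegree < p.totalDegree + 1 := fun b => by
    have := totalDegree_pderiv_le b p
    omega
  rw [wick_eq C _ h1, Finset.sum_range_succ']
  simp only [wick_eq C _ (h2 _), lap_pow_X_mul hC]
  simp only [map_add, map_mul, constantCoeff_X, zero_mul, zero_add, pow_zero, Module.End.one_apply,
    mul_zero, add_zero, constantCoeff_smul, map_sum, Finset.mul_sum, smul_eq_mul]
  rw [Finset.sum_comm]
  refine Finset.sum_congr rfl fun b _ => Finset.sum_congr rfl fun m _ => ?_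
  rw [Nat.factorial_succ]
  have : ((m + 1 : ℕ) : ℝ) ≠ 0 := by positivity
  have : (m.factorial : ℝ) ≠ 0 := by positivity
  push_cast at *
  field_simp

/-- Gaussian integration by parts determines a linear functional on polynomials. -/
lemma eq_wick_of_X_mul {C : ι → ι → ℝ} (hC : ∀ a b, C a b = C b a)
    (L : MvPolynomial ι ℝ →ₗ[ℝ] ℝ) (h1 : L 1 = 1)
    (h : ∀ a p, L (X a * p) = ∑ b, C a b * L (pderiv b p)) : L = wick C := by
  have key : ∀ d (s : ι →₀ ℕ), s.degree = d → ∀ r, L (monomial s r) = wick C (monomial s r) := by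
    intro d
    induction d using Nat.strong_induction_on with
    | _ d ih =>
      intro s hs r
      rcases eq_or_ne s 0 with rfl | hs0
      · have : (monomial (0 : ι →₀ ℕ) r : MvPolynomial ι ℝ) = r • 1 := by
          rw [← C_apply, C_eq_smul_one]
        rw [this, map_smul, map_smul, h1, wick_one]
      · obtain ⟨a, ha⟩ : ∃ a, s a ≠ 0 := by
          by_contra! hh
          exact hs0 (Finsupp.ext hh)
        have hsa : s = Finsupp.single a 1 + (s - Finsupp.single a 1) := by
          ext b
          simp only [Finsupp.add_apply, Finsupp.tsub_apply, Finsupp.single_apply]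
          split_ifs with hb
          · subst hb; omega
          · omega
        set t := s - Finsupp.single a 1 with ht
        have hdeg : t.degree + 1 = d := by
          rw [← hs, hsa, map_add, Finsupp.degree_single]; omega
        have hm : (monomial s r : MvPolynomial ι ℝ) = X a * monomial t r := by
          rw [X, monomial_mul, one_mul, ← hsa]
        rw [hm, h, wick_X_mul hC]
        refine Finset.sum_congr rfl fun b _ => ?_
        rw [pderiv_monomial]
        congr 1
        refine ih (t - Finsupp.single b 1).degree ?_ _ rfl _
        have : (t - Finsupp.single b 1).degree ≤ t.degree := by
          exact Finsupp.degree_mono tsub_le_self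
        omega
  refine LinearMap.ext fun p => ?_
  rw [p.as_sum, map_sum, map_sum]
  exact Finset.sum_congr rfl fun s _ => key _ s rfl _

/-- The power rule survives because `A` and `B` commute. Composing with a functional `ℓ` reduces it
to real calculus, with no topology on `V`. -/
lemma hasDerivAt_pow_apply {V : Type*} [AddCommGroup V] [Module ℝ V] {A B : Module.End ℝ V}
    (hAB : Commute A B) (ℓ : V →ₗ[ℝ] ℝ) (m : ℕ) (v : V) (s : ℝ) :
    HasDerivAt (fun s : ℝ => ℓ (((A + s • B) ^ m) v))
      (m * ℓ (((A + s • B) ^ (m - 1)) (B v))) s := by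
  induction m generalizing v with
  | zero => simpa using hasDerivAt_const s (ℓ v)
  | succ m ih =>
    have e : ∀ s : ℝ, ℓ (((A + s • B) ^ (m + 1)) v) =
        ℓ (((A + s • B) ^ m) (A v)) + s * ℓ (((A + s • B) ^ m) (B v)) := fun s => by
      rw [pow_succ, Module.End.mul_apply, LinearMap.add_apply, LinearMap.smul_apply, map_add,
        map_add, map_smul, map_smul, smul_eq_mul]
    simp only [e]
    refine ((ih (A v)).add ((hasDerivAt_id s).mul (ih (B v)))).congr_deriv ?_
    rcases m with _ | m
    · simp
    · have e2 : B (A v) = A (B v) := (LinearMap.congr_fun hAB.eq v).symm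
      simp only [Nat.add_sub_cancel, id, one_mul, e2]
      rw [pow_succ (A + s • B) m, Module.End.mul_apply, LinearMap.add_apply, LinearMap.smul_apply,
        map_add, map_add, map_smul, map_smul, smul_eq_mul]
      push_cast
      ring

/-- Termwise differentiation of `exp(lap C + s • lap R)`, whose exponents commute: the derivative
inserts one factor `lap R`. This drives the interpolation between covariances. -/
lemma hasDerivAt_wick (C R : ι → ι → ℝ) (p : MvPolynomial ι ℝ) (s : ℝ) :
    HasDerivAt (fun s : ℝ => wick (C + s • R) p) (wick (C + s • R) (lap R p)) s := by
  have hd : (lap R p).totalDegree < p.totalDegree + 1 := by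
    have := totalDegree_lap_le R p
    omega
  have h : ∀ s : ℝ, wick (C + s • R) p = ∑ m ∈ Finset.range (p.totalDegree + 2),
      ((m.factorial : ℝ)⁻¹ * (Algebra.linearMap ℝ ℝ ∘ₗ (lcoeff ℝ (0 : ι →₀ ℕ))) 
        (((lap C + s • lap R) ^ m) p)) := fun s => by
    rw [wick_eq (C + s • R) p (K := p.totalDegree + 2) (by omega), lap_add, lap_smul]
    rfl
  simp only [h]
  refine (HasDerivAt.fun_sum fun m _ => (hasDerivAt_pow_apply (lap_commute C R) _ m p s).const_mul
    ((m.factorial : ℝ)⁻¹)).congr_deriv ?_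
  rw [wick_eq _ _ hd, Finset.sum_range_succ']
  simp only [Nat.cast_zero, zero_mul, mul_zero, add_zero, Nat.add_sub_cancel, lap_add, lap_smul]
  refine Finset.sum_congr rfl fun m _ => ?_
  rw [Nat.factorial_succ, ← mul_assoc]
  congr 1
  have : ((m + 1 : ℕ) : ℝ) ≠ 0 := by positivity
  have : (m.factorial : ℝ) ≠ 0 := by positivity
  push_cast at *
  field_simp

lemma continuous_wick (p : MvPolynomial ι ℝ) : Continuous fun C : ι → ι → ℝ => wick C p := by
  have key : ∀ m (q : MvPolynomial ι ℝ),
      Continuous fun C : ι → ι → ℝ => constantCoeff ((lap C ^ m) q) := by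
    intro m
    induction m with
    | zero => intro q; simpa using continuous_const
    | succ m ih =>
      intro q
      have : ∀ C : ι → ι → ℝ, constantCoeff ((lap C ^ (m + 1)) q) =
          ∑ a, ∑ b, C a b / 2 * constantCoeff ((lap C ^ m) (pderiv a (pderiv b q))) := fun C => by
        rw [pow_succ, Module.End.mul_apply, lap_apply]
        simp only [map_sum, map_smul, constantCoeff_smul, smul_eq_mul]
      simp only [this]
      refine continuous_finsetSum _ fun a _ => continuous_finsetSum _ fun b _ => ?_
      exact (by fun_prop : Continuous fun C : ι → ι → ℝ => C a b / 2).mul (ih _)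
  have h : Continuous fun C : ι → ι → ℝ => ∑ m ∈ Finset.range (p.totalDegree + 1),
      ((m.factorial : ℝ)⁻¹ * constantCoeff ((lap C ^ m) p)) :=
    continuous_finsetSum _ fun m _ => (key m p).const_mul _
  exact h

/-- The family `Y` has the joint moments of a family of independent standard normal variables. -/
structure HasNormalMoments {Ω β : Type*} [MeasurableSpace Ω] [Fintype β] (μ : Measure Ω)
    (Y : β → Ω → ℝ) : Prop where
  integrable : ∀ s : β → ℕ, Integrable (fun ω => ∏ b, Y b ω ^ s b) μ
  integral : ∀ s : β → ℕ, ∫ ω, ∏ b, Y b ω ^ s b ∂μ = ∏ b, normalMoment (s b)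

namespace HasNormalMoments

variable {Ω β : Type*} [MeasurableSpace Ω] [Fintype β] {μ : Measure Ω} {Y : β → Ω → ℝ}

lemma eval_monomial_eq (s : β →₀ ℕ) (r : ℝ) (y : β → ℝ) :
    eval y (monomial s r) = r * ∏ b, y b ^ s b := by
  rw [eval_monomial, Finsupp.prod_fintype _ _ fun _ => pow_zero _]

lemma integrable_eval (hY : HasNormalMoments μ Y) (p : MvPolynomial β ℝ) :
    Integrable (fun ω => eval (fun b => Y b ω) p) μ := by
  rw [p.as_sum]
  simp only [map_sum, eval_monomial_eq]
  exact integrable_finsetSum _ fun s _ => (hY.integrable s).const_mul _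

/-- The expectation of a polynomial in the family. -/
def expect (hY : HasNormalMoments μ Y) : MvPolynomial β ℝ →ₗ[ℝ] ℝ where
  toFun p := ∫ ω, eval (fun b => Y b ω) p ∂μ
  map_add' p q := by
    simp only [map_add]
    exact integral_add (hY.integrable_eval p) (hY.integrable_eval q)
  map_smul' r p := by
    simp only [smul_eval, RingHom.id_apply, smul_eq_mul]
    exact integral_const_mul _ _

lemma expect_monomial (hY : HasNormalMoments μ Y) (s : β →₀ ℕ) (r : ℝ) :
    hY.expect (monomial s r) = r * ∏ b, normalMoment (s b) := by
  change ∫ ω, eval (fun b => Y b ω) (monomial s r) ∂μ = _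
  simp only [eval_monomial_eq]
  rw [integral_const_mul, hY.integral]

lemma expect_X_mul (hY : HasNormalMoments μ Y) (b : β) (p : MvPolynomial β ℝ) :
    hY.expect (X b * p) = hY.expect (pderiv b p) := by
  rw [p.as_sum, Finset.mul_sum, map_sum, map_sum, map_sum]
  refine Finset.sum_congr rfl fun s _ => ?_
  rw [X, monomial_mul, one_mul, pderiv_monomial, expect_monomial, expect_monomial,
    ← Finset.mul_prod_erase _ _ (Finset.mem_univ b),
    ← Finset.mul_prod_erase _ _ (Finset.mem_univ b)]
  have h1 : ∏ x ∈ Finset.univ.erase b, normalMoment ((Finsupp.single b 1 + s : β →₀ ℕ) x) =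
      ∏ x ∈ Finset.univ.erase b, normalMoment ((s - Finsupp.single b 1 : β →₀ ℕ) x) := by
    refine Finset.prod_congr rfl fun x hx => ?_
    have : b ≠ x := (Finset.ne_of_mem_erase hx).symm
    simp [this]
  rw [h1]
  simp only [Finsupp.add_apply, Finsupp.single_eq_same, Finsupp.tsub_apply, add_comm 1 (s b),
    normalMoment_succ]
  ring

lemma expect_one (hY : HasNormalMoments μ Y) : hY.expect 1 = 1 := by
  have h := hY.expect_monomial 0 1
  simpa [normalMoment_zero] using h

/-- Substitution of linear forms. -/
def subst (A : ι → β → ℝ) : MvPolynomial ι ℝ →ₐ[ℝ] MvPolynomial β ℝ :=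
  aeval fun a => ∑ b, A a b • X b

lemma eval_subst {κ : Type*} (A : κ → β → ℝ) (y : β → ℝ) (p : MvPolynomial κ ℝ) :
    eval y (subst A p) = eval (fun a => ∑ b, A a b * y b) p := by
  have : (aeval y).comp (subst A) = aeval (R := ℝ) (fun a => ∑ b, A a b * y b) := by
    ext a
    simp [subst]
  exact congrArg (fun F : MvPolynomial κ ℝ →ₐ[ℝ] ℝ => F p) this

lemma pderiv_subst (A : ι → β → ℝ) (b : β) (p : MvPolynomial ι ℝ) :
    pderiv b (subst A p) = ∑ a, A a b • subst A (pderiv a p) := by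
  induction p using MvPolynomial.induction_on with
  | C r => simp [subst]
  | add p q hp hq => simp only [map_add, hp, hq, smul_add, Finset.sum_add_distrib]
  | mul_X p a hp =>
    have hX : pderiv b (subst A (X a)) = C (A a b) := by
      simp [subst, pderiv_X, Pi.single_apply, C_eq_smul_one]
    have e : ∀ a', subst A (pderiv a' (p * X a)) =
        subst A (pderiv a' p) * subst A (X a) + if a = a' then subst A p else 0 := fun a' => by
      rw [pderiv_mul, map_add, map_mul, pderiv_X, Pi.single_apply]
      split_ifs <;> simp
    rw [map_mul, pderiv_mul, hp, hX]
    simp only [e, smul_add, Finset.sum_add_distrib, smul_ite, smul_zero, Finset.sum_ite_eq,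
      Finset.mem_univ, if_true, Finset.sum_mul, smul_mul_assoc]
    rw [mul_comm (subst A p), C_mul']

lemma integrable_eval_linear {κ : Type*} (hY : HasNormalMoments μ Y) (A : κ → β → ℝ)
    (p : MvPolynomial κ ℝ) :
    Integrable (fun ω => eval (fun a => ∑ b, A a b * Y b ω) p) μ := by
  simpa only [eval_subst] using hY.integrable_eval (subst A p)

/-- The expectation satisfies Gaussian integration by parts: apply it in each variable `Y b`, then
use the chain rule `pderiv_subst`. By `eq_wick_of_X_mul` that identifies it as the Wick functional
of the Gram matrix of the coefficients. -/
lemma integral_eval_linear (hY : HasNormalMoments μ Y) (A : ι → β → ℝ) (p : MvPolynomial ι ℝ) :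
    ∫ ω, eval (fun a => ∑ b, A a b * Y b ω) p ∂μ =
      wick (fun a a' => ∑ b, A a b * A a' b) p := by
  have h : hY.expect ∘ₗ (subst A).toLinearMap = wick (fun a a' => ∑ b, A a b * A a' b) := by
    refine eq_wick_of_X_mul (fun a b => by simp only [mul_comm]) _ ?_ fun a p => ?_
    · simpa using hY.expect_one
    · have hX : subst A (X a) = ∑ b, A a b • X b := by simp [subst]
      simp only [LinearMap.comp_apply, AlgHom.toLinearMap_apply, map_mul, hX, Finset.sum_mul,
        smul_mul_assoc, map_sum, map_smul, hY.expect_X_mul, pderiv_subst, smul_eq_mul,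
        Finset.mul_sum]
      rw [Finset.sum_comm]
      exact Finset.sum_congr rfl fun _ _ => Finset.sum_congr rfl fun _ _ => by ring
  have h2 := LinearMap.congr_fun h p
  rw [← h2]
  change _ = ∫ ω, eval (fun b => Y b ω) (subst A p) ∂μ
  simp only [eval_subst]

end HasNormalMoments

lemma hasNormalMoments_pi {β : Type*} [Fintype β] :
    HasNormalMoments (Measure.pi fun _ : β => gaussianReal 0 1) fun b y => y b where
  integrable s := Integrable.fintype_prod (f := fun b y => y ^ s b)
    fun b => integrable_pow_gaussianReal (s b)
  integral s := integral_fintype_prod_eq_prod (f := fun b (y : ℝ) => y ^ s b)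

lemma hasNormalMoments_of_iIndepFun {Ω β : Type*} [MeasurableSpace Ω] [Fintype β] {μ : Measure Ω}
    {Y : β → Ω → ℝ} (hm : ∀ b, Measurable (Y b)) (hi : iIndepFun Y μ)
    (hY : ∀ b, μ.map (Y b) = gaussianReal 0 1) : HasNormalMoments μ Y := by
  have := hi.isProbabilityMeasure
  have hmap : μ.map (fun ω b => Y b ω) = Measure.pi fun _ : β => gaussianReal 0 1 := by
    rw [hi.map_fun_eq_pi_map fun b => (hm b).aemeasurable]
    simp only [hY]
  have hmeas : Measurable fun ω b => Y b ω := measurable_pi_lambda _ hm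
  constructor
  · intro s
    have h := hasNormalMoments_pi.integrable s
    rw [← hmap] at h
    exact h.comp_measurable hmeas
  · intro s
    rw [← hasNormalMoments_pi.integral s, ← hmap, integral_map hmeas.aemeasurable]
    exact (by fun_prop : Measurable fun y : β → ℝ => ∏ b, y b ^ s b).aestronglyMeasurable

/-- Used with one copy of the normals per block of a partition, so that a product of expectations
becomes a single expectation. -/
lemma hasNormalMoments_pi_copies {Ω β κ : Type*} [MeasurableSpace Ω] [Fintype β] [Fintype κ]
    {μ : Measure Ω} [IsProbabilityMeasure μ] {Y : β → Ω → ℝ} (hY : HasNormalMoments μ Y) :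
    HasNormalMoments (Measure.pi fun _ : κ => μ) fun (p : κ × β) ω => Y p.2 (ω p.1) where
  integrable s := by
    simp only [Fintype.prod_prod_type]
    exact Integrable.fintype_prod (f := fun c ω => ∏ b, Y b ω ^ s (c, b))
      fun c => hY.integrable fun b => s (c, b)
  integral s := by
    simp only [Fintype.prod_prod_type]
    rw [integral_fintype_prod_eq_prod (f := fun c ω => ∏ b, Y b ω ^ s (c, b))]
    exact Finset.prod_congr rfl fun c _ => hY.integral fun b => s (c, b)

-- The law is the image of the standard Gaussian law under `√S`, which is symmetric with square `S`;
-- so the Gram matrix in `integral_eval_linear` is `S`.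
open scoped MatrixOrder in
lemma integral_eval_multivariateGaussian [DecidableEq ι] {S : Matrix ι ι ℝ} (hS : S.PosSemidef)
    (p : MvPolynomial ι ℝ) :
    ∫ x, eval (fun a => x a) p ∂multivariateGaussian 0 S = wick S p := by
  have hsa : IsSelfAdjoint (CFC.sqrt S) := IsSelfAdjoint.of_nonneg (CFC.sqrt_nonneg S)
  have hsym : ∀ a b, CFC.sqrt S a b = CFC.sqrt S b a := fun a b => by
    have := congrFun (congrFun hsa.star_eq b) a
    simpa [Matrix.star_apply] using this
  have hsq : CFC.sqrt S * CFC.sqrt S = S := CFC.sqrt_mul_sqrt_self S hS.nonneg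
  have hpoly : Continuous fun x : EuclideanSpace ℝ ι => eval (fun a => x a) p := by
    have := p.continuous_eval
    fun_prop
  rw [multivariateGaussian, ← map_pi_eq_stdGaussian, Measure.map_map (by fun_prop) (by fun_prop),
    integral_map (by fun_prop) hpoly.aestronglyMeasurable]
  have e : ∀ x : ι → ℝ, eval (fun a => (((fun x : EuclideanSpace ℝ ι => 0 +
      (Matrix.toEuclideanCLM (𝕜 := ℝ) (CFC.sqrt S)) x) ∘ WithLp.toLp 2) x) a) p =
      eval (fun a => ∑ b, CFC.sqrt S a b * x b) p := fun x => by
    congr 2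
    simp [Matrix.mulVec, dotProduct]
  simp only [e]
  refine (hasNormalMoments_pi.integral_eval_linear (fun a b => CFC.sqrt S a b) p).trans ?_
  congr 2
  ext a a'
  conv_rhs => rw [← hsq]
  simp only [Matrix.mul_apply]
  exact Finset.sum_congr rfl fun b _ => by rw [hsym a' b]

end Wick

/-! ### Joining bonds to a partition -/

section Bonds

variable {n : ℕ}

lemma le_joinBonds (Γ : Finset (Sym2 (Fin n))) (Θ : Setoid (Fin n)) : Θ ≤ joinBonds Γ Θ :=
  le_sInf fun _ h => h.1

lemma joinBonds_rel {Γ : Finset (Sym2 (Fin n))} (Θ : Setoid (Fin n)) {i j : Fin n}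
    (h : s(i, j) ∈ Γ) : (joinBonds Γ Θ).r i j := by
  intro Ψ hΨ
  exact hΨ.2 _ h i (by simp) j (by simp)

lemma joinBonds_le {Γ : Finset (Sym2 (Fin n))} {Θ Ψ : Setoid (Fin n)} (h : Θ ≤ Ψ)
    (h2 : ∀ i j, s(i, j) ∈ Γ → Ψ.r i j) : joinBonds Γ Θ ≤ Ψ := by
  refine sInf_le ⟨h, fun e he i hi j hj => ?_⟩
  by_cases hij : i = j
  · subst hij
    exact Ψ.refl i
  · rw [(Sym2.mem_and_mem_iff hij).1 ⟨hi, hj⟩] at he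
    exact h2 i j he

lemma joinBonds_empty (Θ : Setoid (Fin n)) : joinBonds ∅ Θ = Θ :=
  le_antisymm (joinBonds_le le_rfl fun _ _ h => by simp at h) (le_joinBonds _ _)

lemma joinBonds_joinBonds (Γ Γ' : Finset (Sym2 (Fin n))) (Θ : Setoid (Fin n)) :
    joinBonds Γ (joinBonds Γ' Θ) = joinBonds (Γ ∪ Γ') Θ := by
  refine le_antisymm (joinBonds_le (joinBonds_le (le_joinBonds _ _) fun i j h => ?_)
    fun i j h => ?_) (joinBonds_le ((le_joinBonds _ _).trans (le_joinBonds _ _)) fun i j h => ?_)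
  · exact joinBonds_rel _ (Finset.mem_union_right _ h)
  · exact joinBonds_rel _ (Finset.mem_union_left _ h)
  · rcases Finset.mem_union.1 h with h | h
    · exact joinBonds_rel _ h
    · exact le_joinBonds _ _ (joinBonds_rel _ h)

lemma joinBonds_insert (e : Sym2 (Fin n)) (Γ : Finset (Sym2 (Fin n))) (Θ : Setoid (Fin n)) :
    joinBonds (insert e Γ) Θ = joinBonds {e} (joinBonds Γ Θ) := by
  rw [joinBonds_joinBonds, Finset.insert_eq]

/-- One bond merges at most two blocks, so a chain never needs to cross it twice, and the relation
on the right is already transitive. -/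
lemma joinBonds_singleton_rel {Ψ : Setoid (Fin n)} {i j x y : Fin n} :
    (joinBonds {s(i, j)} Ψ).r x y ↔ Ψ.r x y ∨ (Ψ.r x i ∧ Ψ.r j y) ∨ (Ψ.r x j ∧ Ψ.r i y) := by
  let Φ : Setoid (Fin n) :=
    { r := fun x y => Ψ.r x y ∨ (Ψ.r x i ∧ Ψ.r j y) ∨ (Ψ.r x j ∧ Ψ.r i y)
      iseqv :=
        { refl := fun x => Or.inl (Ψ.refl x)
          symm := by
            rintro x y (h | ⟨h1, h2⟩ | ⟨h1, h2⟩)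
            · exact Or.inl (Ψ.symm h)
            · exact Or.inr (Or.inr ⟨Ψ.symm h2, Ψ.symm h1⟩)
            · exact Or.inr (Or.inl ⟨Ψ.symm h2, Ψ.symm h1⟩)
          trans := by
            have t : ∀ {a b c}, Ψ.r a b → Ψ.r b c → Ψ.r a c := fun h h' => Ψ.trans h h'
            have s : ∀ {a b}, Ψ.r a b → Ψ.r b a := fun h => Ψ.symm h
            rintro x y z (h | ⟨h1, h2⟩ | ⟨h1, h2⟩) (k | ⟨k1, k2⟩ | ⟨k1, k2⟩)
            · exact Or.inl (t h k)
            · exact Or.inr (Or.inl ⟨t h k1, k2⟩)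
            · exact Or.inr (Or.inr ⟨t h k1, k2⟩)
            · exact Or.inr (Or.inl ⟨h1, t h2 k⟩)
            · exact Or.inl (t h1 (t (s k1) (t (s h2) k2)))
            · exact Or.inl (t h1 k2)
            · exact Or.inr (Or.inr ⟨h1, t h2 k⟩)
            · exact Or.inl (t h1 k2)
            · exact Or.inl (t h1 (t (s k1) (t (s h2) k2))) } }
  constructor
  · intro h
    have hle : joinBonds {s(i, j)} Ψ ≤ Φ := by
      refine joinBonds_le (fun x y h => Or.inl h) fun a b hab => ?_
      rw [Finset.mem_singleton, Sym2.eq_iff] at hab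
      rcases hab with ⟨rfl, rfl⟩ | ⟨rfl, rfl⟩
      · exact Or.inr (Or.inl ⟨Ψ.refl _, Ψ.refl _⟩)
      · exact Or.inr (Or.inr ⟨Ψ.refl _, Ψ.refl _⟩)
    exact hle h
  · have hle := le_joinBonds {s(i, j)} Ψ
    have hij : (joinBonds {s(i, j)} Ψ).r i j := joinBonds_rel _ (by simp)
    rintro (h | ⟨h1, h2⟩ | ⟨h1, h2⟩)
    · exact hle h
    · exact Setoid.trans' _ (hle h1) (Setoid.trans' _ hij (hle h2))
    · exact Setoid.trans' _ (hle h1) (Setoid.trans' _ (Setoid.symm' _ hij) (hle h2))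

lemma joinBonds_singleton_of_rel {Ψ : Setoid (Fin n)} {i j : Fin n} (h : Ψ.r i j) :
    joinBonds {s(i, j)} Ψ = Ψ := by
  refine le_antisymm (joinBonds_le le_rfl fun a b hab => ?_) (le_joinBonds _ _)
  rw [Finset.mem_singleton, Sym2.eq_iff] at hab
  rcases hab with ⟨rfl, rfl⟩ | ⟨rfl, rfl⟩
  · exact h
  · exact Ψ.symm h

lemma numBlocks_joinBonds_singleton {Ψ : Setoid (Fin n)} {i j : Fin n} (h : ¬ Ψ.r i j) :
    numBlocks (joinBonds {s(i, j)} Ψ) + 1 = numBlocks Ψ := by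
  have hle := le_joinBonds {s(i, j)} Ψ
  -- Without the block of `j`, the block of `i` alone represents the merged block.
  let f : {q : Quotient Ψ // q ≠ Quotient.mk Ψ j} → Quotient (joinBonds {s(i, j)} Ψ) :=
    fun q => Quotient.map' (s₁ := Ψ) id (fun _ _ h => hle h) q.1
  have hf : Function.Bijective f := by
    constructor
    · rintro ⟨q, hq⟩ ⟨q', hq'⟩ hqq
      induction q using Quotient.inductionOn with | _ x => ?_
      induction q' using Quotient.inductionOn with | _ y => ?_
      have hxy : (joinBonds {s(i, j)} Ψ).r x y := Quotient.exact hqq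
      rw [Subtype.mk.injEq]
      rcases joinBonds_singleton_rel.1 hxy with h | ⟨h1, h2⟩ | ⟨h1, h2⟩
      · exact Quotient.sound h
      · exact absurd (Quotient.sound (Ψ.symm h2)) hq'
      · exact absurd (Quotient.sound h1) hq
    · intro q
      induction q using Quotient.inductionOn with | _ x => ?_
      by_cases hx : Ψ.r x j
      · refine ⟨⟨Quotient.mk Ψ i, fun hh => h (Quotient.exact hh)⟩, Quotient.sound ?_⟩
        exact joinBonds_singleton_rel.2 (Or.inr (Or.inl ⟨Ψ.refl _, Ψ.symm hx⟩))
      · exact ⟨⟨Quotient.mk Ψ x, fun hh => hx (Quotient.exact hh)⟩, rfl⟩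
  have hc := Nat.card_congr (Equiv.ofBijective f hf)
  rw [numBlocks, numBlocks, ← hc, Nat.card_eq_fintype_card, Nat.card_eq_fintype_card]
  have := Fintype.card_subtype_compl (fun q : Quotient Ψ => q = Quotient.mk Ψ j)
  have h1 : Fintype.card {q : Quotient Ψ // q = Quotient.mk Ψ j} = 1 := Fintype.card_unique
  have h2 : 0 < Fintype.card (Quotient Ψ) := Fintype.card_pos_iff.2 ⟨Quotient.mk Ψ j⟩
  have h3 : Fintype.card {q : Quotient Ψ // q ≠ Quotient.mk Ψ j} =
    Fintype.card {q : Quotient Ψ // ¬ q = Quotient.mk Ψ j} := Fintype.card_congr (Equiv.refl _)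
  omega

lemma numBlocks_pos (hn : 0 < n) (Ψ : Setoid (Fin n)) : 0 < numBlocks Ψ := by
  have : Nonempty (Quotient Ψ) := ⟨Quotient.mk Ψ ⟨0, hn⟩⟩
  exact Nat.card_pos

lemma numBlocks_top (hn : 0 < n) : numBlocks (⊤ : Setoid (Fin n)) = 1 := by
  have : Nonempty (Quotient (⊤ : Setoid (Fin n))) := ⟨Quotient.mk _ ⟨0, hn⟩⟩
  have : Subsingleton (Quotient (⊤ : Setoid (Fin n))) :=
    ⟨fun a b => by
      induction a using Quotient.inductionOn
      induction b using Quotient.inductionOn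
      exact Quotient.sound trivial⟩
  exact Nat.card_unique

lemma eq_top_of_numBlocks_eq_one {Ψ : Setoid (Fin n)} (h : numBlocks Ψ = 1) : Ψ = ⊤ := by
  obtain ⟨hs, -⟩ := Nat.card_eq_one_iff_unique.1 h
  exact Setoid.eq_top_iff.2 fun x y => Quotient.exact (hs.elim (Quotient.mk Ψ x) (Quotient.mk Ψ y))

lemma numBlocks_le_joinBonds_insert (e : Sym2 (Fin n)) (Γ : Finset (Sym2 (Fin n)))
    (Θ : Setoid (Fin n)) :
    numBlocks (joinBonds Γ Θ) ≤ numBlocks (joinBonds (insert e Γ) Θ) + 1 := by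
  rw [joinBonds_insert]
  induction e using Sym2.ind with | _ i j => ?_
  by_cases h : (joinBonds Γ Θ).r i j
  · rw [joinBonds_singleton_of_rel h]
    omega
  · rw [numBlocks_joinBonds_singleton h]

/-- Each bond lowers the number of blocks by at most one. Equality, which is `IsForestOver`, means
that no bond is wasted. -/
lemma numBlocks_le_joinBonds_add_card (Γ : Finset (Sym2 (Fin n))) (Θ : Setoid (Fin n)) :
    numBlocks Θ ≤ numBlocks (joinBonds Γ Θ) + Γ.card := by
  induction Γ using Finset.induction_on with
  | empty => simp [joinBonds_empty]
  | insert e Γ he ih =>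
    have := numBlocks_le_joinBonds_insert e Γ Θ
    rw [Finset.card_insert_of_notMem he]
    omega

/-- The bonds of `Γ` make a forest of the blocks of `Θ`. -/
def IsForestOver (Γ : Finset (Sym2 (Fin n))) (Θ : Setoid (Fin n)) : Prop :=
  numBlocks (joinBonds Γ Θ) + Γ.card = numBlocks Θ

/-- If the smaller set had a wasted bond, the larger one could not attain equality in
`numBlocks_le_joinBonds_add_card`. -/
lemma IsForestOver.of_insert {e : Sym2 (Fin n)} {Γ : Finset (Sym2 (Fin n))} {Θ : Setoid (Fin n)}
    (he : e ∉ Γ) (h : IsForestOver (insert e Γ) Θ) : IsForestOver Γ Θ := by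
  have h1 := numBlocks_le_joinBonds_insert e Γ Θ
  have h2 := numBlocks_le_joinBonds_add_card Γ Θ
  rw [IsForestOver, Finset.card_insert_of_notMem he] at h
  rw [IsForestOver]
  omega

lemma IsForestOver.not_rel_of_insert {i j : Fin n} {Γ : Finset (Sym2 (Fin n))}
    {Θ : Setoid (Fin n)} (he : s(i, j) ∉ Γ) (h : IsForestOver (insert s(i, j) Γ) Θ) :
    ¬ (joinBonds Γ Θ).r i j := by
  intro hij
  have h2 := numBlocks_le_joinBonds_add_card Γ Θ
  rw [IsForestOver, Finset.card_insert_of_notMem he, joinBonds_insert,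
    joinBonds_singleton_of_rel hij] at h
  omega

/-! ### Orbits of permutations and transpositions -/

variable {σ τ θ : Equiv.Perm (Fin n)}

lemma orb_rel {i j : Fin n} : (orb σ).r i j ↔ σ.SameCycle i j := Iff.rfl

lemma sameCycle_apply_self (σ : Equiv.Perm (Fin n)) (i : Fin n) : σ.SameCycle i (σ i) :=
  ⟨1, by simp⟩

lemma orb_le_iff {Ψ : Setoid (Fin n)} : orb σ ≤ Ψ ↔ ∀ i, Ψ.r i (σ i) := by
  constructor
  · intro h i
    exact h (sameCycle_apply_self σ i)
  · rintro h i j ⟨k, rfl⟩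
    have hpow : ∀ (m : ℕ) x, Ψ.r x ((σ ^ m) x) := by
      intro m
      induction m with
      | zero => intro x; exact Ψ.refl x
      | succ m ih =>
        intro x
        rw [pow_succ', Equiv.Perm.mul_apply]
        exact Ψ.trans (ih x) (h _)
    rcases k with k | k
    · exact hpow k i
    · have := hpow (k + 1) ((σ ^ (Int.negSucc k)) i)
      rw [zpow_negSucc, ← Equiv.Perm.mul_apply, mul_inv_cancel, Equiv.Perm.one_apply] at this
      rw [zpow_negSucc]
      exact Ψ.symm this

/-- The modified permutation sends `b` to `σ a` and then follows `σ` as long as the orbit avoids `a`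
and `b`. -/
lemma pow_mul_swap_apply {a b : Fin n} (k : ℕ)
    (h : ∀ j, 0 < j → j ≤ k → (σ ^ j) a ≠ a ∧ (σ ^ j) a ≠ b) :
    ((σ * Equiv.swap a b) ^ (k + 1)) b = (σ ^ (k + 1)) a := by
  induction k with
  | zero => simp
  | succ k ih =>
    have h' := h (k + 1) (by omega) le_rfl
    rw [pow_succ', Equiv.Perm.mul_apply, ih fun j h1 h2 => h j h1 (by omega),
      Equiv.Perm.mul_apply, Equiv.swap_apply_of_ne_of_ne h'.1 h'.2, ← Equiv.Perm.mul_apply,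
      ← pow_succ']

lemma sameCycle_mul_swap {a b : Fin n} (h : ¬ σ.SameCycle a b) :
    (σ * Equiv.swap a b).SameCycle a b := by
  have hex : ∃ k, 0 < k ∧ (σ ^ k) a = a := by
    exact ⟨orderOf σ, orderOf_pos σ, by rw [pow_orderOf_eq_one]; rfl⟩
  have hk := Nat.find_spec hex
  obtain ⟨k, hk'⟩ : ∃ k, Nat.find hex = k + 1 := ⟨Nat.find hex - 1, by omega⟩
  have := pow_mul_swap_apply (σ := σ) (a := a) (b := b) k fun j h1 h2 =>
    ⟨fun hh => Nat.find_min hex (m := j) (by omega) ⟨h1, hh⟩, fun hh => h ⟨j, by simpa using hh⟩⟩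
  rw [← hk', hk.2] at this
  exact Equiv.Perm.SameCycle.symm ⟨(Nat.find hex : ℕ), by simpa using this⟩

/-- A transposition of points in distinct cycles merges these two cycles. Both inclusions are
checked on one application of the permutation, once `a` and `b` are known to be joined. -/
lemma orb_mul_swap {a b : Fin n} (h : ¬ σ.SameCycle a b) :
    orb (σ * Equiv.swap a b) = joinBonds {s(a, b)} (orb σ) := by
  have hab := sameCycle_mul_swap h
  refine le_antisymm (orb_le_iff.2 fun i => ?_) (joinBonds_le (orb_le_iff.2 fun i => ?_) ?_)
  · rw [Equiv.Perm.mul_apply]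
    refine Setoid.trans' _ ?_ (le_joinBonds _ _ (sameCycle_apply_self σ _))
    have hr : (joinBonds {s(a, b)} (orb σ)).r a b := joinBonds_rel _ (by simp)
    by_cases h1 : i = a
    · rw [h1, Equiv.swap_apply_left]; exact hr
    by_cases h2 : i = b
    · rw [h2, Equiv.swap_apply_right]; exact Setoid.symm' _ hr
    · rw [Equiv.swap_apply_of_ne_of_ne h1 h2]
  · have e : σ i = (σ * Equiv.swap a b) (Equiv.swap a b i) := by simp
    rw [e]
    refine Setoid.trans' _ ?_ (sameCycle_apply_self (σ * Equiv.swap a b) (Equiv.swap a b i))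
    by_cases h1 : i = a
    · rw [h1, Equiv.swap_apply_left]; exact hab
    by_cases h2 : i = b
    · rw [h2, Equiv.swap_apply_right]; exact hab.symm
    · rw [Equiv.swap_apply_of_ne_of_ne h1 h2]
  · intro i j hij
    rw [Finset.mem_singleton, Sym2.eq_iff] at hij
    rcases hij with ⟨rfl, rfl⟩ | ⟨rfl, rfl⟩
    · exact hab
    · exact hab.symm

lemma not_sameCycle_mul_swap {a b : Fin n} (hab : a ≠ b) (h : σ.SameCycle a b) :
    ¬ (σ * Equiv.swap a b).SameCycle a b := by
  have hex : ∃ k, 0 < k ∧ (σ ^ k) a = b := by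
    obtain ⟨i, -, h⟩ := h.exists_pow_eq'
    refine ⟨i, Nat.pos_of_ne_zero ?_, h⟩
    rintro rfl
    exact hab (by simpa using h)
  have hk := Nat.find_spec hex
  -- With `K` the first time at which `σ` leads from `a` to `b`, the new orbit of `b` is `σ a, …,
  -- σ^K a = b`, and this does not contain `a`.
  set K := Nat.find hex with hK
  have hmin : ∀ j, 0 < j → j < K → (σ ^ j) a ≠ b := fun j h1 h2 hh =>
    Nat.find_min hex h2 ⟨h1, hh⟩
  have hne : ∀ j, 0 < j → j < K → (σ ^ j) a ≠ a := fun j h1 h2 hh => by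
    refine hmin (K - j) (by omega) (by omega) ?_
    have : (σ ^ K) a = (σ ^ (K - j)) ((σ ^ j) a) := by
      rw [← Equiv.Perm.mul_apply, ← pow_add, Nat.sub_add_cancel h2.le]
    rw [hh] at this
    rw [← this, hk.2]
  set τ := σ * Equiv.swap a b with hτ
  have hpow : ∀ j, 0 < j → j ≤ K → (τ ^ j) b = (σ ^ j) a := fun j h1 h2 => by
    obtain ⟨j, rfl⟩ : ∃ j', j = j' + 1 := ⟨j - 1, by omega⟩
    exact pow_mul_swap_apply j fun i h3 h4 => ⟨hne i h3 (by omega), hmin i h3 (by omega)⟩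
  have hper : (τ ^ K) b = b := by rw [hpow K hk.1 le_rfl, hk.2]
  intro hsc
  obtain ⟨m, -, hm⟩ := hsc.symm.exists_pow_eq'
  have hmod : (τ ^ (m % K)) b = a := by
    have : (τ ^ (K * (m / K))) b = b := by
      rw [pow_mul]
      exact Function.IsFixedPt.perm_pow hper _
    rw [← hm]
    conv_rhs => rw [← Nat.mod_add_div m K, pow_add, Equiv.Perm.mul_apply, this]
  rcases Nat.eq_zero_or_pos (m % K) with h0 | h0
  · rw [h0] at hmod
    exact hab (by simpa using hmod.symm)
  · rw [hpow _ h0 (Nat.mod_lt _ hk.1).le] at hmod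
    exact hne _ h0 (Nat.mod_lt _ hk.1) hmod

end Bonds

/-! ### Transversals of the orbits of a permutation -/

section Transversal

variable {n : ℕ} {σ τ θ : Equiv.Perm (Fin n)} {A B : Finset (Fin n)}

/-- `A` meets every `σ`-orbit in exactly one point. -/
def IsTransversal (σ : Equiv.Perm (Fin n)) (A : Finset (Fin n)) : Prop :=
  ∀ i, ∃! a, a ∈ A ∧ σ.SameCycle i a

/-- The bonds `{i, σ(i)}` with `i ∉ A`. -/
def forestOf (σ : Equiv.Perm (Fin n)) (A : Finset (Fin n)) : Finset (Sym2 (Fin n)) :=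
  Aᶜ.image fun i => s(i, σ i)

lemma mem_forestOf {i j : Fin n} :
    s(i, j) ∈ forestOf σ A ↔ (i ∉ A ∧ σ i = j) ∨ (j ∉ A ∧ σ j = i) := by
  simp only [forestOf, Finset.mem_image, Finset.mem_compl, Sym2.eq_iff]
  constructor
  · rintro ⟨x, hx, ⟨rfl, h⟩ | ⟨rfl, h⟩⟩
    · exact Or.inl ⟨hx, h⟩
    · exact Or.inr ⟨hx, h⟩
  · rintro (⟨h1, h2⟩ | ⟨h1, h2⟩)
    · exact ⟨i, h1, Or.inl ⟨rfl, h2⟩⟩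
    · exact ⟨j, h1, Or.inr ⟨rfl, h2⟩⟩

namespace IsTransversal

lemma eq_of_sameCycle (h : IsTransversal σ A) {a b : Fin n} (ha : a ∈ A) (hb : b ∈ A)
    (hab : σ.SameCycle a b) : a = b :=
  (h a).unique ⟨ha, Equiv.Perm.SameCycle.refl _ _⟩ ⟨hb, hab⟩

lemma exists_mem (h : IsTransversal σ A) (i : Fin n) : ∃ a ∈ A, σ.SameCycle i a := by
  obtain ⟨a, ⟨h1, h2⟩, -⟩ := h i
  exact ⟨a, h1, h2⟩

lemma mem_of_apply_eq (h : IsTransversal σ A) {i : Fin n} (hi : σ i = i) : i ∈ A := by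
  obtain ⟨a, ha, k, rfl⟩ := h.exists_mem i
  rwa [Function.IsFixedPt.perm_zpow hi k] at ha

/-- A two-cycle meets the transversal. -/
lemma mem_or_of_apply_apply (h : IsTransversal σ A) {i j : Fin n} (hi : σ i = j) (hj : σ j = i) :
    i ∈ A ∨ j ∈ A := by
  obtain ⟨a, ha, hia⟩ := h.exists_mem i
  obtain ⟨k, -, hk⟩ := hia.exists_pow_eq'
  have : ∀ k : ℕ, (σ ^ k) i = i ∨ (σ ^ k) i = j := by
    intro k
    induction k with
    | zero => left; rfl
    | succ k ih =>
      rw [pow_succ', Equiv.Perm.mul_apply]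
      rcases ih with ih | ih <;> rw [ih]
      · exact Or.inr hi
      · exact Or.inl hj
  rcases this k with h' | h' <;> rw [hk] at h' <;> subst h'
  · exact Or.inl ha
  · exact Or.inr ha

/-- Deleting the single bond that leaves the cut point turns an orbit into a path on the same
points, which is still connected: from any point, walk forward until the cut point. -/
lemma orb_le_of_forestOf (h : IsTransversal σ A) {Ψ : Setoid (Fin n)}
    (hΨ : ∀ i j, s(i, j) ∈ forestOf σ A → Ψ.r i j) : orb σ ≤ Ψ := by
  have hstep : ∀ i, i ∉ A → Ψ.r i (σ i) := fun i hi => hΨ _ _ (mem_forestOf.2 (Or.inl ⟨hi, rfl⟩))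
  have key : ∀ (k : ℕ) j, (σ ^ k) j ∈ A → ∃ a ∈ A, σ.SameCycle j a ∧ Ψ.r j a := by
    intro k
    induction k with
    | zero => intro j hj; exact ⟨j, hj, Equiv.Perm.SameCycle.refl _ _, Ψ.refl' j⟩
    | succ k ih =>
      intro j hj
      by_cases hjA : j ∈ A
      · exact ⟨j, hjA, Equiv.Perm.SameCycle.refl _ _, Ψ.refl' j⟩
      · rw [pow_succ, Equiv.Perm.mul_apply] at hj
        obtain ⟨a, ha, h1, h2⟩ := ih _ hj
        exact ⟨a, ha, (sameCycle_apply_self σ j).trans h1, Ψ.trans' (hstep j hjA) h2⟩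
  refine orb_le_iff.2 fun i => ?_
  by_cases hi : i ∈ A
  · obtain ⟨a, ha, hia⟩ := h.exists_mem (σ i)
    obtain ⟨k, -, hk⟩ := hia.exists_pow_eq'
    obtain ⟨b, hb, h1, h2⟩ := key k (σ i) (hk ▸ ha)
    have : i = b := h.eq_of_sameCycle hi hb ((sameCycle_apply_self σ i).trans h1)
    exact Ψ.symm' (this ▸ h2)
  · exact hstep i hi

lemma orb_le_joinBonds (h : IsTransversal σ A) (Θ : Setoid (Fin n)) :
    orb σ ≤ joinBonds (forestOf σ A) Θ :=
  h.orb_le_of_forestOf fun _ _ hij => joinBonds_rel _ hij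

/-- Two points could give the same bond only by forming a two-cycle, and one of the two points is
then in `A`. -/
lemma injOn_bond (h : IsTransversal σ A) :
    Set.InjOn (fun i => s(i, σ i)) (↑Aᶜ : Set (Fin n)) := by
  intro i hi j hj hij
  simp only [Finset.coe_compl, Set.mem_compl_iff, Finset.mem_coe] at hi hj
  rcases Sym2.eq_iff.1 hij with ⟨h1, -⟩ | ⟨h1, h2⟩
  · exact h1
  · rcases h.mem_or_of_apply_apply h2 h1.symm with h' | h'
    · exact absurd h' hi
    · exact absurd h' hj

lemma card_forestOf (h : IsTransversal σ A) : (forestOf σ A).card + A.card = n := by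
  rw [forestOf, Finset.card_image_of_injOn h.injOn_bond, Finset.card_compl, Fintype.card_fin]
  have := A.card_le_univ
  rw [Fintype.card_fin] at this
  omega

lemma numBlocks_orb (h : IsTransversal σ A) : numBlocks (orb σ) = A.card := by
  let f : A → Quotient (orb σ) := fun a => Quotient.mk _ a.1
  have hf : Function.Bijective f := by
    constructor
    · intro a b hab
      exact Subtype.ext (h.eq_of_sameCycle a.2 b.2 (Quotient.exact hab))
    · intro q
      induction q using Quotient.inductionOn with | _ x => ?_
      obtain ⟨a, ha, hxa⟩ := h.exists_mem x
      exact ⟨⟨a, ha⟩, Quotient.sound hxa.symm⟩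
  rw [numBlocks, ← Nat.card_congr (Equiv.ofBijective f hf)]
  simp

lemma one_of_eq_univ (h : IsTransversal σ Finset.univ) : σ = 1 :=
  Equiv.ext fun i => (h.eq_of_sameCycle (Finset.mem_univ _) (Finset.mem_univ _)
    (sameCycle_apply_self σ i)).symm

/-- Cutting the bond `{i, σ(i)}` splits the orbit of `i` into two. -/
lemma insert_mul_swap (h : IsTransversal σ A) {i a : Fin n} (hi : i ∉ A) (ha : a ∈ A)
    (hia : σ.SameCycle i a) : ¬ (σ * Equiv.swap i a).SameCycle i a ∧
      IsTransversal (σ * Equiv.swap i a) (insert i A) := by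
  have hne : i ≠ a := fun hh => hi (hh ▸ ha)
  have hnot := not_sameCycle_mul_swap hne hia
  have horb : orb σ = joinBonds {s(i, a)} (orb (σ * Equiv.swap i a)) := by
    rw [← orb_mul_swap hnot, mul_assoc, Equiv.swap_mul_self, mul_one]
  refine ⟨hnot, fun j => ?_⟩
  have hle : ∀ x y, (σ * Equiv.swap i a).SameCycle x y → σ.SameCycle x y := fun x y hxy => by
    rw [← orb_rel, horb]
    exact le_joinBonds _ _ hxy
  have huniq : ∀ x y, x ∈ insert i A → y ∈ insert i A → (σ * Equiv.swap i a).SameCycle x y →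
      x = y := by
    intro x y hx hy hxy
    rcases Finset.mem_insert.1 hx with hxi | hxA <;> rcases Finset.mem_insert.1 hy with hyi | hyA
    · rw [hxi, hyi]
    · subst hxi
      have : a = y := h.eq_of_sameCycle ha hyA (hia.symm.trans (hle _ _ hxy))
      exact absurd (this ▸ hxy) hnot
    · subst hyi
      have : a = x := h.eq_of_sameCycle ha hxA (hia.symm.trans (hle _ _ hxy).symm)
      exact absurd (this ▸ hxy.symm) hnot
    · exact h.eq_of_sameCycle hxA hyA (hle _ _ hxy)
  obtain ⟨x, hx, hjx⟩ : ∃ x ∈ insert i A, (σ * Equiv.swap i a).SameCycle j x := by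
    obtain ⟨b, hb, hjb⟩ := h.exists_mem j
    rw [← orb_rel, horb] at hjb
    rcases joinBonds_singleton_rel.1 hjb with h' | ⟨h', -⟩ | ⟨h', -⟩
    · exact ⟨b, Finset.mem_insert_of_mem hb, h'⟩
    · exact ⟨i, Finset.mem_insert_self _ _, h'⟩
    · exact ⟨a, Finset.mem_insert_of_mem ha, h'⟩
  exact ⟨x, ⟨hx, hjx⟩, fun y hy => huniq y x hy.1 hx (hy.2.symm.trans hjx)⟩

/-- The transposition changes the permutation only at `i` and `a`. Both lie in the new transversal,
so exactly the bond leaving `i` disappears. -/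
lemma forestOf_insert_mul_swap (h : IsTransversal σ A) {i a : Fin n} (hi : i ∉ A) (ha : a ∈ A) :
    forestOf σ A = insert s(i, σ i) (forestOf (σ * Equiv.swap i a) (insert i A)) ∧
      s(i, σ i) ∉ forestOf (σ * Equiv.swap i a) (insert i A) := by
  have e : Aᶜ = insert i (insert i A)ᶜ := by
    ext x
    by_cases hx : x = i <;> simp [hx, hi]
  have e2 : forestOf (σ * Equiv.swap i a) (insert i A) =
      (insert i A)ᶜ.image fun j => s(j, σ j) := by
    refine Finset.image_congr fun j hj => ?_
    simp only [Finset.coe_compl, Finset.coe_insert, Set.mem_compl_iff, Set.mem_insert_iff,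
      Finset.mem_coe, not_or] at hj
    simp only [Equiv.Perm.mul_apply]
    rw [Equiv.swap_apply_of_ne_of_ne hj.1 (fun hh => hj.2 (hh ▸ ha))]
  rw [e2]
  constructor
  · rw [forestOf, e, Finset.image_insert]
  · intro hh
    obtain ⟨j, hj, hji⟩ := Finset.mem_image.1 hh
    rw [Finset.mem_compl, Finset.mem_insert, not_or] at hj
    exact hj.1 (h.injOn_bond (by simpa using hj.2) (by simpa using hi) hji)

/-- If the bonds `{i, σ(i)}` with `i` off a transversal make a forest of the orbits of `θ`, then
the orbits of `θ σ` are obtained by joining these bonds to the orbits of `θ`. -/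
lemma orb_mul_eq (h : IsTransversal σ A) (hF : IsForestOver (forestOf σ A) (orb θ)) :
    orb (θ * σ) = joinBonds (forestOf σ A) (orb θ) := by
  induction hm : Aᶜ.card generalizing σ A with
  | zero =>
    have hA : A = Finset.univ := by
      rw [← Finset.compl_eq_empty_iff, ← Finset.card_eq_zero, hm]
    subst hA
    rw [h.one_of_eq_univ, mul_one]
    simp [forestOf, joinBonds_empty]
  | succ m ih =>
    obtain ⟨i, hi⟩ : Aᶜ.Nonempty := by rw [← Finset.card_pos, hm]; omega
    rw [Finset.mem_compl] at hi
    obtain ⟨a, ha, hia⟩ := h.exists_mem i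
    obtain ⟨-, ht⟩ := h.insert_mul_swap hi ha hia
    obtain ⟨hf, hnm⟩ := h.forestOf_insert_mul_swap hi ha
    rw [hf] at hF ⊢
    have hc : (insert i A)ᶜ.card = m := by
      rw [Finset.card_compl, Finset.card_insert_of_notMem hi]
      rw [Finset.card_compl] at hm
      omega
    have ih' := ih ht (hF.of_insert hnm) hc
    have hnr := hF.not_rel_of_insert hnm
    -- The cut permutation sends `a` to `σ i`. So modulo the remaining bonds `a` and `σ i` are
    -- equivalent, and the bond `{i, σ i}` has the same effect as the transposition of `i` and `a`.
    have haσ : (joinBonds (forestOf (σ * Equiv.swap i a) (insert i A)) (orb θ)).r a (σ i) := by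
      refine ht.orb_le_joinBonds _ ?_
      have := sameCycle_apply_self (σ * Equiv.swap i a) a
      rwa [Equiv.Perm.mul_apply, Equiv.swap_apply_right] at this
    -- The forest hypothesis enters here: the bond joins distinct blocks, so multiplying by the
    -- transposition merges cycles and does not split one.
    have hnr' : ¬ (θ * (σ * Equiv.swap i a)).SameCycle i a := fun hh => by
      rw [← orb_rel, ih'] at hh
      exact hnr (Setoid.trans' _ hh haσ)
    have e : θ * σ = θ * (σ * Equiv.swap i a) * Equiv.swap i a := by
      rw [mul_assoc, mul_assoc, Equiv.swap_mul_self, mul_one]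
    rw [e, orb_mul_swap hnr', ih', joinBonds_insert]
    refine le_antisymm (joinBonds_le (le_joinBonds _ _) ?_) (joinBonds_le (le_joinBonds _ _) ?_)
    · have hr : (joinBonds {s(i, σ i)}
          (joinBonds (forestOf (σ * Equiv.swap i a) (insert i A)) (orb θ))).r i a :=
        Setoid.trans' _ (joinBonds_rel _ (by simp)) (Setoid.symm' _ (le_joinBonds _ _ haσ))
      intro x y hxy
      rw [Finset.mem_singleton, Sym2.eq_iff] at hxy
      rcases hxy with ⟨rfl, rfl⟩ | ⟨rfl, rfl⟩
      · exact hr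
      · exact Setoid.symm' _ hr
    · have hr : (joinBonds {s(i, a)}
          (joinBonds (forestOf (σ * Equiv.swap i a) (insert i A)) (orb θ))).r i (σ i) :=
        Setoid.trans' _ (joinBonds_rel _ (by simp)) (le_joinBonds _ _ haσ)
      intro x y hxy
      rw [Finset.mem_singleton, Sym2.eq_iff] at hxy
      rcases hxy with ⟨rfl, rfl⟩ | ⟨rfl, rfl⟩
      · exact hr
      · exact Setoid.symm' _ hr

end IsTransversal

/-! ### Reversing orbits -/

/-- The permutation which is `σ⁻¹` on the `σ`-invariant set `U` and `σ` elsewhere. -/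
def flipPerm (σ : Equiv.Perm (Fin n)) (U : Set (Fin n)) (hU : ∀ i, σ i ∈ U ↔ i ∈ U) :
    Equiv.Perm (Fin n) where
  toFun i := if i ∈ U then σ⁻¹ i else σ i
  invFun i := if i ∈ U then σ i else σ⁻¹ i
  left_inv i := by
    have hsymm : σ.symm i ∈ U ↔ i ∈ U := by rw [← hU (σ.symm i)]; simp
    by_cases hi : i ∈ U <;> simp [hi, hU, hsymm]
  right_inv i := by
    have hsymm : σ.symm i ∈ U ↔ i ∈ U := by rw [← hU (σ.symm i)]; simp
    by_cases hi : i ∈ U <;> simp [hi, hU, hsymm]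

/-- The transversal of the reversed permutation. -/
def flipSet (σ : Equiv.Perm (Fin n)) (U : Set (Fin n)) (A : Finset (Fin n)) : Finset (Fin n) :=
  A.image fun a => if a ∈ U then σ a else a

section Flip

variable {U : Set (Fin n)} (hU : ∀ i, σ i ∈ U ↔ i ∈ U)

lemma flipPerm_of_mem {i : Fin n} (hi : i ∈ U) : flipPerm σ U hU i = σ⁻¹ i := if_pos hi

lemma flipPerm_of_notMem {i : Fin n} (hi : i ∉ U) : flipPerm σ U hU i = σ i := if_neg hi

lemma inv_mem_iff {U : Set (Fin n)} (hU : ∀ i, σ i ∈ U ↔ i ∈ U) (i : Fin n) : σ⁻¹ i ∈ U ↔ i ∈ U := by rw [← hU (σ⁻¹ i)]; simp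

lemma orb_flipPerm : orb (flipPerm σ U hU) = orb σ := by
  refine le_antisymm (orb_le_iff.2 fun i => ?_) (orb_le_iff.2 fun i => ?_)
  · by_cases hi : i ∈ U
    · rw [flipPerm_of_mem hU hi]
      exact ⟨-1, by simp⟩
    · rw [flipPerm_of_notMem hU hi]
      exact sameCycle_apply_self σ i
  · by_cases hi : i ∈ U
    · have : flipPerm σ U hU (σ i) = i := by rw [flipPerm_of_mem hU ((hU i).2 hi)]; simp
      have h2 := sameCycle_apply_self (flipPerm σ U hU) (σ i)
      rw [this] at h2
      exact h2.symm
    · rw [← flipPerm_of_notMem hU hi]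
      exact sameCycle_apply_self _ i

lemma sameCycle_flipPerm {i j : Fin n} :
    (flipPerm σ U hU).SameCycle i j ↔ σ.SameCycle i j := by
  rw [← orb_rel, orb_flipPerm, orb_rel]

lemma mem_flipSet_of_notMem {U : Set (Fin n)} (hU : ∀ i, σ i ∈ U ↔ i ∈ U) {i : Fin n} (hi : i ∉ U) : i ∈ flipSet σ U A ↔ i ∈ A := by
  simp only [flipSet, Finset.mem_image]
  constructor
  · rintro ⟨a, ha, h⟩
    split_ifs at h with haU
    · exact absurd (h ▸ (hU a).2 haU) hi
    · exact h ▸ ha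
  · intro h
    exact ⟨i, h, if_neg hi⟩

lemma mem_flipSet_of_mem {U : Set (Fin n)} (hU : ∀ i, σ i ∈ U ↔ i ∈ U) {i : Fin n} (hi : i ∈ U) : i ∈ flipSet σ U A ↔ σ⁻¹ i ∈ A := by
  simp only [flipSet, Finset.mem_image]
  constructor
  · rintro ⟨a, ha, h⟩
    split_ifs at h with haU
    · rw [← h]; simpa using ha
    · exact absurd (h ▸ hi) haU
  · intro h
    exact ⟨σ⁻¹ i, h, by rw [if_pos ((inv_mem_iff hU i).2 hi)]; simp⟩

lemma IsTransversal.flip (h : IsTransversal σ A) :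
    IsTransversal (flipPerm σ U hU) (flipSet σ U A) := by
  have hs : ∀ a, σ.SameCycle a (if a ∈ U then σ a else a) := fun a => by
    split_ifs
    · exact sameCycle_apply_self σ a
    · exact Equiv.Perm.SameCycle.refl _ _
  intro i
  obtain ⟨a, ha, hia⟩ := h.exists_mem i
  refine ⟨if a ∈ U then σ a else a, ⟨Finset.mem_image_of_mem _ ha,
    (sameCycle_flipPerm hU).2 (hia.trans (hs a))⟩, ?_⟩
  rintro y ⟨hy, hiy⟩
  obtain ⟨b, hb, rfl⟩ := Finset.mem_image.1 hy
  have hib := ((sameCycle_flipPerm hU).1 hiy).trans (hs b).symm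
  rw [h.eq_of_sameCycle hb ha (hib.symm.trans hia)]

/-- Reversing an orbit reverses its path. The missing bond `{a, σ a}` stays the same but now leaves
`σ a`, which explains `flipSet`. -/
lemma forestOf_flip : forestOf (flipPerm σ U hU) (flipSet σ U A) = forestOf σ A := by
  ext e
  induction e using Sym2.ind with | _ i j => ?_
  have key : ∀ x y, (x ∉ flipSet σ U A ∧ flipPerm σ U hU x = y) ↔
      if x ∈ U then y ∉ A ∧ σ y = x else x ∉ A ∧ σ x = y := by
    intro x y
    by_cases hx : x ∈ U
    · rw [if_pos hx, mem_flipSet_of_mem hU hx, flipPerm_of_mem hU hx]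
      constructor
      · rintro ⟨h1, rfl⟩
        exact ⟨h1, by simp⟩
      · rintro ⟨h1, rfl⟩
        exact ⟨by simpa using h1, by simp⟩
    · rw [if_neg hx, mem_flipSet_of_notMem hU hx, flipPerm_of_notMem hU hx]
  rw [mem_forestOf, mem_forestOf, key, key]
  by_cases hi : i ∈ U <;> by_cases hj : j ∈ U
  · simp only [hi, hj, if_true]
    tauto
  · simp only [hi, hj, if_true, if_false]
    have h1 : σ i ≠ j := fun h => hj (h ▸ (hU i).2 hi)
    have h2 : σ j ≠ i := fun h => hj ((hU j).1 (h ▸ hi))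
    tauto
  · simp only [hi, hj, if_true, if_false]
    have h1 : σ j ≠ i := fun h => hi (h ▸ (hU j).2 hj)
    have h2 : σ i ≠ j := fun h => hi ((hU i).1 (h ▸ hj))
    tauto
  · simp only [hi, hj, if_false]

end Flip

end Transversal

section Rigidity

variable {n : ℕ} {σ σ₀ : Equiv.Perm (Fin n)} {A A₀ : Finset (Fin n)}

/-! ### Pairs with the same linear forest -/

/-- A path with a prescribed final point can be read off from its bonds by walking backwards; this
is one step of the walk. -/
lemma inv_pow_succ_apply_of_ne (h₀ : IsTransversal σ₀ A₀)
    (hf : forestOf σ A = forestOf σ₀ A₀) {a : Fin n} (ha : a ∈ A) (ha₀ : a ∈ A₀) {m : ℕ}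
    (hm : ∀ k ≤ m, (σ⁻¹ ^ k) a = (σ₀⁻¹ ^ k) a) (hne : (σ₀⁻¹ ^ (m + 1)) a ≠ a) :
    (σ⁻¹ ^ (m + 1)) a = (σ₀⁻¹ ^ (m + 1)) a := by
  have hcyc : ∀ k : ℕ, σ₀.SameCycle ((σ₀⁻¹ ^ k) a) a := fun k => ⟨k, by simp⟩
  have hstep : ∀ (τ : Equiv.Perm (Fin n)) (k : ℕ), τ ((τ⁻¹ ^ (k + 1)) a) = (τ⁻¹ ^ k) a :=
    fun τ k => by
      rw [pow_succ', Equiv.Perm.mul_apply]; simp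
  have hd : (σ₀⁻¹ ^ (m + 1)) a ∉ A₀ := fun hh => hne (h₀.eq_of_sameCycle hh ha₀ (hcyc _))
  have hmem : s((σ₀⁻¹ ^ (m + 1)) a, (σ₀⁻¹ ^ m) a) ∈ forestOf σ A := by
    rw [hf]
    exact mem_forestOf.2 (Or.inl ⟨hd, hstep σ₀ m⟩)
  rcases mem_forestOf.1 hmem with ⟨-, h1⟩ | ⟨h1, h2⟩
  · rw [pow_succ', Equiv.Perm.mul_apply, hm m le_rfl, ← h1]
    simp
  -- If `σ` traversed the bond in the other direction, its two ends would form a two-cycle of `σ₀`,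
  -- and neither end can be the point of `A₀` on that cycle.
  · rcases m with _ | m
    · exact absurd ha h1
    · have e1 : σ₀ ((σ₀⁻¹ ^ (m + 1)) a) = (σ₀⁻¹ ^ (m + 1 + 1)) a := by
        rw [hstep, ← h2, ← hm (m + 1) le_rfl, hstep, hm m (by omega)]
      rcases h₀.mem_or_of_apply_apply e1 (hstep σ₀ (m + 1)) with h' | h'
      · rw [h₀.eq_of_sameCycle h' ha₀ (hcyc _)] at h1
        exact absurd ha h1
      · exact absurd h' hd

lemma inv_pow_apply_eq (h : IsTransversal σ A) (h₀ : IsTransversal σ₀ A₀)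
    (hf : forestOf σ A = forestOf σ₀ A₀) {a : Fin n} (ha : a ∈ A) (ha₀ : a ∈ A₀) (m : ℕ) :
    (σ⁻¹ ^ m) a = (σ₀⁻¹ ^ m) a := by
  induction m using Nat.strong_induction_on with
  | _ m ih =>
    rcases m with _ | m
    · rfl
    · by_cases h1 : (σ₀⁻¹ ^ (m + 1)) a = a
      · by_cases h2 : (σ⁻¹ ^ (m + 1)) a = a
        · rw [h1, h2]
        · exact (inv_pow_succ_apply_of_ne h hf.symm ha₀ ha
            (fun k hk => (ih k (by omega)).symm) h2).symm
      · exact inv_pow_succ_apply_of_ne h₀ hf ha ha₀ (fun k hk => ih k (by omega)) h1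

lemma apply_eq_of_forestOf_eq (h : IsTransversal σ A) (h₀ : IsTransversal σ₀ A₀)
    (hf : forestOf σ A = forestOf σ₀ A₀) {a : Fin n} (ha : a ∈ A) (ha₀ : a ∈ A₀) {j : Fin n}
    (hj : σ₀.SameCycle a j) : σ j = σ₀ j := by
  obtain ⟨i, hi, -, rfl⟩ := (Equiv.Perm.sameCycle_inv.2 hj).exists_pow_eq''
  obtain ⟨i, rfl⟩ : ∃ i', i = i' + 1 := ⟨i - 1, by omega⟩
  have e := inv_pow_apply_eq h h₀ hf ha ha₀
  have hstep : ∀ (τ : Equiv.Perm (Fin n)) (k : ℕ), τ ((τ⁻¹ ^ (k + 1)) a) = (τ⁻¹ ^ k) a :=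
    fun τ k => by
      rw [pow_succ', Equiv.Perm.mul_apply]; simp
  rw [hstep, ← e (i + 1), hstep, e]

/-- A point of `A₀` is an end of its path, so it carries at most one bond. If `σ` uses a bond
leaving `a`, the one entering `a` must be cut. -/
lemma inv_mem_of_notMem (h : IsTransversal σ A) (hf : forestOf σ A = forestOf σ₀ A₀) {a : Fin n}
    (ha : a ∉ A) (ha₀ : a ∈ A₀) : σ⁻¹ a ∈ A := by
  by_contra hc
  have h1 : s(σ⁻¹ a, a) ∈ forestOf σ₀ A₀ := hf ▸ mem_forestOf.2 (Or.inl ⟨hc, by simp⟩)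
  have h2 : s(a, σ a) ∈ forestOf σ₀ A₀ := hf ▸ mem_forestOf.2 (Or.inl ⟨ha, rfl⟩)
  have e1 : σ₀ (σ⁻¹ a) = a := by
    rcases mem_forestOf.1 h1 with ⟨-, h⟩ | ⟨h, -⟩
    · exact h
    · exact absurd ha₀ h
  have e2 : σ₀ (σ a) = a := by
    rcases mem_forestOf.1 h2 with ⟨h, -⟩ | ⟨-, h⟩
    · exact absurd ha₀ h
    · exact h
  have e3 : σ⁻¹ a = σ a := σ₀.injective (e1.trans e2.symm)
  rcases h.mem_or_of_apply_apply (i := a) (j := σ a) rfl (by rw [← e3]; simp) with h' | h'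
  · exact ha h'
  · exact hc (e3 ▸ h')

/-- Reversing every orbit of `σ` reduces this to `apply_eq_of_forestOf_eq`. -/
lemma inv_apply_eq_of_forestOf_eq (h : IsTransversal σ A) (h₀ : IsTransversal σ₀ A₀)
    (hf : forestOf σ A = forestOf σ₀ A₀) {a : Fin n} (ha : a ∉ A) (ha₀ : a ∈ A₀) {j : Fin n}
    (hj : σ₀.SameCycle a j) : σ⁻¹ j = σ₀ j := by
  have hU : ∀ i, σ i ∈ (Set.univ : Set (Fin n)) ↔ i ∈ (Set.univ : Set (Fin n)) := by simp
  have := apply_eq_of_forestOf_eq (h.flip hU) h₀ ((forestOf_flip hU).trans hf)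
    ((mem_flipSet_of_mem hU (Set.mem_univ a)).2 (inv_mem_of_notMem h hf ha ha₀)) ha₀ hj
  rwa [flipPerm_of_mem hU (Set.mem_univ j)] at this

lemma IsTransversal.eq_of_subset {B : Finset (Fin n)} (hA : IsTransversal σ A)
    (hB : IsTransversal σ B) (h : B ⊆ A) : B = A := by
  refine Finset.Subset.antisymm h fun a ha => ?_
  obtain ⟨b, hb, hab⟩ := hB.exists_mem a
  rwa [hA.eq_of_sameCycle ha (h hb) hab]

lemma mem_saturation_iff (S : Finset (Fin n)) (i : Fin n) :
    σ i ∈ {j | ∃ a ∈ S, σ.SameCycle a j} ↔ i ∈ {j | ∃ a ∈ S, σ.SameCycle a j} := by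
  simp

lemma support_flipPerm {U : Set (Fin n)} (hU : ∀ i, σ i ∈ U ↔ i ∈ U) :
    (flipPerm σ U hU).support = σ.support := by
  ext i
  rw [Equiv.Perm.mem_support, Equiv.Perm.mem_support]
  by_cases hi : i ∈ U
  · rw [flipPerm_of_mem hU hi, ne_eq, Equiv.Perm.inv_eq_iff_eq, eq_comm]
  · rw [flipPerm_of_notMem hU hi]

lemma IsTransversal.card_inter_support (h : IsTransversal σ A) :
    (A ∩ σ.support).card + σ.supportᶜ.card = A.card := by
  have : σ.supportᶜ = A \ σ.support := by
    ext i
    simp only [Finset.mem_compl, Finset.mem_sdiff, Equiv.Perm.mem_support, not_not]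
    exact ⟨fun hi => ⟨h.mem_of_apply_eq hi, hi⟩, fun hi => hi.2⟩
  rw [this, Finset.card_inter_add_card_sdiff]

/-- The pairs (permutation, transversal) with a given linear forest have total weight one. -/
lemma sum_transversals (h₀ : IsTransversal σ₀ A₀) :
    ∑ x ∈ (Finset.univ : Finset (Equiv.Perm (Fin n) × Finset (Fin n))).filter
      (fun x => IsTransversal x.1 x.2 ∧ forestOf x.1 x.2 = forestOf σ₀ A₀),
      (2 : ℝ)⁻¹ ^ (x.2 ∩ x.1.support).card = 1 := by
  -- Subsets `S` of the nontrivial cut points encode which paths are reversed; there are as many as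
  -- the weights require.
  have hsum : ∑ _S ∈ (A₀ ∩ σ₀.support).powerset, (2 : ℝ)⁻¹ ^ (A₀ ∩ σ₀.support).card = 1 := by
    rw [Finset.sum_const, Finset.card_powerset, nsmul_eq_mul]
    push_cast
    rw [← mul_pow]
    norm_num
  -- Reversing a nontrivial path moves its cut point, so `S` is recovered as the part of `A₀`
  -- missing from the new transversal.
  have hrec : ∀ S ⊆ A₀ ∩ σ₀.support, ∀ a,
      a ∈ S ↔ a ∈ A₀ ∧ a ∉ flipSet σ₀ {j | ∃ a ∈ S, σ₀.SameCycle a j} A₀ := by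
    intro S hS a
    constructor
    · intro ha
      have haS := Finset.mem_inter.1 (hS ha)
      refine ⟨haS.1, fun hh => ?_⟩
      rw [mem_flipSet_of_mem (mem_saturation_iff S) ⟨a, ha, Equiv.Perm.SameCycle.refl _ _⟩] at hh
      have := h₀.eq_of_sameCycle hh haS.1 ⟨1, by simp⟩
      rw [Equiv.Perm.inv_eq_iff_eq] at this
      exact Equiv.Perm.mem_support.1 haS.2 this.symm
    · rintro ⟨h1, h2⟩
      by_cases haU : a ∈ {j | ∃ a ∈ S, σ₀.SameCycle a j}
      · obtain ⟨b, hb, hba⟩ := haU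
        rwa [← h₀.eq_of_sameCycle (Finset.mem_inter.1 (hS hb)).1 h1 hba]
      · rw [mem_flipSet_of_notMem (mem_saturation_iff S) haU] at h2
        exact absurd h1 h2
  rw [← hsum]
  symm
  refine Finset.sum_bij (fun S _ => (flipPerm σ₀ {j | ∃ a ∈ S, σ₀.SameCycle a j}
    (mem_saturation_iff S), flipSet σ₀ {j | ∃ a ∈ S, σ₀.SameCycle a j} A₀)) ?_ ?_ ?_ ?_
  · intro S _
    rw [Finset.mem_filter]
    exact ⟨Finset.mem_univ _, h₀.flip (mem_saturation_iff S),
      forestOf_flip (mem_saturation_iff S)⟩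
  · intro S hS S' hS' he
    ext a
    rw [hrec S (Finset.mem_powerset.1 hS), hrec S' (Finset.mem_powerset.1 hS'),
      show flipSet σ₀ _ A₀ = flipSet σ₀ _ A₀ from congrArg Prod.snd he]
  · rintro ⟨σ, A⟩ hx
    obtain ⟨-, h, hf⟩ := Finset.mem_filter.1 hx
    simp only at h hf
    -- A fixed point of `σ₀` meets no bond, so it cannot be missing from `A`.
    have hS : A₀ \ A ⊆ A₀ ∩ σ₀.support := by
      intro a ha
      obtain ⟨ha₀, haA⟩ := Finset.mem_sdiff.1 ha
      refine Finset.mem_inter.2 ⟨ha₀, Equiv.Perm.mem_support.2 fun hfix => ?_⟩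
      have h2 : s(a, σ a) ∈ forestOf σ₀ A₀ := hf ▸ mem_forestOf.2 (Or.inl ⟨haA, rfl⟩)
      rcases mem_forestOf.1 h2 with ⟨h, -⟩ | ⟨h3, h4⟩
      · exact h ha₀
      · rw [σ₀.injective (h4.trans hfix.symm)] at h3
        exact h3 ha₀
    refine ⟨A₀ \ A, Finset.mem_powerset.2 hS, ?_⟩
    set U : Set (Fin n) := {j | ∃ a ∈ A₀ \ A, σ₀.SameCycle a j} with hUdef
    have hUmem : ∀ a ∈ A₀, ∀ j, σ₀.SameCycle a j → (j ∈ U ↔ a ∉ A) := by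
      intro a ha j haj
      constructor
      · rintro ⟨b, hb, hbj⟩
        obtain ⟨hb1, hb2⟩ := Finset.mem_sdiff.1 hb
        rwa [h₀.eq_of_sameCycle ha hb1 (haj.trans hbj.symm)]
      · intro haA
        exact ⟨a, Finset.mem_sdiff.2 ⟨ha, haA⟩, haj⟩
    -- On each orbit of `σ₀`, the permutation `σ` is `σ₀` or its inverse, according to whether the
    -- two transversals share the cut point.
    have hperm : flipPerm σ₀ U (mem_saturation_iff _) = σ := by
      ext1 j
      obtain ⟨a, ha, hja⟩ := h₀.exists_mem j
      by_cases haA : a ∈ A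
      · rw [flipPerm_of_notMem _ (fun hj => (hUmem a ha j hja.symm).1 hj haA)]
        exact (apply_eq_of_forestOf_eq h h₀ hf haA ha hja.symm).symm
      · rw [flipPerm_of_mem _ ((hUmem a ha j hja.symm).2 haA)]
        have := inv_apply_eq_of_forestOf_eq h h₀ hf haA ha (j := σ₀⁻¹ j)
          (hja.symm.trans ⟨-1, by simp⟩)
        rw [Equiv.Perm.inv_eq_iff_eq] at this
        simpa using this
    have hset : flipSet σ₀ U A₀ = A := by
      have ht := h₀.flip (mem_saturation_iff (A₀ \ A))
      rw [hperm] at ht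
      refine h.eq_of_subset ht fun y hy => ?_
      obtain ⟨a, ha, rfl⟩ := Finset.mem_image.1 hy
      have hUa := hUmem a ha a (Equiv.Perm.SameCycle.refl _ _)
      split_ifs with haU
      · rw [← inv_apply_eq_of_forestOf_eq h h₀ hf (hUa.1 haU) ha (Equiv.Perm.SameCycle.refl _ _)]
        exact inv_mem_of_notMem h hf (hUa.1 haU) ha
      · by_contra hc
        exact haU (hUa.2 hc)
    rw [hperm, hset]
  · intro S _
    simp only
    congr 1
    have h1 := (h₀.flip (mem_saturation_iff S)).card_inter_support
    have h2 := h₀.card_inter_support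
    have h3 := (h₀.flip (mem_saturation_iff S)).numBlocks_orb
    rw [orb_flipPerm, h₀.numBlocks_orb] at h3
    rw [support_flipPerm] at h1 ⊢
    omega

/-! ### Cycle-cuttings and transversals -/

/-- Adding the fixed points treats all orbits uniformly; they contribute no bond, so the linear
forest is unchanged. -/
lemma IsCycleCutting.isTransversal (h : IsCycleCutting σ A) :
    IsTransversal σ (A ∪ σ.supportᶜ) := by
  intro i
  by_cases hi : i ∈ σ.support
  · obtain ⟨a, ⟨ha, hia⟩, hu⟩ := h.2 i hi
    refine ⟨a, ⟨Finset.mem_union_left _ ha, hia⟩, ?_⟩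
    rintro y ⟨hy, hiy⟩
    rcases Finset.mem_union.1 hy with hy | hy
    · exact hu y ⟨hy, hiy⟩
    · rw [Finset.mem_compl, Equiv.Perm.mem_support, not_not] at hy
      obtain ⟨k, rfl⟩ := hiy.symm
      rw [Function.IsFixedPt.perm_zpow hy k, Equiv.Perm.mem_support] at hi
      exact absurd hy hi
  · have hfix : σ i = i := by rwa [Equiv.Perm.mem_support, not_not] at hi
    refine ⟨i, ⟨Finset.mem_union_right _ (Finset.mem_compl.2 hi),
      Equiv.Perm.SameCycle.refl _ _⟩, ?_⟩
    rintro y ⟨-, k, rfl⟩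
    exact Function.IsFixedPt.perm_zpow hfix k

lemma compl_union_compl_support (A : Finset (Fin n)) :
    (A ∪ σ.supportᶜ)ᶜ = σ.support \ A := by
  ext i
  simp only [Finset.mem_compl, Finset.mem_union, Finset.mem_sdiff]
  tauto

lemma linForest_eq_forestOf : linForest σ A = forestOf σ (A ∪ σ.supportᶜ) := by
  rw [linForest, forestOf, compl_union_compl_support]

lemma IsCycleCutting.union_inter (h : IsCycleCutting σ A) :
    (A ∪ σ.supportᶜ) ∩ σ.support = A := by
  ext i
  have := @h.1 i
  simp only [Finset.mem_inter, Finset.mem_union, Finset.mem_compl]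
  tauto

lemma IsTransversal.inter_union (h : IsTransversal σ A) :
    (A ∩ σ.support) ∪ σ.supportᶜ = A := by
  ext i
  have : i ∉ σ.support → i ∈ A := fun hi =>
    h.mem_of_apply_eq (by rwa [Equiv.Perm.mem_support, not_not] at hi)
  simp only [Finset.mem_inter, Finset.mem_union, Finset.mem_compl]
  tauto

lemma IsTransversal.isCycleCutting (h : IsTransversal σ A) :
    IsCycleCutting σ (A ∩ σ.support) := by
  refine ⟨Finset.inter_subset_right, fun i hi => ?_⟩
  obtain ⟨a, ⟨ha, hia⟩, hu⟩ := h i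
  refine ⟨a, ⟨Finset.mem_inter.2 ⟨ha, ?_⟩, hia⟩,
    fun y hy => hu y ⟨(Finset.mem_inter.1 hy.1).1, hy.2⟩⟩
  rw [Equiv.Perm.mem_support] at hi ⊢
  intro hfix
  obtain ⟨k, rfl⟩ := hia.symm
  rw [Function.IsFixedPt.perm_zpow hfix k] at hi
  exact hi hfix

/-- The cycle-cuttings with a given linear forest have total weight one. -/
lemma sum_cycleCuttings (h₀ : IsTransversal σ₀ A₀) :
    ∑ x ∈ (Finset.univ : Finset (Equiv.Perm (Fin n) × Finset (Fin n))).filter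
      (fun x => IsCycleCutting x.1 x.2 ∧ linForest x.1 x.2 = forestOf σ₀ A₀),
      (2 : ℝ)⁻¹ ^ x.2.card = 1 := by
  rw [← sum_transversals h₀]
  refine Finset.sum_bij' (fun x _ => (x.1, x.2 ∪ x.1.supportᶜ))
    (fun x _ => (x.1, x.2 ∩ x.1.support)) ?_ ?_ ?_ ?_ ?_
  · rintro ⟨σ, A⟩ hx
    obtain ⟨-, h1, h2⟩ := Finset.mem_filter.1 hx
    exact Finset.mem_filter.2 ⟨Finset.mem_univ _, h1.isTransversal, linForest_eq_forestOf ▸ h2⟩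
  · rintro ⟨σ, A⟩ hx
    obtain ⟨-, h1, h2⟩ := Finset.mem_filter.1 hx
    refine Finset.mem_filter.2 ⟨Finset.mem_univ _, h1.isCycleCutting, ?_⟩
    simp only [linForest_eq_forestOf]
    rw [IsTransversal.inter_union h1]
    exact h2
  · rintro ⟨σ, A⟩ hx
    obtain ⟨-, h1, h2⟩ := Finset.mem_filter.1 hx
    simp only [Prod.mk.injEq, true_and]
    exact h1.union_inter
  · rintro ⟨σ, A⟩ hx
    obtain ⟨-, h1, h2⟩ := Finset.mem_filter.1 hx
    simp only [Prod.mk.injEq, true_and]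
    exact IsTransversal.inter_union h1
  · rintro ⟨σ, A⟩ hx
    obtain ⟨-, h1, h2⟩ := Finset.mem_filter.1 hx
    simp only
    rw [IsCycleCutting.union_inter h1]

/-! ### Existence of a pair with a given linear forest -/

/-- A vertex of degree at most one is the last or the first point of its path; otherwise its
outgoing and incoming bonds would be two distinct bonds. -/
lemma IsTransversal.mem_or_inv_mem (h : IsTransversal σ A) {i : Fin n}
    (hi : ((forestOf σ A).filter (i ∈ ·)).card ≤ 1) : i ∈ A ∨ σ⁻¹ i ∈ A := by
  by_contra! hc
  have h1 : s(i, σ i) ∈ (forestOf σ A).filter (i ∈ ·) :=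
    Finset.mem_filter.2 ⟨mem_forestOf.2 (Or.inl ⟨hc.1, rfl⟩), by simp⟩
  have h2 : s(σ⁻¹ i, i) ∈ (forestOf σ A).filter (i ∈ ·) :=
    Finset.mem_filter.2 ⟨mem_forestOf.2 (Or.inl ⟨hc.2, by simp⟩), by simp⟩
  rcases Sym2.eq_iff.1 (Finset.card_le_one.1 hi _ h1 _ h2) with ⟨h3, -⟩ | ⟨-, h3⟩
  · exact hc.1 (h.mem_of_apply_eq (Equiv.Perm.eq_inv_iff_eq.1 h3))
  · rcases h.mem_or_of_apply_apply (i := i) (j := σ i) rfl (by rw [h3]; simp) with h' | h'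
    · exact hc.1 h'
    · exact hc.2 (h3 ▸ h')

lemma orbit_mem_iff (i j : Fin n) : σ j ∈ {k | σ.SameCycle i k} ↔ j ∈ {k | σ.SameCycle i k} := by
  simp

lemma IsTransversal.exists_orient_end (h : IsTransversal σ A) {i : Fin n}
    (hi : i ∈ A ∨ σ⁻¹ i ∈ A) : ∃ τ B, IsTransversal τ B ∧ forestOf τ B = forestOf σ A ∧
      orb τ = orb σ ∧ i ∈ B := by
  by_cases hiA : i ∈ A
  · exact ⟨σ, A, h, rfl, rfl, hiA⟩
  · refine ⟨_, _, h.flip (orbit_mem_iff i), forestOf_flip _, orb_flipPerm _, ?_⟩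
    exact (mem_flipSet_of_mem (orbit_mem_iff i) (Equiv.Perm.SameCycle.refl _ _)).2
      (hi.resolve_left hiA)

lemma IsTransversal.exists_orient_start (h : IsTransversal σ A) {i k : Fin n}
    (hi : i ∈ A ∨ σ⁻¹ i ∈ A) (hk : k ∈ A) (hik : ¬ σ.SameCycle i k) :
    ∃ τ B, IsTransversal τ B ∧ forestOf τ B = forestOf σ A ∧
      orb τ = orb σ ∧ τ⁻¹ i ∈ B ∧ k ∈ B := by
  by_cases hiA : σ⁻¹ i ∈ A
  · exact ⟨σ, A, h, rfl, rfl, hiA, hk⟩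
  · have hmem : σ i ∈ {k | σ.SameCycle i k} := sameCycle_apply_self σ i
    refine ⟨_, _, h.flip (orbit_mem_iff i), forestOf_flip _, orb_flipPerm _, ?_,
      (mem_flipSet_of_notMem (orbit_mem_iff i) hik).2 hk⟩
    have e : (flipPerm σ _ (orbit_mem_iff i))⁻¹ i = σ i := by
      rw [Equiv.Perm.inv_eq_iff_eq, flipPerm_of_mem _ hmem]
      simp
    rw [e, mem_flipSet_of_mem (orbit_mem_iff i) hmem]
    simpa using hi.resolve_right hiA

/-- Joining the end of one path to the start of another. -/
lemma IsTransversal.join (h : IsTransversal σ A) {i j : Fin n} (hi : i ∈ A) (hj : σ⁻¹ j ∈ A)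
    (hij : ¬ σ.SameCycle i j) : IsTransversal (σ * Equiv.swap i (σ⁻¹ j)) (A.erase i) ∧
      forestOf (σ * Equiv.swap i (σ⁻¹ j)) (A.erase i) = insert s(i, j) (forestOf σ A) := by
  have hcj : σ.SameCycle (σ⁻¹ j) j := ⟨1, by simp⟩
  have hic : ¬ σ.SameCycle i (σ⁻¹ j) := fun hh => hij (hh.trans hcj)
  have hne : σ⁻¹ j ≠ i := fun hh => hic (hh ▸ Equiv.Perm.SameCycle.refl _ _)
  have horb := orb_mul_swap hic
  constructor
  · have huniq : ∀ x y, x ∈ A.erase i → y ∈ A.erase i →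
        (σ * Equiv.swap i (σ⁻¹ j)).SameCycle x y → x = y := by
      intro x y hx hy hxy
      obtain ⟨hxi, hxA⟩ := Finset.mem_erase.1 hx
      obtain ⟨hyi, hyA⟩ := Finset.mem_erase.1 hy
      rw [← orb_rel, horb] at hxy
      rcases joinBonds_singleton_rel.1 hxy with h' | ⟨h', -⟩ | ⟨-, h'⟩
      · exact h.eq_of_sameCycle hxA hyA h'
      · exact absurd (h.eq_of_sameCycle hxA hi h') hxi
      · exact absurd (h.eq_of_sameCycle hi hyA h').symm hyi
    intro x
    obtain ⟨y, hy, hxy⟩ : ∃ y ∈ A.erase i, (σ * Equiv.swap i (σ⁻¹ j)).SameCycle x y := by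
      obtain ⟨a, ha, hxa⟩ := h.exists_mem x
      by_cases hai : a = i
      · refine ⟨σ⁻¹ j, Finset.mem_erase.2 ⟨hne, hj⟩, ?_⟩
        rw [← orb_rel, horb]
        exact joinBonds_singleton_rel.2 (Or.inr (Or.inl ⟨hai ▸ hxa, Setoid.refl' _ _⟩))
      · refine ⟨a, Finset.mem_erase.2 ⟨hai, ha⟩, ?_⟩
        rw [← orb_rel, horb]
        exact joinBonds_singleton_rel.2 (Or.inl hxa)
    exact ⟨y, ⟨hy, hxy⟩, fun z hz => huniq z y hz.1 hy (hz.2.symm.trans hxy)⟩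
  · have e : (A.erase i)ᶜ = insert i Aᶜ := by
      ext x
      simp only [Finset.mem_compl, Finset.mem_erase, Finset.mem_insert]
      tauto
    rw [forestOf, e, Finset.image_insert]
    congr 1
    · simp
    · refine Finset.image_congr fun x hx => ?_
      simp only [Finset.coe_compl, Set.mem_compl_iff, Finset.mem_coe] at hx
      simp only [Equiv.Perm.mul_apply]
      have h1 : x ≠ i := fun hh => hx (hh ▸ hi)
      have h2 : x ≠ σ⁻¹ j := fun hh => hx (hh ▸ hj)
      rw [Equiv.swap_apply_of_ne_of_ne h1 h2]

/-- A forest over `Θ` all of whose vertices have degree at most two comes from a transversal. -/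
lemma exists_transversal_of_isForestOver {Θ : Setoid (Fin n)} {Γ : Finset (Sym2 (Fin n))}
    (hF : IsForestOver Γ Θ) (hdeg : ∀ i, (Γ.filter (i ∈ ·)).card ≤ 2) :
    ∃ σ A, IsTransversal σ A ∧ forestOf σ A = Γ := by
  induction Γ using Finset.induction_on with
  | empty =>
    refine ⟨1, Finset.univ, fun i => ⟨i, ⟨Finset.mem_univ _, Equiv.Perm.SameCycle.refl _ _⟩, ?_⟩,
      by simp [forestOf]⟩
    rintro y ⟨-, hy⟩
    exact (Equiv.Perm.sameCycle_one.1 hy).symm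
  | insert e Γ he ih =>
    obtain ⟨σ, A, h, hf⟩ := ih (hF.of_insert he) fun i =>
      (Finset.card_le_card (Finset.filter_subset_filter _ (Finset.subset_insert _ _))).trans
        (hdeg i)
    induction e using Sym2.ind with | _ i j => ?_
    have hnr := hF.not_rel_of_insert he
    -- Before `{i, j}` is added, both points have degree at most one, so each is an end of its path,
    -- and the forest condition puts them on different paths. After reversals `i` is last and `j`
    -- first, and the new bond concatenates the paths.
    have hd : ∀ x ∈ s(i, j), (Γ.filter (x ∈ ·)).card ≤ 1 := fun x hx => by
      have := hdeg x
      rw [Finset.filter_insert, if_pos hx, Finset.card_insert_of_notMem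
        (fun hh => he (Finset.mem_filter.1 hh).1)] at this
      omega
    have hnc : ¬ σ.SameCycle i j := fun hh => hnr (hf ▸ h.orb_le_joinBonds Θ hh)
    obtain ⟨τ, B, hτ, hτf, hτo, hiB⟩ :=
      h.exists_orient_end (h.mem_or_inv_mem (hf ▸ hd i (by simp)))
    have hnc' : ¬ τ.SameCycle j i := fun hh => hnc (by
      rw [← orb_rel, ← hτo]
      exact hh.symm)
    obtain ⟨ρ, C, hρ, hρf, hρo, hjC, hiC⟩ :=
      hτ.exists_orient_start (hτ.mem_or_inv_mem (hτf ▸ hf ▸ hd j (by simp))) hiB hnc'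
    have hnc'' : ¬ ρ.SameCycle i j := fun hh => hnc' (by
      rw [← orb_rel, ← hρo]
      exact hh.symm)
    obtain ⟨h1, h2⟩ := hρ.join hiC hjC hnc''
    exact ⟨_, _, h1, by rw [h2, hρf, hτf, hf]⟩

end Rigidity

/-! ### The alternating sum over the partitions coarser than a given one -/

section Cumulant

variable {n : ℕ}

instance : Fintype (Setoid (Fin n)) :=
  Fintype.ofInjective (fun Ψ => Ψ.r) fun _ _ h => Setoid.ext fun a b => iff_of_eq
    (congrFun (congrFun h a) b)

/-- The weight `(-1)^(k-1) (k-1)!`. -/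
def cumWeight (k : ℕ) : ℝ := (-1) ^ (k - 1) * ((k - 1).factorial : ℝ)

/-- The cumulant weight is the coefficient of `x` in the falling factorial `x (x-1) ⋯ (x-k+1)`. -/
lemma coeff_one_descPochhammer {k : ℕ} (hk : 0 < k) :
    (descPochhammer ℝ k).coeff 1 = cumWeight k := by
  obtain ⟨k, rfl⟩ : ∃ k', k = k' + 1 := ⟨k - 1, by omega⟩
  rw [descPochhammer_succ_left, Polynomial.coeff_X_mul, Polynomial.coeff_zero_eq_eval_zero,
    Polynomial.eval_comp, descPochhammer_eval_eq_prod_range, cumWeight, Nat.add_sub_cancel,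
    ← Finset.prod_range_add_one_eq_factorial]
  have h : ∏ _j ∈ Finset.range k, (-1 : ℝ) = (-1) ^ k := by simp
  rw [← h]
  push_cast
  rw [← Finset.prod_mul_distrib]
  refine Finset.prod_congr rfl fun j _ => ?_
  simp
  ring

/-- Such functions are the injections of the set of blocks into `Fin m`. -/
lemma card_ker_eq (m : ℕ) (Ψ : Setoid (Fin n)) :
    Fintype.card {f : Fin n → Fin m // Setoid.ker f = Ψ} = m.descFactorial (numBlocks Ψ) := by
  let E : {f : Fin n → Fin m // Setoid.ker f = Ψ} ≃ (Quotient Ψ ↪ Fin m) :=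
    { toFun := fun f => ⟨Quotient.lift f.1 fun a b hab => by
          have : (Setoid.ker f.1).r a b := by rw [f.2]; exact hab
          exact this, by
        intro q q'
        induction q using Quotient.inductionOn with | _ x => ?_
        induction q' using Quotient.inductionOn with | _ y => ?_
        intro hxy
        refine Quotient.sound ?_
        have : (Setoid.ker f.1).r x y := hxy
        rw [f.2] at this
        exact this⟩
      invFun := fun g => ⟨fun i => g (Quotient.mk Ψ i), by
        ext x y
        exact g.injective.eq_iff.trans Quotient.eq⟩
      left_inv := fun f => rfl
      right_inv := fun g => by
        ext q
        induction q using Quotient.inductionOn with | _ x => rfl }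
  rw [Fintype.card_congr E, Fintype.card_embedding_eq, Fintype.card_fin, numBlocks,
    Nat.card_eq_fintype_card]

/-- Both sides count the functions to `Fin m` that are constant on the blocks of `Θ`; the left side
groups them by kernel. -/
lemma sum_descFactorial (m : ℕ) (Θ : Setoid (Fin n)) :
    ∑ Ψ ∈ Finset.univ.filter (Θ ≤ ·), m.descFactorial (numBlocks Ψ) = m ^ numBlocks Θ := by
  have h1 : Fintype.card {f : Fin n → Fin m // Θ ≤ Setoid.ker f} = m ^ numBlocks Θ := by
    let E : {f : Fin n → Fin m // Θ ≤ Setoid.ker f} ≃ (Quotient Θ → Fin m) :=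
      { toFun := fun f => Quotient.lift f.1 fun a b hab => f.2 hab
        invFun := fun g => ⟨fun i => g (Quotient.mk Θ i), fun {x y} hxy =>
          congrArg g (Quotient.sound hxy)⟩
        left_inv := fun f => rfl
        right_inv := fun g => by
          ext q
          induction q using Quotient.inductionOn with | _ x => rfl }
    rw [Fintype.card_congr E, Fintype.card_fun, Fintype.card_fin, numBlocks,
      Nat.card_eq_fintype_card]
  rw [← h1, Fintype.card_subtype]
  rw [Finset.card_eq_sum_card_fiberwise (f := fun f => Setoid.ker f)
    (t := Finset.univ.filter (Θ ≤ ·)) (fun f hf => by simpa using hf)]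
  refine Finset.sum_congr rfl fun Ψ hΨ => ?_
  rw [← card_ker_eq, Fintype.card_subtype, Finset.filter_filter]
  congr 1
  ext f
  simp only [Finset.mem_filter, Finset.mem_univ, true_and] at hΨ ⊢
  exact ⟨fun h => ⟨h ▸ hΨ, h⟩, fun h => h.2⟩

/-- `sum_descFactorial` holds for all natural `m`, hence as an identity of polynomials; compare the
coefficients of `x`. -/
lemma sum_cumWeight_eq_zero {Θ : Setoid (Fin n)} (hΘ : 2 ≤ numBlocks Θ) :
    ∑ Ψ ∈ Finset.univ.filter (Θ ≤ ·), cumWeight (numBlocks Ψ) = 0 := by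
  have hn : 0 < n := by
    rcases Nat.eq_zero_or_pos n with rfl | hn
    · have : IsEmpty (Quotient Θ) := ⟨fun q => by
        induction q using Quotient.inductionOn with | _ x => exact x.elim0⟩
      rw [numBlocks, Nat.card_of_isEmpty] at hΘ
      omega
    · exact hn
  have hp : ∑ Ψ ∈ Finset.univ.filter (Θ ≤ ·), descPochhammer ℝ (numBlocks Ψ) =
      Polynomial.X ^ numBlocks Θ := by
    refine Polynomial.eq_of_infinite_eval_eq _ _ (Set.infinite_of_injective_forall_mem
      (f := fun m : ℕ => (m : ℝ)) Nat.cast_injective fun m => ?_)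
    simp only [Set.mem_ofPred_eq, Polynomial.eval_finsetSum, Polynomial.eval_pow,
      Polynomial.eval_X, descPochhammer_eval_eq_descFactorial]
    exact_mod_cast sum_descFactorial m Θ
  have h1 := congrArg (fun p => Polynomial.coeff p 1) hp
  simp only [Polynomial.finsetSum_coeff, Polynomial.coeff_X_pow] at h1
  rw [if_neg (by omega)] at h1
  rw [← h1]
  exact Finset.sum_congr rfl fun Ψ _ => (coeff_one_descPochhammer (numBlocks_pos hn Ψ)).symm

end Cumulant

/-! ### The simplex and the interpolating matrices -/

section Simplex

/-- The simplex `u > t_1 > ⋯ > t_m > 0`. -/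
def simplexBelow (u : ℝ) (m : ℕ) : Set (Fin m → ℝ) :=
  {t | (∀ α, 0 < t α ∧ t α < u) ∧ StrictAnti t}

lemma simplexBelow_one (m : ℕ) : simplexBelow 1 m = decSimplex m := rfl

lemma cons_mem_simplexBelow {u s : ℝ} {m : ℕ} {t : Fin m → ℝ} :
    (Fin.cons s t : Fin (m + 1) → ℝ) ∈ simplexBelow u (m + 1) ↔
      (0 < s ∧ s < u) ∧ t ∈ simplexBelow s m := by
  simp only [simplexBelow, Set.mem_ofPred_eq, Fin.forall_fin_succ, Fin.cons_zero, Fin.cons_succ]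
  constructor
  · rintro ⟨⟨h1, h2⟩, h3⟩
    refine ⟨h1, fun α => ⟨(h2 α).1, ?_⟩, fun α β hαβ => ?_⟩
    · have := h3 (Fin.succ_pos α)
      simpa using this
    · have := h3 (Fin.succ_lt_succ_iff.2 hαβ)
      simpa using this
  · rintro ⟨h1, h2, h3⟩
    refine ⟨⟨h1, fun α => ⟨(h2 α).1, (h2 α).2.trans h1.2⟩⟩, fun α β hαβ => ?_⟩
    induction α using Fin.cases with
    | zero =>
      induction β using Fin.cases with
      | zero => exact absurd hαβ (lt_irrefl _)
      | succ β => simpa using (h2 β).2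
    | succ α =>
      induction β using Fin.cases with
      | zero => exact absurd hαβ (Fin.not_lt_zero _)
      | succ β => simpa using h3 (Fin.succ_lt_succ_iff.1 hαβ)

lemma measurableSet_simplexBelow (u : ℝ) (m : ℕ) : MeasurableSet (simplexBelow u m) := by
  have : simplexBelow u m = (⋂ α, {t | 0 < t α} ∩ {t | t α < u}) ∩
      ⋂ α, ⋂ β, {t | α < β → t β < t α} := by
    ext t
    simp [simplexBelow, StrictAnti]
  rw [this]
  refine (MeasurableSet.iInter fun α => (measurableSet_lt (by fun_prop) (by fun_prop)).inter
    (measurableSet_lt (by fun_prop) (by fun_prop))).inter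
    (MeasurableSet.iInter fun α => MeasurableSet.iInter fun β => ?_)
  by_cases h : α < β
  · simp only [h, true_imp_iff]
    exact measurableSet_lt (by fun_prop) (by fun_prop)
  · simp [h]

lemma integrableOn_simplexBelow {u : ℝ} {m : ℕ} {F : (Fin m → ℝ) → ℝ} (hF : Continuous F) :
    IntegrableOn F (simplexBelow u m) := by
  have hK : IsCompact (Set.univ.pi fun _ : Fin m => Set.Icc (0 : ℝ) u) :=
    isCompact_univ_pi fun _ => isCompact_Icc
  refine (hF.continuousOn.integrableOn_compact hK).mono_set fun t ht => ?_
  simp only [Set.mem_pi, Set.mem_univ, true_imp_iff, Set.mem_Icc]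
  exact fun α => ⟨(ht.1 α).1.le, (ht.1 α).2.le⟩

/-- Fubini, with the largest coordinate as outer variable: the others range over the smaller simplex
below it. -/
lemma integral_simplexBelow_succ {u : ℝ} (hu : 0 ≤ u) {m : ℕ} {F : (Fin (m + 1) → ℝ) → ℝ}
    (hF : Continuous F) :
    IntervalIntegrable (fun s => ∫ t in simplexBelow s m, F (Fin.cons s t)) volume 0 u ∧
    ∫ t in simplexBelow u (m + 1), F t =
      ∫ s in (0 : ℝ)..u, ∫ t in simplexBelow s m, F (Fin.cons s t) := by
  have hmp := (volume_preserving_piFinSuccAbove (fun _ : Fin (m + 1) => ℝ) 0).symm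
  have hcons : ∀ p : ℝ × (Fin m → ℝ),
      (MeasurableEquiv.piFinSuccAbove (fun _ : Fin (m + 1) => ℝ) 0).symm p = Fin.cons p.1 p.2 := by
    intro p
    simp [MeasurableEquiv.piFinSuccAbove, Fin.consEquiv]
  have hInt : Integrable (fun p : ℝ × (Fin m → ℝ) =>
      (simplexBelow u (m + 1)).indicator F (Fin.cons p.1 p.2)) (volume.prod volume) := by
    have h1 := (integrable_indicator_iff (measurableSet_simplexBelow u (m + 1))).2
      (integrableOn_simplexBelow (u := u) hF)
    have h2 := hmp.integrable_comp_of_integrable h1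
    refine h2.congr (ae_of_all _ fun p => ?_)
    simp only [Function.comp_apply, hcons]
  have hinner : ∀ s, ∫ t, (simplexBelow u (m + 1)).indicator F (Fin.cons s t) =
      (Set.Ioo 0 u).indicator (fun s => ∫ t in simplexBelow s m, F (Fin.cons s t)) s := by
    intro s
    by_cases hs : s ∈ Set.Ioo 0 u
    · rw [Set.indicator_of_mem hs, ← integral_indicator (measurableSet_simplexBelow s m)]
      congr 1
      ext t
      by_cases ht : t ∈ simplexBelow s m
      · rw [Set.indicator_of_mem ht, Set.indicator_of_mem (cons_mem_simplexBelow.2 ⟨hs, ht⟩)]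
      · rw [Set.indicator_of_notMem ht, Set.indicator_of_notMem
          (fun h => ht (cons_mem_simplexBelow.1 h).2)]
    · rw [Set.indicator_of_notMem hs]
      have : ∀ t, (simplexBelow u (m + 1)).indicator F (Fin.cons s t) = 0 := fun t =>
        Set.indicator_of_notMem (fun h => hs (cons_mem_simplexBelow.1 h).1) _
      simp [this]
  constructor
  · rw [intervalIntegrable_iff_integrableOn_Ioo_of_le hu,
      ← integrable_indicator_iff measurableSet_Ioo]
    have := hInt.integral_prod_left
    simpa only [hinner] using this
  · rw [intervalIntegral.integral_of_le hu, integral_Ioc_eq_integral_Ioo,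
      ← integral_indicator measurableSet_Ioo,
      ← integral_indicator (measurableSet_simplexBelow u (m + 1)), ← hmp.integral_comp']
    simp only [hcons]
    rw [← Measure.volume_eq_prod] at hInt
    rw [Measure.volume_eq_prod, integral_prod _ hInt]
    simp only [hinner]

variable {n : ℕ}

lemma continuous_interpMatrix {m : ℕ} (Θ : Setoid (Fin n)) (e : Fin m → Sym2 (Fin n)) :
    Continuous (interpMatrix Θ e) := by
  unfold interpMatrix
  fun_prop

lemma joinBonds_image_cons {m : ℕ} (Θ : Setoid (Fin n)) (b : Sym2 (Fin n))
    (e : Fin m → Sym2 (Fin n)) (S : Finset (Fin m)) :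
    joinBonds ((insert 0 (S.map (Fin.succEmb m))).image (Fin.cons b e : Fin (m + 1) → _)) Θ =
      joinBonds (S.image e) (joinBonds {b} Θ) := by
  rw [joinBonds_joinBonds]
  congr 1
  ext x
  simp [Finset.mem_image, Fin.exists_fin_succ, eq_comm]

/-- Splitting off the first bond `b` leaves the same interpolation starting from `{b} ∨ Θ`; this is
the recursion matched by the induction in the forest formula. -/
lemma interpMatrix_cons {m : ℕ} (Θ : Setoid (Fin n)) (b : Sym2 (Fin n))
    (e : Fin m → Sym2 (Fin n)) (s : ℝ) (t : Fin m → ℝ) :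
    interpMatrix Θ (Fin.cons b e : Fin (m + 1) → _) (Fin.cons s t) =
      partMatrix Θ + s • (partMatrix (joinBonds {b} Θ) - partMatrix Θ) +
        (interpMatrix (joinBonds {b} Θ) e t - partMatrix (joinBonds {b} Θ)) := by
  have h1 : (Finset.univ.filter (· ≤ (0 : Fin (m + 1)))) =
      insert 0 ((∅ : Finset (Fin m)).map (Fin.succEmb m)) := by
    ext x; simp
  have h2 : (Finset.univ.filter (· < (0 : Fin (m + 1)))) = ∅ := by
    ext x; simp
  have h3 : ∀ α : Fin m, (Finset.univ.filter (· ≤ α.succ)) =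
      insert 0 ((Finset.univ.filter (· ≤ α)).map (Fin.succEmb m)) := fun α => by
    ext x
    induction x using Fin.cases <;> simp [Fin.succ_ne_zero]
  have h4 : ∀ α : Fin m, (Finset.univ.filter (· < α.succ)) =
      insert 0 ((Finset.univ.filter (· < α)).map (Fin.succEmb m)) := fun α => by
    ext x
    induction x using Fin.cases <;> simp [Fin.succ_ne_zero]
  unfold interpMatrix
  rw [Fin.sum_univ_succ]
  simp only [h1, h2, h3, h4, joinBonds_image_cons, Fin.cons_zero, Fin.cons_succ,
    Finset.image_empty, joinBonds_empty]
  abel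

end Simplex

/-! ### The forest formula for alternating sums over partitions -/

section Forest

variable {n : ℕ}

/-- The bond `e` lies in a block of `Ψ`. -/
def bondIn (Ψ : Setoid (Fin n)) (e : Sym2 (Fin n)) : Prop := ∀ i ∈ e, ∀ j ∈ e, Ψ.r i j

lemma bondIn_mk {Ψ : Setoid (Fin n)} {i j : Fin n} : bondIn Ψ s(i, j) ↔ Ψ.r i j := by
  constructor
  · intro h
    exact h i (by simp) j (by simp)
  · intro h x hx y hy
    rcases Sym2.mem_iff.1 hx with rfl | rfl <;> rcases Sym2.mem_iff.1 hy with rfl | rfl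
    · exact Ψ.refl' _
    · exact h
    · exact Ψ.symm' h
    · exact Ψ.refl' _

lemma joinBonds_singleton_le_iff {Θ Ψ : Setoid (Fin n)} {e : Sym2 (Fin n)} :
    joinBonds {e} Θ ≤ Ψ ↔ Θ ≤ Ψ ∧ bondIn Ψ e := by
  induction e using Sym2.ind with | _ i j => ?_
  rw [bondIn_mk]
  constructor
  · intro h
    exact ⟨(le_joinBonds _ _).trans h, h (joinBonds_rel _ (by simp))⟩
  · rintro ⟨h1, h2⟩
    refine joinBonds_le h1 fun a b hab => ?_
    rw [Finset.mem_singleton, Sym2.eq_iff] at hab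
    rcases hab with ⟨rfl, rfl⟩ | ⟨rfl, rfl⟩
    · exact h2
    · exact Setoid.symm h2

/-- Successive application of the operators `D (e 0)`, `D (e 1)`, …. -/
def seqOp {V : Type*} (D : Sym2 (Fin n) → V → V) : (m : ℕ) → (Fin m → Sym2 (Fin n)) → V → V
  | 0, _, g => g
  | m + 1, e, g => seqOp D m (fun α => e α.succ) (D (e 0) g)

/-- At least `m + 1` bonds are needed to join `m + 2` blocks, so none of those available, in
particular `b`, can lie inside a block. -/
lemma joinBonds_image_cons_eq_top_iff {m : ℕ} (hn : 0 < n) {Θ : Setoid (Fin n)}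
    (hΘ : numBlocks Θ = m + 2) (b : Sym2 (Fin n)) (e : Fin m → Sym2 (Fin n)) :
    joinBonds (Finset.univ.image (Fin.cons b e : Fin (m + 1) → _)) Θ = ⊤ ↔
      ¬ bondIn Θ b ∧ joinBonds (Finset.univ.image e) (joinBonds {b} Θ) = ⊤ := by
  have hu : (Finset.univ : Finset (Fin (m + 1))) =
      insert 0 ((Finset.univ : Finset (Fin m)).map (Fin.succEmb m)) := by
    ext x
    induction x using Fin.cases <;> simp
  rw [hu, joinBonds_image_cons]
  refine ⟨fun h => ⟨fun hb => ?_, h⟩, fun h => h.2⟩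
  have hΘb : joinBonds {b} Θ = Θ :=
    le_antisymm (joinBonds_singleton_le_iff.2 ⟨le_rfl, hb⟩) (le_joinBonds _ _)
  rw [hΘb] at h
  have h1 := numBlocks_le_joinBonds_add_card (Finset.univ.image e) Θ
  have h2 : (Finset.univ.image e).card ≤ m :=
    Finset.card_image_le.trans (by simp)
  rw [h, numBlocks_top hn] at h1
  omega

variable {V : Type*} {φ : V → (Fin n → Fin n → ℝ) → ℝ} {D : Sym2 (Fin n) → V → V}

/-- The forest formula: an alternating sum over the partitions coarser than `Θ` is a sum over
the enumerated trees on the blocks of `Θ`. -/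
theorem sum_cumWeight_eq_sum_trees (hn : 0 < n) (hφ : ∀ g, Continuous (φ g))
    (hD : ∀ g Q (Θ Ψ : Setoid (Fin n)), Θ ≤ Ψ → ∀ s : ℝ,
      HasDerivAt (fun s : ℝ => φ g (Q + s • (partMatrix Ψ - partMatrix Θ)))
        (∑ e with bondIn Ψ e ∧ ¬ bondIn Θ e,
          φ (D e g) (Q + s • (partMatrix Ψ - partMatrix Θ))) s)
    (m : ℕ) (Θ : Setoid (Fin n)) (hΘ : numBlocks Θ = m + 1) (g : V) (Q : Fin n → Fin n → ℝ)
    {u : ℝ} (hu : 0 ≤ u) :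
    ∑ Ψ with Θ ≤ Ψ, cumWeight (numBlocks Ψ) * φ g (Q + u • partMatrix Ψ) =
      ∑ e : Fin m → Sym2 (Fin n), if joinBonds (Finset.univ.image e) Θ = ⊤ then
        ∫ t in simplexBelow u m, φ (seqOp D m e g)
          (Q + u • partMatrix Θ + (interpMatrix Θ e t - partMatrix Θ)) else 0 := by
  induction m generalizing Θ g Q u with
  | zero =>
    have htop : Θ = ⊤ := eq_top_of_numBlocks_eq_one hΘ
    subst htop
    have h1 : (Finset.univ.filter fun Ψ : Setoid (Fin n) => ⊤ ≤ Ψ) = {⊤} := by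
      ext Ψ; simp
    have h2 : simplexBelow u 0 = Set.univ := by
      ext t
      simp [simplexBelow, Subsingleton.strictAnti]
    rw [h1, Finset.sum_singleton, numBlocks_top hn]
    have h3 : (volume : Measure (Fin 0 → ℝ)).real Set.univ = 1 := by
      simp [Measure.real, volume_pi]
    simp [h2, h3, cumWeight, joinBonds_empty, interpMatrix, seqOp]
  | succ m ih =>
    -- There are at least two blocks, so the weights sum to zero and the value at `[Θ]` may be
    -- subtracted from every term.
    have hsum0 := sum_cumWeight_eq_zero (Θ := Θ) (by omega)
    have hcont : ∀ (g : V) (Ψ : Setoid (Fin n)), Continuous fun s : ℝ =>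
        φ g (Q + u • partMatrix Θ + s • (partMatrix Ψ - partMatrix Θ)) := fun g Ψ =>
      (hφ g).comp (by fun_prop)
    have hdiff : ∀ Ψ, Θ ≤ Ψ → φ g (Q + u • partMatrix Ψ) - φ g (Q + u • partMatrix Θ) =
        ∫ s in (0 : ℝ)..u, ∑ e with bondIn Ψ e ∧ ¬ bondIn Θ e,
          φ (D e g) (Q + u • partMatrix Θ + s • (partMatrix Ψ - partMatrix Θ)) := by
      intro Ψ hΨ
      rw [intervalIntegral.integral_eq_sub_of_hasDerivAt
        (fun s _ => hD g (Q + u • partMatrix Θ) Θ Ψ hΨ s)]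
      · congr 2
        · rw [smul_sub]; abel
        · simp
      · exact (continuous_finsetSum _ fun e _ => hcont (D e g) Ψ).intervalIntegrable _ _
    have hLHS : ∑ Ψ with Θ ≤ Ψ, cumWeight (numBlocks Ψ) * φ g (Q + u • partMatrix Ψ) =
        ∑ Ψ with Θ ≤ Ψ, cumWeight (numBlocks Ψ) *
          (φ g (Q + u • partMatrix Ψ) - φ g (Q + u • partMatrix Θ)) := by
      simp only [mul_sub, Finset.sum_sub_distrib, ← Finset.sum_mul, hsum0, zero_mul, sub_zero]
    have hterm : ∀ b : Sym2 (Fin n), ¬ bondIn Θ b → ∀ s : ℝ, 0 ≤ s →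
        ∑ Ψ with joinBonds {b} Θ ≤ Ψ, cumWeight (numBlocks Ψ) *
          φ (D b g) (Q + u • partMatrix Θ + s • (partMatrix Ψ - partMatrix Θ)) =
        ∑ e : Fin m → Sym2 (Fin n),
          if joinBonds (Finset.univ.image e) (joinBonds {b} Θ) = ⊤ then
            ∫ t in simplexBelow s m, φ (seqOp D (m + 1) (Fin.cons b e) g)
              (Q + u • partMatrix Θ +
                (interpMatrix Θ (Fin.cons b e : Fin (m + 1) → _) (Fin.cons s t) - partMatrix Θ))
          else 0 := by
      intro b hb s hs
      have hb' : numBlocks (joinBonds {b} Θ) = m + 1 := by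
        induction b using Sym2.ind with | _ i j => ?_
        rw [bondIn_mk] at hb
        have := numBlocks_joinBonds_singleton hb
        omega
      -- The point reached at time `s` is `(Q + (u - s)[Θ]) + s[Ψ]`; the statement carries a general
      -- `Q` and `u` so that the induction can restart there with `s` in place of `u`.
      have := ih (joinBonds {b} Θ) hb' (D b g) (Q + (u - s) • partMatrix Θ) hs
      have e1 : ∀ Ψ : Setoid (Fin n), Q + u • partMatrix Θ + s • (partMatrix Ψ - partMatrix Θ) =
          Q + (u - s) • partMatrix Θ + s • partMatrix Ψ := fun Ψ => by module
      have e2 : ∀ (e : Fin m → Sym2 (Fin n)) t, Q + u • partMatrix Θ +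
          (interpMatrix Θ (Fin.cons b e : Fin (m + 1) → _) (Fin.cons s t) - partMatrix Θ) =
          Q + (u - s) • partMatrix Θ + s • partMatrix (joinBonds {b} Θ) +
            (interpMatrix (joinBonds {b} Θ) e t - partMatrix (joinBonds {b} Θ)) := fun e t => by
        rw [interpMatrix_cons]
        module
      simp only [e1, e2]
      exact this
    rw [hLHS]
    calc ∑ Ψ with Θ ≤ Ψ, cumWeight (numBlocks Ψ) *
          (φ g (Q + u • partMatrix Ψ) - φ g (Q + u • partMatrix Θ))
        = ∑ Ψ with Θ ≤ Ψ, ∑ b, ∫ s in (0 : ℝ)..u, if bondIn Ψ b ∧ ¬ bondIn Θ b then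
            cumWeight (numBlocks Ψ) *
              φ (D b g) (Q + u • partMatrix Θ + s • (partMatrix Ψ - partMatrix Θ)) else 0 := by
          refine Finset.sum_congr rfl fun Ψ hΨ => ?_
          rw [hdiff Ψ (Finset.mem_filter.1 hΨ).2, ← intervalIntegral.integral_const_mul,
            ← intervalIntegral.integral_finsetSum]
          · congr 1
            ext s
            rw [Finset.sum_filter, Finset.mul_sum]
            refine Finset.sum_congr rfl fun b _ => ?_
            split_ifs <;> simp
          · intro b _
            split_ifs
            · exact ((hcont _ _).const_mul _).intervalIntegrable _ _
            · simp
      _ = ∑ b, if ¬ bondIn Θ b then ∫ s in (0 : ℝ)..u, ∑ Ψ with joinBonds {b} Θ ≤ Ψ,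
            cumWeight (numBlocks Ψ) *
              φ (D b g) (Q + u • partMatrix Θ + s • (partMatrix Ψ - partMatrix Θ)) else 0 := by
          rw [Finset.sum_comm]
          refine Finset.sum_congr rfl fun b _ => ?_
          by_cases hb : bondIn Θ b
          · simp [hb]
          · rw [if_pos hb, intervalIntegral.integral_finsetSum
              (fun Ψ _ => ((hcont _ _).const_mul _).intervalIntegrable _ _)]
            -- The partitions coarser than `Θ` with `b` inside a block are those coarser than `{b} ∨
            -- Θ`, which has one block fewer.
            simp only [joinBonds_singleton_le_iff]
            have hfil : (Finset.univ.filter fun Ψ : Setoid (Fin n) => Θ ≤ Ψ ∧ bondIn Ψ b) =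
                (Finset.univ.filter (Θ ≤ ·)).filter fun Ψ => bondIn Ψ b :=
              (Finset.filter_filter _ _ _).symm
            rw [hfil, Finset.sum_filter (fun Ψ => bondIn Ψ b)]
            refine Finset.sum_congr rfl fun Ψ _ => ?_
            by_cases hΨ : bondIn Ψ b <;> simp [hΨ, hb]
      _ = ∑ b, if ¬ bondIn Θ b then ∫ s in (0 : ℝ)..u, ∑ e : Fin m → Sym2 (Fin n),
          (if joinBonds (Finset.univ.image e) (joinBonds {b} Θ) = ⊤ then
            ∫ t in simplexBelow s m, φ (seqOp D (m + 1) (Fin.cons b e) g)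
              (Q + u • partMatrix Θ +
                (interpMatrix Θ (Fin.cons b e : Fin (m + 1) → _) (Fin.cons s t) - partMatrix Θ))
          else 0) else 0 := by
          refine Finset.sum_congr rfl fun b _ => ?_
          by_cases hb : bondIn Θ b
          · simp only [hb, not_true_eq_false, if_false]
          · rw [if_pos hb, if_pos hb]
            refine intervalIntegral.integral_congr fun s hs => ?_
            rw [Set.uIcc_of_le hu] at hs
            exact hterm b hb s hs.1
      _ = ∑ b, ∑ e : Fin m → Sym2 (Fin n),
          if joinBonds (Finset.univ.image (Fin.cons b e : Fin (m + 1) → _)) Θ = ⊤ then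
            ∫ t in simplexBelow u (m + 1), φ (seqOp D (m + 1) (Fin.cons b e) g)
              (Q + u • partMatrix Θ +
                (interpMatrix Θ (Fin.cons b e : Fin (m + 1) → _) t - partMatrix Θ))
          else 0 := by
          refine Finset.sum_congr rfl fun b _ => ?_
          have hFc : ∀ e : Fin m → Sym2 (Fin n), Continuous fun t : Fin (m + 1) → ℝ =>
              φ (seqOp D (m + 1) (Fin.cons b e) g) (Q + u • partMatrix Θ +
                (interpMatrix Θ (Fin.cons b e : Fin (m + 1) → _) t - partMatrix Θ)) := fun e =>
            (hφ _).comp (continuous_const.add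
              ((continuous_interpMatrix Θ _).sub continuous_const))
          simp only [joinBonds_image_cons_eq_top_iff hn hΘ]
          by_cases hb : bondIn Θ b
          · simp [hb]
          · simp only [hb, not_false_eq_true, if_true, true_and]
            rw [intervalIntegral.integral_finsetSum]
            · refine Finset.sum_congr rfl fun e _ => ?_
              split_ifs with he
              · exact (integral_simplexBelow_succ hu (hFc e)).2.symm
              · simp
            · intro e _
              split_ifs with he
              · exact (integral_simplexBelow_succ hu (hFc e)).1
              · simp
      _ = _ := by
          rw [← Fintype.sum_prod_type']
          refine Fintype.sum_equiv (Fin.consEquiv fun _ => Sym2 (Fin n)) _ _ fun p => ?_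
          rfl

end Forest

/-! ### The law of a GUE matrix and its characteristic function -/

section GUELaw

open Complex ComplexConjugate

variable {N : ℕ}

/-- Square complex matrices, with the product measurable structure. -/
abbrev Mat (N : ℕ) : Type := Fin N → Fin N → ℂ

/-- The real pairing `Re tr (A M)`. -/
def pairing (A M : Mat N) : ℝ := (∑ i, ∑ j, A i j * M j i).re

/-- `tr ((A + A^*)^2)`. -/
def energy (A : Mat N) : ℝ := ∑ i, ∑ j, normSq (A i j + conj (A j i))

lemma pairing_eq_trace (A M : Mat N) :
    pairing A M = ((Matrix.of A * Matrix.of M).trace).re := rfl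

lemma energy_eq_trace (A : Mat N) : energy A =
    (((Matrix.of A + (Matrix.of A).conjTranspose) *
      (Matrix.of A + (Matrix.of A).conjTranspose).conjTranspose).trace).re := by
  simp only [energy, Matrix.trace, Matrix.diag_apply, Matrix.mul_apply, re_sum]
  refine Finset.sum_congr rfl fun i _ => Finset.sum_congr rfl fun j _ => ?_
  simp only [Matrix.conjTranspose_apply, Matrix.add_apply, Matrix.of_apply, RCLike.star_def]
  rw [mul_conj]
  simp

/-- The law with characteristic function `A ↦ exp (-tr ((A + A^*)^2) / 8)`. -/
def IsGUELaw (μ : Measure (Mat N)) : Prop :=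
  ∀ A : Mat N, ∫ M, cexp (pairing A M * I) ∂μ = cexp (-(energy A / 8 : ℝ))

lemma continuous_pairing (A : Mat N) : Continuous (pairing A) := by
  unfold pairing
  fun_prop

/-- The matrix with the single entry `z` at `(i, j)`. -/
def entryMat (i j : Fin N) (z : ℂ) : Mat N := fun i' j' => if i' = i ∧ j' = j then z else 0

lemma eq_sum_entryMat (M : Mat N) : M = ∑ i, ∑ j, ((M i j).re • entryMat i j 1 +
    (M i j).im • entryMat i j I) := by
  ext i j
  simp only [Finset.sum_apply, Pi.add_apply, Pi.smul_apply, entryMat]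
  rw [Finset.sum_eq_single i (by intro b _ hb; simp [hb.symm]) (by simp),
    Finset.sum_eq_single j (by intro b _ hb; simp [hb.symm]) (by simp)]
  simp

/-- The real pairings exhaust the real dual, so `IsGUELaw` prescribes the whole characteristic
function. The entries come from `Re((x - iy)(a + ib)) = xa + yb`. -/
lemma exists_pairing_eq (L : StrongDual ℝ (Mat N)) : ∃ A, ∀ M, L M = pairing A M := by
  refine ⟨fun j i => ⟨L (entryMat i j 1), -L (entryMat i j I)⟩, fun M => ?_⟩
  have : L M = ∑ i, ∑ j, ((M i j).re * L (entryMat i j 1) +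
      (M i j).im * L (entryMat i j I)) := by
    conv_lhs => rw [eq_sum_entryMat M]
    simp only [map_sum, map_add, map_smul, smul_eq_mul]
  rw [this, pairing, Finset.sum_comm, re_sum]
  refine Finset.sum_congr rfl fun j _ => ?_
  rw [re_sum]
  refine Finset.sum_congr rfl fun i _ => ?_
  rw [mul_re]
  ring

lemma IsGUELaw.unique {μ ν : Measure (Mat N)} [IsFiniteMeasure μ] [IsFiniteMeasure ν]
    (hμ : IsGUELaw μ) (hν : IsGUELaw ν) : μ = ν := by
  refine Measure.ext_of_charFunDual (funext fun L => ?_)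
  obtain ⟨A, hA⟩ := exists_pairing_eq L
  simp only [charFunDual_apply, hA]
  rw [hμ A, hν A]

/-- Conjugation by a unitary matrix. -/
def conjBy (U : Matrix (Fin N) (Fin N) ℂ) (M : Mat N) : Mat N :=
  U * Matrix.of M * U.conjTranspose

lemma measurable_conjBy (U : Matrix (Fin N) (Fin N) ℂ) : Measurable (conjBy U) := by
  refine measurable_pi_lambda _ fun i => measurable_pi_lambda _ fun j => ?_
  simp only [conjBy, Matrix.mul_apply, Matrix.of_apply]
  fun_prop

/-- The trace is cyclic, so the conjugation can be moved onto `A`, and the energy of `A` is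
unitarily invariant. -/
lemma IsGUELaw.map_conjBy {μ : Measure (Mat N)} (hμ : IsGUELaw μ)
    {U : Matrix (Fin N) (Fin N) ℂ} (hU : U * U.conjTranspose = 1) :
    IsGUELaw (μ.map (conjBy U)) := by
  intro A
  rw [integral_map (measurable_conjBy U).aemeasurable
    (by have := continuous_pairing A; exact (by fun_prop : Continuous fun M : Mat N =>
      cexp (pairing A M * I)).aestronglyMeasurable)]
  set B : Mat N := U.conjTranspose * Matrix.of A * U with hB
  have hBof : Matrix.of B = U.conjTranspose * Matrix.of A * U := rfl
  have h1 : ∀ M, pairing A (conjBy U M) = pairing B M := fun M => by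
    have hc : Matrix.of (conjBy U M) = U * Matrix.of M * U.conjTranspose := rfl
    rw [pairing_eq_trace, pairing_eq_trace, hBof, hc, ← mul_assoc, Matrix.trace_mul_comm]
    simp only [mul_assoc]
  have h2 : energy B = energy A := by
    rw [energy_eq_trace, energy_eq_trace, hBof]
    have e : U.conjTranspose * Matrix.of A * U + (U.conjTranspose * Matrix.of A * U).conjTranspose =
        U.conjTranspose * (Matrix.of A + (Matrix.of A).conjTranspose) * U := by
      simp only [Matrix.conjTranspose_mul, Matrix.conjTranspose_conjTranspose, mul_add, add_mul,
        mul_assoc]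
    rw [e]
    set C := Matrix.of A + (Matrix.of A).conjTranspose with hC
    have e2 : U.conjTranspose * C * U * (U.conjTranspose * C * U).conjTranspose =
        U.conjTranspose * (C * C.conjTranspose * U) := by
      simp only [Matrix.conjTranspose_mul, Matrix.conjTranspose_conjTranspose]
      calc _ = U.conjTranspose * C * (U * U.conjTranspose) * (C.conjTranspose * U) := by
            simp only [mul_assoc]
        _ = _ := by rw [hU, mul_one]; simp only [mul_assoc]
    rw [e2, Matrix.trace_mul_comm, mul_assoc, hU, mul_one]
  simp only [h1]
  rw [hμ B, h2]

/-- The block matrix with last diagonal entry `a`, last row `r` and last column `c`. -/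
def blk (a : ℂ) (r c : Fin N → ℂ) (M : Mat N) : Mat (N + 1) := fun i j =>
  Fin.lastCases (motive := fun _ => ℂ) (Fin.lastCases (motive := fun _ => ℂ) a r j)
    (fun i' => Fin.lastCases (motive := fun _ => ℂ) (c i') (M i') j) i

@[simp] lemma blk_last_last (a : ℂ) (r c : Fin N → ℂ) (M : Mat N) :
    blk a r c M (Fin.last N) (Fin.last N) = a := by simp [blk]

@[simp] lemma blk_last_castSucc (a : ℂ) (r c : Fin N → ℂ) (M : Mat N) (j : Fin N) :
    blk a r c M (Fin.last N) j.castSucc = r j := by simp [blk]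

@[simp] lemma blk_castSucc_last (a : ℂ) (r c : Fin N → ℂ) (M : Mat N) (i : Fin N) :
    blk a r c M i.castSucc (Fin.last N) = c i := by simp [blk]

@[simp] lemma blk_castSucc_castSucc (a : ℂ) (r c : Fin N → ℂ) (M : Mat N) (i j : Fin N) :
    blk a r c M i.castSucc j.castSucc = M i j := by simp [blk]

lemma measurable_blk {X : Type*} [MeasurableSpace X] {a : X → ℂ} {r c : X → Fin N → ℂ}
    {M : X → Mat N} (ha : Measurable a) (hr : Measurable r) (hc : Measurable c)
    (hM : Measurable M) : Measurable fun x => blk (a x) (r x) (c x) (M x) := by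
  refine measurable_pi_lambda _ fun i => measurable_pi_lambda _ fun j => ?_
  induction i using Fin.lastCases with
  | last =>
    induction j using Fin.lastCases with
    | last => simpa using ha
    | cast j => simp only [blk_last_castSucc]; fun_prop
  | cast i =>
    induction j using Fin.lastCases with
    | last => simp only [blk_castSucc_last]; fun_prop
    | cast j => simp only [blk_castSucc_castSucc]; fun_prop

/-- Complex Gaussian variables built from pairs of standard normal ones. -/
def cvec (y : Fin N × Fin 2 → ℝ) : Fin N → ℂ := fun k =>
  ⟨y (k, 0) / √2, y (k, 1) / √2⟩

lemma measurable_cvec : Measurable (cvec (N := N)) := by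
  refine measurable_pi_lambda _ fun k => ?_
  have : (fun y : Fin N × Fin 2 → ℝ => cvec y k) = fun y =>
      ((y (k, 0) / √2 : ℝ) : ℂ) + ((y (k, 1) / √2 : ℝ) : ℂ) * I := by
    ext y
    exact (Complex.mk_eq_add_mul_I _ _)
  rw [this]
  fun_prop

/-- The data from which the successive columns of the matrices are built. -/
def borderLaw (N : ℕ) : Measure (ℝ × (Fin N × Fin 2 → ℝ)) :=
  (gaussianReal 0 1).prod (Measure.pi fun _ => gaussianReal 0 1)

instance (N : ℕ) : IsProbabilityMeasure (borderLaw N) := by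
  unfold borderLaw
  infer_instance

/-- The law of a GUE matrix, built by bordering. -/
def gueLaw : (N : ℕ) → Measure (Mat N)
  | 0 => Measure.dirac 0
  | N + 1 => ((borderLaw N).prod (gueLaw N)).map fun x =>
      blk x.1.1 (fun k => conj (cvec x.1.2 k)) (cvec x.1.2) x.2

lemma measurable_gue_blk : Measurable fun x : (ℝ × (Fin N × Fin 2 → ℝ)) × Mat N =>
    blk x.1.1 (fun k => conj (cvec x.1.2 k)) (cvec x.1.2) x.2 := by
  have hc : Measurable fun x : (ℝ × (Fin N × Fin 2 → ℝ)) × Mat N => cvec x.1.2 :=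
    measurable_cvec.comp (by fun_prop)
  refine measurable_blk (by fun_prop) ?_ hc (by fun_prop)
  exact measurable_pi_lambda _ fun k =>
    continuous_conj.measurable.comp ((measurable_pi_apply k).comp hc)

instance isProbabilityMeasure_gueLaw (N : ℕ) : IsProbabilityMeasure (gueLaw N) := by
  induction N with
  | zero => rw [gueLaw]; infer_instance
  | succ N ih =>
    rw [gueLaw]
    exact Measure.isProbabilityMeasure_map measurable_gue_blk.aemeasurable

lemma integral_exp_gaussianReal (t : ℝ) (v : NNReal) :
    ∫ x, cexp ((t * x : ℝ) * I) ∂gaussianReal 0 v = cexp (-(v * t ^ 2 / 2 : ℝ)) := by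
  have h := charFun_gaussianReal (μ := 0) (v := v) t
  rw [charFun_apply_real] at h
  simp only [ofReal_mul]
  rw [h]
  push_cast
  congr 1
  ring

lemma energy_succ (A : Mat (N + 1)) : energy A =
    energy (fun i j : Fin N => A i.castSucc j.castSucc) +
      2 * ∑ k : Fin N, normSq (A (Fin.last N) k.castSucc + conj (A k.castSucc (Fin.last N))) +
      4 * (A (Fin.last N) (Fin.last N)).re ^ 2 := by
  have hs : ∀ z w : ℂ, normSq (z + conj w) = normSq (w + conj z) := fun z w => by
    simp only [normSq_apply, add_re, add_im, conj_re, conj_im]; ring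
  unfold energy
  rw [Fin.sum_univ_castSucc]
  simp only [Fin.sum_univ_castSucc (n := N), Finset.sum_add_distrib]
  have h1 : normSq (A (Fin.last N) (Fin.last N) + conj (A (Fin.last N) (Fin.last N))) =
      4 * (A (Fin.last N) (Fin.last N)).re ^ 2 := by
    simp only [normSq_apply, add_re, add_im, conj_re, conj_im]; ring
  have h2 : ∀ k : Fin N, normSq (A k.castSucc (Fin.last N) + conj (A (Fin.last N) k.castSucc)) =
      normSq (A (Fin.last N) k.castSucc + conj (A k.castSucc (Fin.last N))) := fun k => hs _ _
  simp only [h1, h2]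
  ring

/-- The last row is the conjugate of the last column, so only `A_{last,k} + conj A_{k,last}` pairs
with it. The pairing is then a sum of functions of independent quantities. -/
lemma pairing_blk (A : Mat (N + 1)) (a : ℝ) (y : Fin N × Fin 2 → ℝ) (M : Mat N) :
    pairing A (blk a (fun k => conj (cvec y k)) (cvec y) M) =
      (A (Fin.last N) (Fin.last N)).re * a +
      (∑ p : Fin N × Fin 2, (if p.2 = 0 then
        (A (Fin.last N) p.1.castSucc + conj (A p.1.castSucc (Fin.last N))).re / √2
        else -(A (Fin.last N) p.1.castSucc + conj (A p.1.castSucc (Fin.last N))).im / √2) * y p) +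
      pairing (fun i j : Fin N => A i.castSucc j.castSucc) M := by
  unfold pairing
  rw [Fin.sum_univ_castSucc]
  simp only [Fin.sum_univ_castSucc (n := N), blk_last_last, blk_castSucc_last, blk_last_castSucc,
    blk_castSucc_castSucc, Finset.sum_add_distrib, Fintype.sum_prod_type, Fin.sum_univ_two]
  simp only [add_re, re_sum, mul_re, conj_re, conj_im, cvec, ofReal_re, ofReal_im, if_true,
    add_im, one_ne_zero, if_false]
  simp only [add_div, neg_div, add_mul, neg_mul, mul_neg, Finset.sum_add_distrib,
    Finset.sum_sub_distrib, Finset.sum_neg_distrib, neg_add, sub_neg_eq_add, mul_zero, sub_zero,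
    mul_div_assoc, div_mul_eq_mul_div]
  ring

/-- The characteristic function factors over the corner, the border and the smaller matrix, and the
energy splits accordingly by `energy_succ`. -/
lemma isGUELaw_gueLaw (N : ℕ) : IsGUELaw (gueLaw N) := by
  induction N with
  | zero =>
    intro A
    simp [gueLaw, pairing, energy]
  | succ N ih =>
    intro A
    rw [gueLaw, integral_map measurable_gue_blk.aemeasurable
      (by have := continuous_pairing A; exact (by fun_prop : Continuous fun M : Mat (N + 1) =>
        cexp (pairing A M * I)).aestronglyMeasurable)]
    set t : Fin N × Fin 2 → ℝ := fun p => if p.2 = 0 then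
        (A (Fin.last N) p.1.castSucc + conj (A p.1.castSucc (Fin.last N))).re / √2
        else -(A (Fin.last N) p.1.castSucc + conj (A p.1.castSucc (Fin.last N))).im / √2 with ht
    have e : ∀ x : (ℝ × (Fin N × Fin 2 → ℝ)) × Mat N,
        cexp (pairing A (blk x.1.1 (fun k => conj (cvec x.1.2 k)) (cvec x.1.2) x.2) * I) =
        (cexp (((A (Fin.last N) (Fin.last N)).re * x.1.1 : ℝ) * I) *
          ∏ p, cexp ((t p * x.1.2 p : ℝ) * I)) *
          cexp (pairing (fun i j : Fin N => A i.castSucc j.castSucc) x.2 * I) := fun x => by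
      rw [pairing_blk, ← Complex.exp_sum, ← Complex.exp_add, ← Complex.exp_add]
      congr 1
      push_cast
      simp only [add_mul, Finset.sum_mul, ht]
    simp only [e]
    rw [integral_prod_mul (f := fun x : ℝ × (Fin N × Fin 2 → ℝ) =>
      cexp (((A (Fin.last N) (Fin.last N)).re * x.1 : ℝ) * I) *
          ∏ p, cexp ((t p * x.2 p : ℝ) * I))
      (g := fun M => cexp (pairing (fun i j : Fin N => A i.castSucc j.castSucc) M * I)), ih,
      borderLaw, integral_prod_mul (f := fun a : ℝ =>
        cexp (((A (Fin.last N) (Fin.last N)).re * a : ℝ) * I))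
        (g := fun y : Fin N × Fin 2 → ℝ => ∏ p, cexp ((t p * y p : ℝ) * I)),
      integral_fintype_prod_eq_prod (f := fun p (y : ℝ) => cexp ((t p * y : ℝ) * I)),
      integral_exp_gaussianReal]
    simp only [integral_exp_gaussianReal]
    rw [← Complex.exp_sum, ← Complex.exp_add, ← Complex.exp_add]
    congr 1
    have hsum : ∑ p, (t p) ^ 2 =
        (∑ k : Fin N, normSq (A (Fin.last N) k.castSucc + conj (A k.castSucc (Fin.last N)))) / 2 := by
      rw [Fintype.sum_prod_type, Finset.sum_div]
      refine Finset.sum_congr rfl fun k _ => ?_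
      have h2 : √2 ^ 2 = (2 : ℝ) := Real.sq_sqrt (by norm_num)
      simp only [ht, Fin.sum_univ_two, if_true, one_ne_zero, if_false, div_pow, h2, normSq_apply,
        neg_div]
      rw [← neg_div, div_pow, h2]
      ring
    have hE := energy_succ A
    rw [Finset.sum_neg_distrib, ← neg_add, ← neg_add]
    rw [← ofReal_sum, ← ofReal_add, ← ofReal_add]
    congr 2
    simp only [NNReal.coe_one, one_mul]
    rw [← Finset.sum_div, hsum, hE]
    ring

end GUELaw

section Tridiagonal

open Complex ComplexConjugate

variable {N : ℕ}

/-! ### The law of a standard GUE matrix -/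

lemma sum_sum_eq_sum_upper {E : Type*} [AddCommMonoid E] (F : Fin N → Fin N → E) :
    ∑ i, ∑ j, F i j = ∑ p : {p : Fin N × Fin N // p.1 ≤ p.2},
      if p.1.1 = p.1.2 then F p.1.1 p.1.2 else F p.1.1 p.1.2 + F p.1.2 p.1.1 := by
  have h1 : ∑ p : {p : Fin N × Fin N // p.1 ≤ p.2},
      (if p.1.1 = p.1.2 then F p.1.1 p.1.2 else F p.1.1 p.1.2 + F p.1.2 p.1.1) =
      ∑ p ∈ Finset.univ.filter (fun p : Fin N × Fin N => p.1 ≤ p.2),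
        (if p.1 = p.2 then F p.1 p.2 else F p.1 p.2 + F p.2 p.1) :=
    (Finset.sum_subtype (Finset.univ.filter fun p : Fin N × Fin N => p.1 ≤ p.2) (by simp)
      fun p => if p.1 = p.2 then F p.1 p.2 else F p.1 p.2 + F p.2 p.1).symm
  rw [h1, Finset.sum_filter, Fintype.sum_prod_type]
  have h2 : ∀ i j : Fin N, (if i ≤ j then if i = j then F i j else F i j + F j i else 0) =
      (if i ≤ j then F i j else 0) + (if i < j then F j i else 0) := fun i j => by
    rcases lt_trichotomy i j with h | h | h
    · simp [h.le, h.ne, h]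
    · simp [h]
    · simp [h.not_ge, h.not_gt]
  simp only [h2, Finset.sum_add_distrib]
  rw [Finset.sum_comm (f := fun i j : Fin N => if i < j then F j i else 0),
    ← Finset.sum_add_distrib]
  refine Finset.sum_congr rfl fun i _ => ?_
  rw [← Finset.sum_add_distrib]
  refine Finset.sum_congr rfl fun j _ => ?_
  rcases le_or_gt i j with h | h
  · simp [h, h.not_gt]
  · simp [h, h.not_ge]

variable {Ω : Type*} [MeasurableSpace Ω] {P : Measure Ω}

/-- The contribution of an entry on or above the diagonal to `pairing`. -/
def entryPairing (A : Mat N) (p : {p : Fin N × Fin N // p.1 ≤ p.2}) (z : ℂ) : ℝ :=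
  if p.1.1 = p.1.2 then (A p.1.1 p.1.1).re * z.re
  else ((A p.1.2 p.1.1 + conj (A p.1.1 p.1.2)) * z).re

lemma pairing_of_isHermitian (A : Mat N) {M : Matrix (Fin N) (Fin N) ℂ} (hM : M.IsHermitian) :
    pairing A (fun i j => M i j) = ∑ p, entryPairing A p (M p.1.1 p.1.2) := by
  unfold pairing
  rw [sum_sum_eq_sum_upper fun i j => A i j * M j i, re_sum]
  refine Finset.sum_congr rfl fun p _ => ?_
  have hc : M p.1.2 p.1.1 = conj (M p.1.1 p.1.2) := (hM.apply p.1.2 p.1.1).symm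
  unfold entryPairing
  split_ifs with h
  · have him : (M p.1.1 p.1.2).im = 0 := by
      rw [← h] at hc ⊢
      have := congrArg Complex.im hc
      rw [conj_im] at this
      linarith
    rw [hc, ← h, mul_re, conj_re, conj_im]
    rw [← h] at him
    rw [him]
    ring
  · rw [hc]
    simp only [add_re, mul_re, conj_re, conj_im, add_im]
    ring

lemma energy_eq_sum_upper (A : Mat N) : energy A = ∑ p : {p : Fin N × Fin N // p.1 ≤ p.2},
    if p.1.1 = p.1.2 then 4 * (A p.1.1 p.1.1).re ^ 2
    else 2 * normSq (A p.1.2 p.1.1 + conj (A p.1.1 p.1.2)) := by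
  rw [energy, sum_sum_eq_sum_upper]
  refine Finset.sum_congr rfl fun p _ => ?_
  split_ifs with h
  · rw [← h]
    simp only [normSq_apply, add_re, add_im, conj_re, conj_im]
    ring
  · simp only [normSq_apply, add_re, add_im, conj_re, conj_im]
    ring

/-- For hermitian matrices the pairing is a sum of functions of single entries on or above the
diagonal, so independence factors the characteristic function. -/
lemma IsStandardGUE.isGUELaw {Ξ : Ω → Matrix (Fin N) (Fin N) ℂ}
    (hΞ : IsStandardGUE P Ξ) :
    IsGUELaw (P.map fun ω => (fun i j => Ξ ω i j : Mat N)) := by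
  intro A
  have hm : Measurable fun ω => (fun i j => Ξ ω i j : Mat N) :=
    measurable_pi_lambda _ fun i => measurable_pi_lambda _ fun j => hΞ.measurable i j
  rw [integral_map hm.aemeasurable
    (by have := continuous_pairing A; exact (by fun_prop : Continuous fun M : Mat N =>
      cexp (pairing A M * I)).aestronglyMeasurable)]
  have h1 : ∀ ω, cexp (pairing A (fun i j => Ξ ω i j) * I) =
      ∏ p, cexp (entryPairing A p (Ξ ω p.1.1 p.1.2) * I) := fun ω => by
    rw [pairing_of_isHermitian A (hΞ.isHermitian ω), ← Complex.exp_sum, ofReal_sum,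
      Finset.sum_mul]
  simp only [h1]
  have hcont : ∀ p, Continuous fun z : ℂ => cexp (entryPairing A p z * I) := fun p => by
    have : Continuous (entryPairing A p) := by
      unfold entryPairing
      split_ifs <;> fun_prop
    fun_prop
  rw [hΞ.indep.integral_fun_prod_comp (f := fun p z => cexp (entryPairing A p z * I))
    (fun p => (hΞ.measurable _ _).aemeasurable) fun p => (hcont p).aestronglyMeasurable]
  rw [energy_eq_sum_upper, Finset.sum_div, ofReal_sum, ← Finset.sum_neg_distrib, Complex.exp_sum]
  refine Finset.prod_congr rfl fun p _ => ?_
  obtain ⟨⟨i, j⟩, hij⟩ := p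
  simp only at hij
  by_cases h : i = j
  · subst h
    simp only [entryPairing, if_true]
    have := integral_map (μ := P) (φ := fun ω => (Ξ ω i i).re)
      (continuous_re.measurable.comp (hΞ.measurable i i)).aemeasurable
      (f := fun x : ℝ => cexp (((A i i).re * x : ℝ) * I))
      (by exact (by fun_prop : Continuous fun x : ℝ =>
        cexp (((A i i).re * x : ℝ) * I)).aestronglyMeasurable)
    rw [← this, hΞ.diag, integral_exp_gaussianReal]
    congr 3
    simp only [NNReal.coe_one]
    ring
  · have hlt : i < j := lt_of_le_of_ne hij h
    simp only [entryPairing, h, if_false]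
    set b := A j i + conj (A i j) with hb
    have := integral_map (μ := P) (φ := fun ω => ((Ξ ω i j).re, (Ξ ω i j).im))
      ((continuous_re.measurable.comp (hΞ.measurable i j)).prodMk
        (continuous_im.measurable.comp (hΞ.measurable i j))).aemeasurable
      (f := fun x : ℝ × ℝ => cexp ((b.re * x.1 : ℝ) * I) * cexp (((-b.im) * x.2 : ℝ) * I))
      (by exact (by fun_prop : Continuous fun x : ℝ × ℝ =>
        cexp ((b.re * x.1 : ℝ) * I) * cexp (((-b.im) * x.2 : ℝ) * I)).aestronglyMeasurable)
    have h2 : ∀ ω, cexp ((b * Ξ ω i j).re * I) = cexp ((b.re * (Ξ ω i j).re : ℝ) * I) *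
        cexp (((-b.im) * (Ξ ω i j).im : ℝ) * I) := fun ω => by
      rw [← Complex.exp_add, mul_re]
      congr 1
      push_cast
      ring
    simp only [h2]
    rw [← this, hΞ.offDiag i j hlt,
      integral_prod_mul (f := fun x : ℝ => cexp ((b.re * x : ℝ) * I))
        (g := fun x : ℝ => cexp (((-b.im) * x : ℝ) * I)), integral_exp_gaussianReal,
      integral_exp_gaussianReal, ← Complex.exp_add, ← neg_add, ← ofReal_add]
    congr 3
    simp only [normSq_apply]
    push_cast
    ring

lemma IsStandardGUE.map_eq {Ξ : Ω → Matrix (Fin N) (Fin N) ℂ} [IsProbabilityMeasure P]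
    (hΞ : IsStandardGUE P Ξ) : P.map (fun ω => (fun i j => Ξ ω i j : Mat N)) = gueLaw N := by
  have hm : Measurable fun ω => (fun i j => Ξ ω i j : Mat N) :=
    measurable_pi_lambda _ fun i => measurable_pi_lambda _ fun j => hΞ.measurable i j
  have := Measure.isProbabilityMeasure_map (μ := P) hm.aemeasurable
  exact hΞ.isGUELaw.unique (isGUELaw_gueLaw N)

/-! ### Tridiagonalization -/

/-- The last vector of the standard basis. -/
def lastVec (N : ℕ) : Fin N → ℂ := fun k => if (k : ℕ) + 1 = N then 1 else 0

lemma lastVec_last : lastVec (N + 1) (Fin.last N) = 1 := by simp [lastVec]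

lemma lastVec_castSucc (k : Fin N) : lastVec (N + 1) k.castSucc = 0 := by
  simp [lastVec, k.2.ne]

/-- The law of the tridiagonal model, built by bordering. -/
def triLaw : (N : ℕ) → Measure (Mat N)
  | 0 => Measure.dirac 0
  | N + 1 => ((borderLaw N).prod (triLaw N)).map fun x =>
      blk x.1.1 (lastVec N) (((∑ p, x.1.2 p ^ 2 / 2 : ℝ) : ℂ) • lastVec N) x.2

lemma measurable_tri_blk : Measurable fun x : (ℝ × (Fin N × Fin 2 → ℝ)) × Mat N =>
    blk x.1.1 (lastVec N) (((∑ p, x.1.2 p ^ 2 / 2 : ℝ) : ℂ) • lastVec N) x.2 := by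
  refine measurable_blk (by fun_prop) (by fun_prop) ?_ (by fun_prop)
  exact measurable_pi_lambda _ fun k => by
    simp only [Pi.smul_apply]
    fun_prop

instance isProbabilityMeasure_triLaw (N : ℕ) : IsProbabilityMeasure (triLaw N) := by
  induction N with
  | zero => rw [triLaw]; infer_instance
  | succ N ih =>
    rw [triLaw]
    exact Measure.isProbabilityMeasure_map measurable_tri_blk.aemeasurable

lemma blk_mul_blk (a a' : ℂ) (r c r' c' : Fin N → ℂ) (M M' : Mat N) :
    Matrix.of (blk a r c M) * Matrix.of (blk a' r' c' M') =
      Matrix.of (blk (a * a' + ∑ k, r k * c' k)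
        (a • r' + Matrix.vecMul r (Matrix.of M')) (a' • c + Matrix.mulVec (Matrix.of M) c')
        (fun i j => c i * r' j + (Matrix.of M * Matrix.of M') i j)) := by
  ext i j
  rw [Matrix.mul_apply, Fin.sum_univ_castSucc]
  induction i using Fin.lastCases with
  | last =>
    induction j using Fin.lastCases with
    | last => simp [add_comm]
    | cast j => simp [Matrix.vecMul, dotProduct, add_comm]
  | cast i =>
    induction j using Fin.lastCases with
    | last => simp [Matrix.mulVec, dotProduct, add_comm, mul_comm]
    | cast j => simp [Matrix.mul_apply, add_comm]

lemma blk_diag_conj (a : ℂ) (r c : Fin N → ℂ) (M : Mat N) (S S' : Matrix (Fin N) (Fin N) ℂ) :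
    Matrix.of (blk 1 0 0 (Matrix.of.symm S)) * Matrix.of (blk a r c M) *
        Matrix.of (blk 1 0 0 (Matrix.of.symm S')) =
      Matrix.of (blk a (Matrix.vecMul r S') (Matrix.mulVec S c)
        (Matrix.of.symm (S * Matrix.of M * S'))) := by
  rw [blk_mul_blk, blk_mul_blk]
  congr 2
  · simp
  · simp
  · simp
  · ext i j
    simp [Matrix.mul_apply]

/-- Invariance under conjugation by block matrices `1 ⊕ S`. -/
def ConjInvariant (F : Mat (N + 1) → ENNReal) : Prop :=
  ∀ S S' : Matrix (Fin N) (Fin N) ℂ, S * S' = 1 → ∀ a r c M,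
    F (blk a r c M) = F (blk a (Matrix.vecMul r S') (Matrix.mulVec S c)
      (Matrix.of.symm (S * Matrix.of M * S')))

lemma mulVec_blk_lastVec (S : Mat N) (b : ℂ) :
    Matrix.mulVec (Matrix.of (blk 1 0 0 S)) (b • lastVec (N + 1)) = b • lastVec (N + 1) := by
  ext i
  rw [Matrix.mulVec, dotProduct, Fin.sum_univ_castSucc]
  induction i using Fin.lastCases <;> simp [lastVec_last, lastVec_castSucc]

lemma vecMul_blk_lastVec (S : Mat N) :
    Matrix.vecMul (lastVec (N + 1)) (Matrix.of (blk 1 0 0 S)) = lastVec (N + 1) := by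
  ext i
  rw [Matrix.vecMul, dotProduct, Fin.sum_univ_castSucc]
  induction i using Fin.lastCases <;> simp [lastVec_last, lastVec_castSucc]

lemma blk_one : Matrix.of (blk 1 0 0 (Matrix.of.symm (1 : Matrix (Fin N) (Fin N) ℂ))) = 1 := by
  ext i j
  induction i using Fin.lastCases with
  | last =>
    induction j using Fin.lastCases with
    | last => simp
    | cast j => simp [(Fin.castSucc_lt_last j).ne']
  | cast i =>
    induction j using Fin.lastCases with
    | last => simp [(Fin.castSucc_lt_last i).ne]
    | cast j => simp [Matrix.one_apply]

lemma blk_diag_mul_of_mul_eq_one {S S' : Matrix (Fin N) (Fin N) ℂ} (hS : S * S' = 1) :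
    Matrix.of (blk 1 0 0 (Matrix.of.symm S)) * Matrix.of (blk 1 0 0 (Matrix.of.symm S')) = 1 := by
  rw [blk_mul_blk, ← blk_one]
  congr 2
  · simp
  · simp
  · simp
  · ext i j
    simp [hS]

/-- After one column is reduced, conjugation by `1 ⊕ S` still fixes the last basis vector. The
reduced border is thus untouched, and the smaller matrix can be reduced in turn. -/
lemma ConjInvariant.blk {F : Mat (N + 2) → ENNReal} (hF : ConjInvariant F) (a b : ℂ) :
    ConjInvariant fun M : Mat (N + 1) => F (blk a (lastVec (N + 1)) (b • lastVec (N + 1)) M) := by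
  intro S S' hS a' r c M
  have h1 := blk_diag_mul_of_mul_eq_one hS
  have h2 := hF _ _ h1 a (lastVec (N + 1)) (b • lastVec (N + 1)) (TriGUE.blk a' r c M)
  rw [mulVec_blk_lastVec, vecMul_blk_lastVec, blk_diag_conj, Equiv.symm_apply_apply] at h2
  exact h2

/-- Extend the normalized vector to an orthonormal basis in which it comes last, and take
coordinates in that basis. -/
lemma exists_unitary_mulVec (v : Fin (N + 1) → ℂ) (hv : v ≠ 0) :
    ∃ U : Matrix (Fin (N + 1)) (Fin (N + 1)) ℂ, U * U.conjTranspose = 1 ∧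
      Matrix.mulVec U v = ((√(∑ k, normSq (v k)) : ℝ) : ℂ) • lastVec (N + 1) := by
  set x : EuclideanSpace ℂ (Fin (N + 1)) := WithLp.toLp 2 v with hx
  have hx0 : x ≠ 0 := fun h => hv (by
    have := congrArg WithLp.ofLp h
    simpa [hx] using this)
  have hnorm : ‖x‖ = √(∑ k, normSq (v k)) := by
    rw [EuclideanSpace.norm_eq]
    simp [hx, normSq_eq_norm_sq]
  have hn0 : (‖x‖ : ℂ) ≠ 0 := by
    exact_mod_cast norm_ne_zero_iff.2 hx0
  have hon : Orthonormal ℂ (({Fin.last N} : Set (Fin (N + 1))).domRestrict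
      fun _ => ((‖x‖ : ℂ)⁻¹ • x)) := by
    constructor
    · intro i
      simp [Set.domRestrict, norm_smul, inv_mul_cancel₀ (norm_ne_zero_iff.2 hx0)]
    · intro i j hij
      exact absurd (Subsingleton.elim i j) hij
  obtain ⟨b, hb⟩ := hon.exists_orthonormalBasis_extension_of_card_eq (by simp)
  have hbl : b (Fin.last N) = (‖x‖ : ℂ)⁻¹ • x := hb _ rfl
  have hxb : x = (‖x‖ : ℂ) • b (Fin.last N) := by
    rw [hbl, smul_smul, mul_inv_cancel₀ hn0, one_smul]
  refine ⟨Matrix.of fun i j => conj (b i j), ?_, ?_⟩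
  · ext i j
    have h := orthonormal_iff_ite.1 b.orthonormal i j
    rw [EuclideanSpace.inner_eq_star_dotProduct] at h
    simp only [Matrix.mul_apply, Matrix.of_apply, Matrix.conjTranspose_apply, RCLike.star_def,
      conj_conj, Matrix.one_apply]
    rw [← h, dotProduct]
    refine Finset.sum_congr rfl fun k _ => ?_
    simp [mul_comm]
  · ext i
    have h : inner ℂ (b i) x = (‖x‖ : ℂ) * if i = Fin.last N then 1 else 0 := by
      conv_lhs => rw [hxb, inner_smul_right]
      rw [orthonormal_iff_ite.1 b.orthonormal i (Fin.last N)]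
    rw [EuclideanSpace.inner_eq_star_dotProduct] at h
    have hl : lastVec (N + 1) i = if i = Fin.last N then 1 else 0 := by
      simp [lastVec, Fin.ext_iff]
    rw [Pi.smul_apply, smul_eq_mul, hl, ← hnorm, ← h]
    simp only [Matrix.mulVec, dotProduct, Matrix.of_apply, hx]
    refine Finset.sum_congr rfl fun k _ => ?_
    simp [mul_comm]

lemma sum_normSq_cvec (y : Fin N × Fin 2 → ℝ) : ∑ k, normSq (cvec y k) = ∑ p, y p ^ 2 / 2 := by
  rw [Fintype.sum_prod_type]
  refine Finset.sum_congr rfl fun k _ => ?_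
  have h2 : √2 * √2 = (2 : ℝ) := Real.mul_self_sqrt (by norm_num)
  simp only [normSq_apply, cvec, Fin.sum_univ_two, div_mul_div_comm, h2]
  ring

lemma ConjInvariant.lintegral_blk {F : Mat (N + 1) → ENNReal} (hFm : Measurable F)
    (hF : ConjInvariant F) (a : ℂ) {y : Fin N × Fin 2 → ℝ} (hy : N = 0 ∨ y ≠ 0) :
    ∫⁻ M, F (TriGUE.blk a (fun k => conj (cvec y k)) (cvec y) M) ∂gueLaw N =
      ∫⁻ M, F (TriGUE.blk a (lastVec N) (((∑ p, y p ^ 2 / 2 : ℝ) : ℂ) • lastVec N) M)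
        ∂gueLaw N := by
  rcases N with _ | N
  · refine lintegral_congr fun M => ?_
    congr 2
    · exact Subsingleton.elim _ _
    · exact Subsingleton.elim _ _
  · have hy0 : y ≠ 0 := hy.resolve_left (by omega)
    have hpos : 0 < ∑ p, y p ^ 2 / 2 := by
      obtain ⟨p, hp⟩ := Function.ne_iff.1 hy0
      refine Finset.sum_pos' (fun q _ => by positivity) ⟨p, Finset.mem_univ p, ?_⟩
      have : y p ≠ 0 := hp
      positivity
    have hv : cvec y ≠ 0 := fun h => by
      have := sum_normSq_cvec y
      rw [h] at this
      simp only [Pi.zero_apply, map_zero, Finset.sum_const_zero] at this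
      exact hpos.ne this
    obtain ⟨U, hU, hUv⟩ := exists_unitary_mulVec (cvec y) hv
    rw [sum_normSq_cvec] at hUv
    set ρ : ℝ := √(∑ p, y p ^ 2 / 2) with hρ
    have hρ0 : (ρ : ℂ) ≠ 0 := by
      exact_mod_cast (Real.sqrt_pos.2 hpos).ne'
    have hρ2 : (ρ : ℂ) * ρ = ((∑ p, y p ^ 2 / 2 : ℝ) : ℂ) := by
      rw [← ofReal_mul, Real.mul_self_sqrt hpos.le]
    have hinv : (gueLaw (N + 1)).map (conjBy U) = gueLaw (N + 1) := by
      have := Measure.isProbabilityMeasure_map (μ := gueLaw (N + 1))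
        (measurable_conjBy U).aemeasurable
      exact ((isGUELaw_gueLaw _).map_conjBy hU).unique (isGUELaw_gueLaw _)
    -- Conjugating by `ρU` and not by `U` makes the last row exactly the basis vector and multiplies
    -- the column by `ρ` again, to `ρ²`; the scalars cancel on the smaller block, whose law is
    -- unitarily invariant. So only squared lengths appear.
    have hSS : ((ρ : ℂ) • U) * ((ρ : ℂ)⁻¹ • U.conjTranspose) = 1 := by
      rw [Matrix.smul_mul, Matrix.mul_smul, smul_smul, mul_inv_cancel₀ hρ0, one_smul, hU]
    have hstep : ∀ M, F (TriGUE.blk a (fun k => conj (cvec y k)) (cvec y) M) =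
        F (TriGUE.blk a (lastVec (N + 1)) (((∑ p, y p ^ 2 / 2 : ℝ) : ℂ) • lastVec (N + 1))
          (conjBy U M)) := fun M => by
      rw [hF _ _ hSS a]
      congr 2
      · ext k
        have := congrFun hUv k
        have h2 := congrArg conj this
        simp only [Matrix.mulVec, dotProduct, map_sum, map_mul, Pi.smul_apply, smul_eq_mul,
          conj_ofReal] at h2
        rw [Matrix.vecMul_smul, Pi.smul_apply, Matrix.vecMul, dotProduct]
        simp only [Matrix.conjTranspose_apply, RCLike.star_def]
        have h3 : conj (lastVec (N + 1) k) = lastVec (N + 1) k := by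
          unfold lastVec
          split_ifs <;> simp
        rw [h3] at h2
        rw [smul_eq_mul, inv_mul_eq_iff_eq_mul₀ hρ0, ← h2]
        exact Finset.sum_congr rfl fun _ _ => mul_comm _ _
      · rw [Matrix.smul_mulVec, hUv, smul_smul, hρ2]
      · change _ = Matrix.of.symm (U * Matrix.of M * U.conjTranspose)
        rw [Matrix.smul_mul, Matrix.smul_mul, Matrix.mul_smul, smul_smul,
          mul_inv_cancel₀ hρ0, one_smul]
    simp only [hstep]
    have hmeas : Measurable fun M : Mat (N + 1) => F (TriGUE.blk a (lastVec (N + 1))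
        (((∑ p, y p ^ 2 / 2 : ℝ) : ℂ) • lastVec (N + 1)) M) :=
      hFm.comp (measurable_blk measurable_const measurable_const measurable_const measurable_id)
    conv_rhs => rw [← hinv]
    rw [lintegral_map hmeas (measurable_conjBy U)]

/-- The tridiagonal model has the same invariant statistics as a GUE matrix. -/
lemma ConjInvariant.lintegral_eq {F : Mat (N + 1) → ENNReal} (hFm : Measurable F)
    (hF : ConjInvariant F) : ∫⁻ M, F M ∂gueLaw (N + 1) = ∫⁻ M, F M ∂triLaw (N + 1) := by
  induction N with
  | zero =>
    rw [gueLaw, triLaw, lintegral_map hFm measurable_gue_blk, lintegral_map hFm measurable_tri_blk,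
      gueLaw, triLaw]
    refine lintegral_congr fun x => ?_
    congr 2
    · exact Subsingleton.elim _ _
    · exact Subsingleton.elim _ _
  | succ N ih =>
    have hg : Measurable fun x : (ℝ × (Fin (N + 1) × Fin 2 → ℝ)) × Mat (N + 1) =>
        F (TriGUE.blk x.1.1 (fun k => conj (cvec x.1.2 k)) (cvec x.1.2) x.2) :=
      hFm.comp measurable_gue_blk
    have ht : Measurable fun x : (ℝ × (Fin (N + 1) × Fin 2 → ℝ)) × Mat (N + 1) =>
        F (TriGUE.blk x.1.1 (lastVec (N + 1))
          (((∑ p, x.1.2 p ^ 2 / 2 : ℝ) : ℂ) • lastVec (N + 1)) x.2) :=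
      hFm.comp measurable_tri_blk
    rw [gueLaw, triLaw, lintegral_map hFm measurable_gue_blk, lintegral_map hFm measurable_tri_blk,
      lintegral_prod _ hg.aemeasurable, lintegral_prod _ ht.aemeasurable]
    -- A zero column has no direction to rotate and no invertible `ρ`, but it occurs with
    -- probability zero.
    have hae : ∀ᵐ x ∂borderLaw (N + 1), x.2 ≠ 0 := by
      have h1 : ∀ᵐ y ∂(Measure.pi fun _ : Fin (N + 1) × Fin 2 => gaussianReal 0 1), y ≠ 0 := by
        have hna : NullSingletonClass (gaussianReal 0 1) :=
          nullSingletonClass_gaussianReal one_ne_zero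
        refine (measure_eq_zero_iff_ae_notMem.1 (measure_singleton (μ := Measure.pi
          fun _ : Fin (N + 1) × Fin 2 => gaussianReal 0 1) 0)).mono fun y hy => ?_
        simpa using hy
      exact Measure.quasiMeasurePreserving_snd.ae h1
    refine lintegral_congr_ae (hae.mono fun x hx => ?_)
    simp only
    rw [hF.lintegral_blk hFm x.1 (Or.inr hx)]
    exact ih (hFm.comp (measurable_blk measurable_const measurable_const measurable_const
      measurable_id)) (hF.blk _ _)

end Tridiagonal

/-! ### The tridiagonal matrix in i.i.d. normal variables -/

section TridiagonalModel

variable {N : ℕ}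

instance : IsProbabilityMeasure iidNormal := by
  unfold iidNormal
  infer_instance

lemma iIndepFun_iidNormal : iIndepFun (fun (p : ℤ × ℕ) (ξ : ℤ × ℕ → ℝ) => ξ p) iidNormal :=
  iIndepFun_infinitePi (X := fun _ x => x) fun _ => measurable_id

lemma iidNormal_map_eval (p : ℤ × ℕ) : iidNormal.map (fun ξ => ξ p) = gaussianReal 0 1 :=
  Measure.infinitePi_map_eval (fun _ : ℤ × ℕ => gaussianReal 0 1) p

lemma iidNormal_map_precomp {α : Type*} [Fintype α] {u : α → ℤ × ℕ} (hu : Function.Injective u) :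
    iidNormal.map (fun ξ a => ξ (u a)) = Measure.pi fun _ => gaussianReal 0 1 := by
  have h := (iIndepFun_iff_map_fun_eq_pi_map (μ := iidNormal)
    (f := fun (a : α) (ξ : ℤ × ℕ → ℝ) => ξ (u a))
    (fun a => (measurable_pi_apply (u a)).aemeasurable)).1 (iIndepFun_iidNormal.precomp hu)
  rw [h]
  simp only [iidNormal_map_eval]

/-- Functions of disjoint finite sets of coordinates are independent. -/
lemma indepFun_iidNormal {β γ : Type*} [MeasurableSpace β] [MeasurableSpace γ]
    {X : (ℤ × ℕ → ℝ) → β} {Y : (ℤ × ℕ → ℝ) → γ} (hX : Measurable X) (hY : Measurable Y)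
    {S T : Finset (ℤ × ℕ)} (hST : Disjoint S T)
    (hXS : ∀ ξ ξ', (∀ p ∈ S, ξ p = ξ' p) → X ξ = X ξ')
    (hYT : ∀ ξ ξ', (∀ p ∈ T, ξ p = ξ' p) → Y ξ = Y ξ') : IndepFun X Y iidNormal := by
  have hext : ∀ U : Finset (ℤ × ℕ), Measurable fun (η : U → ℝ) (p : ℤ × ℕ) =>
      if h : p ∈ U then η ⟨p, h⟩ else 0 := fun U =>
    measurable_pi_lambda _ fun p => by
      by_cases h : p ∈ U
      · simp only [h, dif_pos]
        fun_prop
      · simp only [h, dif_neg, not_false_iff]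
        fun_prop
  have h := (iIndepFun_iidNormal.indepFun_finset S T hST fun p => measurable_pi_apply p).comp
    (hX.comp (hext S)) (hY.comp (hext T))
  convert h using 1
  · ext ξ
    exact hXS _ _ fun p hp => by simp [hp]
  · ext ξ
    exact hYT _ _ fun p hp => by simp [hp]

/-- The entries of the tridiagonal model. -/
def triEntry (ξ : ℤ × ℕ → ℝ) (h h' : ℤ) : ℝ :=
  if h' = h then ξ (h, 0)
  else if h' = h + 1 then ∑ k ∈ Finset.range (2 * h).toNat, ξ (h, k + 1) ^ 2 / 2
  else if h = h' + 1 then 1 else 0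

/-- The tridiagonal model of the GUE. -/
def triMat (N : ℕ) (ξ : ℤ × ℕ → ℝ) : Mat N := fun i j =>
  ((triEntry ξ ((i : ℤ) + 1) ((j : ℤ) + 1) : ℝ) : ℂ)

lemma measurable_triEntry (h h' : ℤ) : Measurable fun ξ => triEntry ξ h h' := by
  unfold triEntry
  split_ifs <;> fun_prop

lemma measurable_triMat : Measurable (triMat N) :=
  measurable_pi_lambda _ fun _ => measurable_pi_lambda _ fun _ =>
    Complex.measurable_ofReal.comp (measurable_triEntry _ _)

lemma sum_range_two_mul {E : Type*} [AddCommMonoid E] (F : ℕ → E) (N : ℕ) :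
    ∑ k ∈ Finset.range (2 * N), F k = ∑ p : Fin N × Fin 2, F (2 * p.1 + p.2) := by
  rw [Fintype.sum_prod_type]
  simp only [Fin.sum_univ_two, Fin.val_zero, Fin.val_one, add_zero]
  rw [Fin.sum_univ_eq_sum_range fun k => F (2 * k) + F (2 * k + 1)]
  induction N with
  | zero => simp
  | succ N ih =>
    rw [show 2 * (N + 1) = 2 * N + 1 + 1 by ring, Finset.sum_range_succ, Finset.sum_range_succ, ih,
      Finset.sum_range_succ, add_assoc]

/-- The border of the tridiagonal model. -/
def triBorder (N : ℕ) (ξ : ℤ × ℕ → ℝ) : ℝ × (Fin N × Fin 2 → ℝ) :=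
  (ξ ((N : ℤ) + 1, 0), fun p => ξ (N, 2 * p.1 + p.2 + 1))

/-- The entry above the diagonal at height `N` uses the variables `ξ (N, ·)` with second index `1,
…, 2N`, which are precisely the ones the smaller matrix leaves unused. -/
lemma triMat_succ (ξ : ℤ × ℕ → ℝ) : triMat (N + 1) ξ =
    blk (triBorder N ξ).1 (lastVec N)
      (((∑ p, (triBorder N ξ).2 p ^ 2 / 2 : ℝ) : ℂ) • lastVec N) (triMat N ξ) := by
  ext i j
  induction i using Fin.lastCases with
  | last =>
    induction j using Fin.lastCases with
    | last => simp [triMat, triEntry, triBorder]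
    | cast j =>
      have := j.2
      have h1 : ¬ ((j : ℤ) = N) := by omega
      have h2 : ¬ ((j : ℤ) = N + 1) := by omega
      simp only [triMat, triEntry, lastVec, blk_last_castSucc, Fin.val_last, Fin.val_castSucc,
        add_left_inj, h1, h2, if_false]
      by_cases h : (j : ℕ) + 1 = N
      · have : (N : ℤ) = j + 1 := by omega
        simp [h, this]
      · have : ¬ (N : ℤ) = j + 1 := by omega
        simp [h, this]
  | cast i =>
    induction j using Fin.lastCases with
    | last =>
      have := i.2
      have h1 : ¬ ((N : ℤ) = i) := by omega
      have h2 : ¬ ((i : ℤ) = N + 1) := by omega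
      simp only [triMat, triEntry, lastVec, blk_castSucc_last, Fin.val_last, Fin.val_castSucc,
        add_left_inj, h1, h2, if_false, Pi.smul_apply, smul_eq_mul]
      by_cases h : (i : ℕ) + 1 = N
      · have h3 : (N : ℤ) = i + 1 := by omega
        have h4 : (2 * (N : ℤ)).toNat = 2 * N := by omega
        simp only [h, ← h3, if_true, triBorder, h4, mul_one]
        rw [sum_range_two_mul fun k => ξ ((N : ℤ), k + 1) ^ 2 / 2]
      · have : ¬ (N : ℤ) = i + 1 := by omega
        simp [h, this]
    | cast j => simp [triMat]

lemma measurable_triBorder : Measurable (triBorder N) := by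
  unfold triBorder
  fun_prop

lemma iidNormal_map_triBorder : iidNormal.map (triBorder N) = borderLaw N := by
  have hu : Function.Injective fun p : Fin N × Fin 2 => ((N : ℤ), 2 * (p.1 : ℕ) + p.2 + 1) := by
    rintro ⟨⟨a, ha⟩, ⟨b, hb⟩⟩ ⟨⟨a', ha'⟩, ⟨b', hb'⟩⟩ h
    simp only [Prod.mk.injEq, true_and] at h
    simp only [Prod.mk.injEq, Fin.mk.injEq]
    omega
  have h := (indepFun_iff_map_prod_eq_prod_map_map (μ := iidNormal)
    (f := fun ξ => ξ ((N : ℤ) + 1, 0))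
    (g := fun ξ (p : Fin N × Fin 2) => ξ ((N : ℤ), 2 * (p.1 : ℕ) + p.2 + 1))
    (measurable_pi_apply _).aemeasurable
    (measurable_pi_lambda _ fun _ => measurable_pi_apply _).aemeasurable).1
    (indepFun_iidNormal (by fun_prop) (by fun_prop) (S := {((N : ℤ) + 1, 0)})
      (T := Finset.univ.image fun p : Fin N × Fin 2 => ((N : ℤ), 2 * (p.1 : ℕ) + p.2 + 1))
      (by
        rw [Finset.disjoint_left]
        intro p hp hp'
        obtain ⟨q, _, hq⟩ := Finset.mem_image.1 hp'
        rw [Finset.mem_singleton.1 hp] at hq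
        simp at hq)
      (fun ξ ξ' h => h _ (by simp))
      (fun ξ ξ' h => funext fun p => h _ (Finset.mem_image_of_mem _ (Finset.mem_univ p))))
  rw [iidNormal_map_precomp hu, iidNormal_map_eval] at h
  exact h

/-- The coordinates on which `triMat N` depends. -/
def triCoords (N : ℕ) : Finset (ℤ × ℕ) :=
  ((Finset.Icc (1 : ℤ) N) ×ˢ Finset.range (2 * N)).filter fun p => p.2 = 0 ∨ p.1 < N

lemma triMat_congr {ξ ξ' : ℤ × ℕ → ℝ} (h : ∀ p ∈ triCoords N, ξ p = ξ' p) :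
    triMat N ξ = triMat N ξ' := by
  ext i j
  have hi := i.2
  have hj := j.2
  simp only [triMat]
  congr 1
  unfold triEntry
  split_ifs with h1 h2 h3
  · refine h _ ?_
    simp [triCoords]
    omega
  · refine Finset.sum_congr rfl fun k hk => ?_
    rw [Finset.mem_range] at hk
    rw [h]
    simp [triCoords]
    omega
  · rfl
  · rfl

/-- By `triMat_succ` the matrix is bordered as in `triLaw`; border and smaller matrix depend on
disjoint sets of coordinates and are therefore independent. -/
lemma iidNormal_map_triMat (N : ℕ) : iidNormal.map (triMat N) = triLaw N := by
  induction N with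
  | zero =>
    have : triMat 0 = fun _ => (0 : Mat 0) := funext fun _ => Subsingleton.elim _ _
    rw [this, Measure.map_const, triLaw]
    simp
  | succ N ih =>
    have h := (indepFun_iff_map_prod_eq_prod_map_map (μ := iidNormal)
      (f := triBorder N) (g := triMat N) measurable_triBorder.aemeasurable
      measurable_triMat.aemeasurable).1
      (indepFun_iidNormal measurable_triBorder measurable_triMat
        (S := insert ((N : ℤ) + 1, 0)
          (Finset.univ.image fun p : Fin N × Fin 2 => ((N : ℤ), 2 * (p.1 : ℕ) + p.2 + 1)))
        (T := triCoords N)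
        (by
          rw [Finset.disjoint_left]
          intro p hp hp'
          simp only [triCoords, Finset.mem_filter, Finset.mem_product, Finset.mem_Icc] at hp'
          rcases Finset.mem_insert.1 hp with rfl | hp
          · simp at hp'
          · obtain ⟨q, _, rfl⟩ := Finset.mem_image.1 hp
            simp at hp')
        (fun ξ ξ' h => Prod.ext (h _ (by simp)) (funext fun p => h _
          (Finset.mem_insert_of_mem (Finset.mem_image_of_mem _ (Finset.mem_univ p)))))
        fun ξ ξ' h => triMat_congr h)
    rw [iidNormal_map_triBorder, ih] at h
    rw [triLaw, ← h, Measure.map_map measurable_tri_blk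
      (measurable_triBorder.prodMk measurable_triMat)]
    congr 1
    exact funext fun ξ => triMat_succ ξ

/-- Products of traces of powers. -/
def traceProd {ι : Type*} (s : Finset ι) (m : ι → ℕ) (M : Mat N) : ℝ :=
  ∏ i ∈ s, ((Matrix.of M ^ m i).trace).re

lemma continuous_traceProd {ι : Type*} (s : Finset ι) (m : ι → ℕ) :
    Continuous (traceProd (N := N) s m) := by
  unfold traceProd
  refine continuous_finsetProd _ fun i _ => Complex.continuous_re.comp ?_
  have h : Continuous fun M : Mat N => Matrix.of M :=
    continuous_pi fun i => continuous_pi fun j => by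
      simp only [Matrix.of_apply]
      fun_prop
  exact (h.pow (m i)).matrix_trace

lemma traceProd_blk {ι : Type*} (s : Finset ι) (m : ι → ℕ) {S S' : Matrix (Fin N) (Fin N) ℂ}
    (hS : S * S' = 1) (a : ℂ) (r c : Fin N → ℂ) (M : Mat N) :
    traceProd s m (blk a r c M) = traceProd s m (blk a (Matrix.vecMul r S') (Matrix.mulVec S c)
      (Matrix.of.symm (S * Matrix.of M * S'))) := by
  have h1 := blk_diag_mul_of_mul_eq_one hS
  let u : (Matrix (Fin (N + 1)) (Fin (N + 1)) ℂ)ˣ :=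
    ⟨Matrix.of (blk 1 0 0 (Matrix.of.symm S)), Matrix.of (blk 1 0 0 (Matrix.of.symm S')), h1,
      mul_eq_one_comm.1 h1⟩
  have h2 : Matrix.of (blk a (Matrix.vecMul r S') (Matrix.mulVec S c)
      (Matrix.of.symm (S * Matrix.of M * S'))) = u.1 * Matrix.of (blk a r c M) * u⁻¹.1 :=
    (blk_diag_conj a r c M S S').symm
  unfold traceProd
  refine Finset.prod_congr rfl fun i _ => ?_
  rw [h2, Units.conj_pow, Matrix.trace_units_conj]

/-- Indicators of events in the trace statistics are conjugation invariant, so the laws agree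
without any integrability assumption. -/
lemma gueLaw_map_traceProd {ι : Type*} (s : Finset ι) (m : ι → ℕ) :
    (gueLaw (N + 1)).map (traceProd s m) = (triLaw (N + 1)).map (traceProd s m) := by
  have hm := (continuous_traceProd (N := N + 1) s m).measurable
  refine Measure.ext fun t ht => ?_
  rw [Measure.map_apply hm ht, Measure.map_apply hm ht, ← lintegral_indicator_one (hm ht),
    ← lintegral_indicator_one (hm ht)]
  refine ConjInvariant.lintegral_eq (measurable_one.indicator (hm ht)) ?_
  intro S S' hS a r c M
  simp only [Set.indicator, Set.mem_preimage, traceProd_blk s m hS a r c M, Pi.one_apply]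

lemma IsStandardGUE.integral_traceProd {Ω : Type*} [MeasurableSpace Ω] {P : Measure Ω}
    [IsProbabilityMeasure P] {Ξ : Ω → Matrix (Fin N) (Fin N) ℂ} (hN : 0 < N)
    (hΞ : IsStandardGUE P Ξ) {ι : Type*} (s : Finset ι) (m : ι → ℕ) :
    ∫ ω, ∏ i ∈ s, ((Ξ ω ^ m i).trace).re ∂P = ∫ ξ, traceProd s m (triMat N ξ) ∂iidNormal := by
  obtain ⟨N, rfl⟩ : ∃ K, N = K + 1 := ⟨N - 1, by omega⟩
  have hc := continuous_traceProd (N := N + 1) s m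
  have hm : Measurable fun ω => (fun i j => Ξ ω i j : Mat (N + 1)) :=
    measurable_pi_lambda _ fun i => measurable_pi_lambda _ fun j => hΞ.measurable i j
  have h1 : ∫ ω, ∏ i ∈ s, ((Ξ ω ^ m i).trace).re ∂P = ∫ M, traceProd s m M ∂gueLaw (N + 1) := by
    rw [← hΞ.map_eq, integral_map hm.aemeasurable hc.aestronglyMeasurable]
    rfl
  have h2 : ∀ μ : Measure (Mat (N + 1)), ∫ M, traceProd s m M ∂μ = ∫ x, x ∂μ.map (traceProd s m) :=
    fun μ => (integral_map hc.measurable.aemeasurable (f := fun x => x)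
      (by fun_prop)).symm
  rw [h1, h2, gueLaw_map_traceProd, ← h2, ← iidNormal_map_triMat,
    integral_map measurable_triMat.aemeasurable hc.aestronglyMeasurable]

end TridiagonalModel

section Orbits

/-! ### Labelling the orbits of a permutation -/

/-- Equal multisets of values mean fibres of equal size, which can be matched one value at a time.
-/
lemma exists_equiv_of_map_univ_eq {α β γ : Type*} [Fintype α] [Fintype β] {f : α → γ} {g : β → γ}
    (h : (Finset.univ : Finset α).val.map f = (Finset.univ : Finset β).val.map g) :
    ∃ e : α ≃ β, ∀ a, g (e a) = f a := by
  have hc : ∀ c, Fintype.card {a // f a = c} = Fintype.card {b // g b = c} := fun c => by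
    have := congrArg (Multiset.count c) h
    rw [Multiset.count_map, Multiset.count_map] at this
    rw [Fintype.card_subtype, Fintype.card_subtype]
    simpa only [Finset.card_def, Finset.filter_val, eq_comm] using this
  exact ⟨Equiv.ofFiberEquiv fun c => Fintype.equivOfCardEq (hc c),
    fun a => Equiv.ofFiberEquiv_map _ a⟩

variable {n : ℕ}

lemma image_orbits_eq (θ : Equiv.Perm (Fin n)) :
    (Finset.univ.image fun q : Quotient (orb θ) =>
      Finset.univ.filter fun i => (Quotient.mk (orb θ) i) = q) =
    θ.cycleFactorsFinset.image Equiv.Perm.support ∪ θ.supportᶜ.image fun i => {i} := by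
  have hq : ∀ i, (Finset.univ.filter fun j => Quotient.mk (orb θ) j = Quotient.mk (orb θ) i) =
      Finset.univ.filter fun j => θ.SameCycle j i := fun i => by
    ext j
    simp only [Finset.mem_filter, Finset.mem_univ, true_and]
    exact Quotient.eq
  have hs : ∀ i ∈ θ.support, (Finset.univ.filter fun j => θ.SameCycle j i) =
      (θ.cycleOf i).support := fun i hi => by
    ext j
    rw [Equiv.Perm.mem_support_cycleOf_iff' (Equiv.Perm.mem_support.1 hi)]
    simp [Equiv.Perm.sameCycle_comm]
  have hf : ∀ i ∉ θ.support, (Finset.univ.filter fun j => θ.SameCycle j i) = {i} := fun i hi => by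
    ext j
    simp only [Finset.mem_filter, Finset.mem_univ, true_and, Finset.mem_singleton]
    refine ⟨fun h => ?_, fun h => h ▸ Equiv.Perm.SameCycle.refl _ _⟩
    exact (h.symm.eq_of_left (Equiv.Perm.notMem_support.1 hi)).symm
  ext T
  simp only [Finset.mem_image, Finset.mem_univ, true_and, Finset.mem_union, Finset.mem_compl]
  constructor
  · rintro ⟨q, rfl⟩
    induction q using Quotient.inductionOn with
    | h i =>
      rw [hq]
      by_cases hi : i ∈ θ.support
      · exact Or.inl ⟨θ.cycleOf i, Equiv.Perm.cycleOf_mem_cycleFactorsFinset_iff.2 hi, (hs i hi).symm⟩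
      · exact Or.inr ⟨i, hi, (hf i hi).symm⟩
  · rintro (⟨c, hc, rfl⟩ | ⟨i, hi, rfl⟩)
    · obtain ⟨hcyc, hca⟩ := Equiv.Perm.mem_cycleFactorsFinset_iff.1 hc
      obtain ⟨i, hi⟩ := hcyc.nonempty_support
      have h1 : c = θ.cycleOf i := Equiv.Perm.cycle_is_cycleOf hi hc
      have h2 : i ∈ θ.support := Equiv.Perm.mem_cycleFactorsFinset_support_le hc hi
      exact ⟨Quotient.mk _ i, by rw [hq, hs i h2, h1]⟩
    · exact ⟨Quotient.mk _ i, by rw [hq, hf i hi]⟩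

/-- The orbits are the supports of the cycle factors together with the fixed singletons, matching
the definition of the partition of `θ` as cycle type plus parts `1`. -/
lemma map_card_orbits (θ : Equiv.Perm (Fin n)) :
    ((Finset.univ : Finset (Quotient (orb θ))).val.map fun q =>
      (Finset.univ.filter fun i => (Quotient.mk (orb θ) i) = q).card) = θ.partition.parts := by
  have hinj : Function.Injective fun q : Quotient (orb θ) =>
      Finset.univ.filter fun i => (Quotient.mk (orb θ) i) = q := fun q q' h => by
    induction q using Quotient.inductionOn with
    | h i =>
      have : i ∈ Finset.univ.filter fun j => Quotient.mk (orb θ) j = Quotient.mk (orb θ) i := by simp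
      rw [show (Finset.univ.filter fun j => Quotient.mk (orb θ) j = Quotient.mk (orb θ) i) =
        Finset.univ.filter fun j => Quotient.mk (orb θ) j = q' from h] at this
      simpa using this
  have h1 := congrArg (Multiset.map Finset.card) (Finset.image_val_of_injOn
    (s := (Finset.univ : Finset (Quotient (orb θ)))) hinj.injOn)
  rw [Multiset.map_map] at h1
  refine h1.symm.trans ?_
  rw [image_orbits_eq, ← Finset.disjUnion_eq_union _ _ ?_, Finset.disjUnion_val, Multiset.map_add,
    Finset.image_val_of_injOn, Finset.image_val_of_injOn, Multiset.map_map, Multiset.map_map,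
    Equiv.Perm.parts_partition, Equiv.Perm.cycleType_def]
  · congr 1
    simp only [Function.comp_def, Finset.card_singleton, Multiset.map_const']
    rw [← Finset.card_def, Finset.card_compl]
  · exact Set.injOn_of_injective Finset.singleton_injective
  · intro c hc c' hc' h
    by_contra hne
    have hd := Equiv.Perm.cycleFactorsFinset_pairwise_disjoint θ hc hc' hne
    rw [Equiv.Perm.disjoint_iff_disjoint_support, show c.support = c'.support from h,
      disjoint_self] at hd
    exact (Equiv.Perm.mem_cycleFactorsFinset_iff.1 hc').1.ne_one
      (Equiv.Perm.support_eq_empty_iff.1 hd)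
  · rw [Finset.disjoint_left]
    intro T hT hT'
    obtain ⟨c, hc, rfl⟩ := Finset.mem_image.1 hT
    obtain ⟨i, hi, hi'⟩ := Finset.mem_image.1 hT'
    have : i ∈ c.support := by rw [← hi']; simp
    exact Finset.mem_compl.1 hi (Equiv.Perm.mem_cycleFactorsFinset_support_le hc this)

/-- A labelling of the orbits of `θ` by the parts of its cycle type. -/
lemma exists_label (θ : Equiv.Perm (Fin n)) {L : List ℕ} (hL : (L : Multiset ℕ) = θ.partition.parts) :
    ∃ f : Fin n → Fin L.length, Function.Surjective f ∧ (∀ i j, f i = f j ↔ θ.SameCycle i j) ∧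
      ∀ c, (Finset.univ.filter fun i => f i = c).card = L.get c := by
  have h : ((Finset.univ : Finset (Quotient (orb θ))).val.map fun q =>
      (Finset.univ.filter fun i => (Quotient.mk (orb θ) i) = q).card) =
      (Finset.univ : Finset (Fin L.length)).val.map L.get := by
    rw [map_card_orbits, ← hL, Fin.univ_val_map, List.ofFn_get]
  obtain ⟨e, he⟩ := exists_equiv_of_map_univ_eq h
  refine ⟨fun i => e (Quotient.mk (orb θ) i), e.surjective.comp Quotient.mk_surjective,
    fun i j => ?_, fun c => ?_⟩
  · rw [e.apply_eq_iff_eq]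
    exact Quotient.eq
  · rw [← e.apply_symm_apply c, he, e.apply_symm_apply]
    congr 1
    ext i
    simp [Equiv.eq_symm_apply]

end Orbits

section Traces

/-! ### Traces of powers as sums over closed walks -/

variable {ι : Type*} [Fintype ι] {R : Type*} [CommRing R]

lemma pow_succ_apply_eq_sum [DecidableEq ι] (M : Matrix ι ι R) (m : ℕ) (i j : ι) :
    (M ^ (m + 1)) i j = ∑ w : Fin m → ι, ∏ k : Fin (m + 1),
      M ((Fin.cons i w : Fin (m + 1) → ι) k) ((Fin.snoc w j : Fin (m + 1) → ι) k) := by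
  induction m generalizing i with
  | zero =>
    simp [Fin.snoc]
  | succ m ih =>
    rw [pow_succ', Matrix.mul_apply, ← (Fin.consEquiv fun _ => ι).sum_comp, Fintype.sum_prod_type]
    refine Finset.sum_congr rfl fun x _ => ?_
    rw [ih, Finset.mul_sum]
    refine Finset.sum_congr rfl fun w _ => ?_
    change _ = ∏ k, M ((Fin.cons i (Fin.cons x w : Fin (m + 1) → ι) : Fin (m + 2) → ι) k)
      ((Fin.snoc (Fin.cons x w : Fin (m + 1) → ι) j : Fin (m + 2) → ι) k)
    rw [Fin.prod_univ_succ (n := m + 1)]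
    have h : (Fin.snoc (Fin.cons x w : Fin (m + 1) → ι) j : Fin (m + 2) → ι) =
        Fin.cons x (Fin.snoc w j : Fin (m + 1) → ι) := (Fin.cons_snoc_eq_snoc_cons x w j).symm
    simp only [h, Fin.cons_zero, Fin.cons_succ]

lemma trace_pow_eq_sum [DecidableEq ι] (M : Matrix ι ι R) (m : ℕ) :
    (M ^ (m + 1)).trace = ∑ w : Fin (m + 1) → ι, ∏ k, M (w k) (w (finRotate _ k)) := by
  rw [Matrix.trace, ← (Fin.consEquiv fun _ => ι).sum_comp, Fintype.sum_prod_type]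
  refine Finset.sum_congr rfl fun i _ => ?_
  rw [Matrix.diag_apply, pow_succ_apply_eq_sum]
  refine Finset.sum_congr rfl fun w _ => ?_
  simp only [Fin.consEquiv_apply]
  have h := Fin.snoc_eq_cons_rotate w i
  refine Finset.prod_congr rfl fun k _ => ?_
  rw [h]

variable {n : ℕ}

lemma card_orbit_eq_minimalPeriod (θ : Equiv.Perm (Fin n)) (x : Fin n) :
    (Finset.univ.filter fun i => θ.SameCycle x i).card = Function.minimalPeriod θ x := by
  have hp : 0 < Function.minimalPeriod θ x :=
    Function.minimalPeriod_pos_of_mem_periodicPts (θ.injective.mem_periodicPts x)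
  have : (Finset.univ.filter fun i => θ.SameCycle x i) =
      (Finset.range (Function.minimalPeriod θ x)).image fun k => θ^[k] x := by
    ext y
    simp only [Finset.mem_filter, Finset.mem_univ, true_and, Finset.mem_image, Finset.mem_range]
    constructor
    · intro h
      obtain ⟨k, hk⟩ := h.exists_nat_pow_eq
      refine ⟨k % Function.minimalPeriod θ x, Nat.mod_lt _ hp, ?_⟩
      rw [Function.iterate_mod_minimalPeriod_eq, ← hk, Equiv.Perm.coe_pow]
    · rintro ⟨k, _, rfl⟩
      exact ⟨k, by simp [Equiv.Perm.coe_pow]⟩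
  rw [this, Finset.card_image_of_injOn, Finset.card_range]
  intro a ha b hb hab
  exact Function.iterate_injOn_Iio_minimalPeriod (by simpa using ha) (by simpa using hb) hab

/-- A product of traces of powers is a sum over functions on the points being permuted. -/
lemma prod_trace_pow_eq_sum [DecidableEq ι] {γ : Type*} [Fintype γ] (θ : Equiv.Perm (Fin n))
    {f : Fin n → γ}
    (hs : Function.Surjective f) (hf : ∀ i j, f i = f j ↔ θ.SameCycle i j) {L : γ → ℕ}
    (hL : ∀ c, (Finset.univ.filter fun i => f i = c).card = L c) (M : γ → Matrix ι ι R) :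
    ∏ c, (M c ^ L c).trace = ∑ w : Fin n → ι, ∏ i, M (f i) (w i) (w (θ i)) := by
  choose g hg using hs
  have hfg : ∀ c k, f (θ^[k] (g c)) = c := fun c k => by
    rw [← hg c, hf, hg]
    exact Equiv.Perm.SameCycle.symm ⟨k, by simp [Equiv.Perm.coe_pow]⟩
  have hper : ∀ c, Function.minimalPeriod θ (g c) = L c := fun c => by
    rw [← card_orbit_eq_minimalPeriod, ← hL]
    congr 1
    ext i
    simp only [Finset.mem_filter, Finset.mem_univ, true_and, ← hf, hg, eq_comm]
  have hpos : ∀ c, 0 < L c := fun c => by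
    rw [← hper]
    exact Function.minimalPeriod_pos_of_mem_periodicPts (θ.injective.mem_periodicPts (g c))
  -- Starting each orbit at a chosen point identifies `Fin n` with a disjoint union of cyclic words,
  -- on which `θ` acts by rotation.
  let F : (Σ c, Fin (L c)) → Fin n := fun p => θ^[p.2] (g p.1)
  have hF : Function.Bijective F := by
    rw [Fintype.bijective_iff_injective_and_card]
    constructor
    · rintro ⟨c, k⟩ ⟨c', k'⟩ h
      have hc : c = c' := by rw [← hfg c k, ← hfg c' k']; exact congrArg f h
      subst hc
      have : (k : ℕ) = k' := Function.iterate_injOn_Iio_minimalPeriod (f := θ) (x := g c)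
        (by rw [hper]; exact k.2) (by rw [hper]; exact k'.2) h
      rw [Fin.ext this]
    · rw [Fintype.card_sigma]
      simp only [Fintype.card_fin]
      simp only [← hL]
      have := Finset.card_eq_sum_card_fiberwise (s := Finset.univ) (f := f) (t := Finset.univ)
        fun _ _ => Finset.mem_coe.2 (Finset.mem_univ _)
      rw [← this]
      simp
  have htr : ∀ c, (M c ^ L c).trace = ∑ w : Fin (L c) → ι, ∏ k, M c (w k) (w (finRotate _ k)) := by
    intro c
    obtain ⟨m, hm⟩ : ∃ m, L c = m + 1 := ⟨L c - 1, by have := hpos c; omega⟩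
    rw [hm]
    exact trace_pow_eq_sum _ _
  have hrot : ∀ c (k : Fin (L c)), θ (F ⟨c, k⟩) = F ⟨c, finRotate _ k⟩ := fun c k => by
    have h1 : ∀ (l : ℕ) (hl : L c = l) (k : Fin l), θ (θ^[k] (g c)) = θ^[finRotate l k] (g c) := by
      intro l hl k
      obtain ⟨m, rfl⟩ : ∃ m, l = m + 1 := ⟨l - 1, by have := k.2; omega⟩
      rw [← Function.iterate_succ_apply' θ]
      by_cases hk : k = Fin.last m
      · subst hk
        rw [finRotate_last, Fin.val_last, Fin.val_zero, Function.iterate_zero, id_eq]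
        have := Function.isPeriodicPt_minimalPeriod θ (g c)
        rw [hper, hl] at this
        exact this
      · rw [coe_finRotate_of_ne_last hk]
    exact h1 _ rfl k
  simp only [htr]
  rw [Finset.prod_univ_sum, Fintype.piFinset_univ]
  let E := Equiv.ofBijective F hF
  rw [← (Equiv.piCurry fun (c : γ) (_ : Fin (L c)) => ι).sum_comp,
    ← (E.arrowCongr (Equiv.refl ι)).symm.sum_comp]
  refine Finset.sum_congr rfl fun w _ => ?_
  rw [← E.prod_comp, Fintype.prod_sigma]
  refine Finset.prod_congr rfl fun c _ => Finset.prod_congr rfl fun k _ => ?_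
  have h1 : f (E ⟨c, k⟩) = c := hfg c k
  have h2 : θ (E ⟨c, k⟩) = E ⟨c, finRotate _ k⟩ := hrot c k
  rw [h1, h2]
  rfl

end Traces

/-! ### Cumulants of traces as alternating sums of Wick functionals -/

section CumulantFormula

open MvPolynomial

variable {n N : ℕ} {γ : Type*} [Fintype γ]

/-- The covariances of `ζ^h ⋆ Q`. -/
def recoupledCov (N : ℕ) (h : Fin n → ℤ) (Q : Fin n → Fin n → ℝ) :
    Fin n × Fin (2 * N + 1) → Fin n × Fin (2 * N + 1) → ℝ := fun p p' =>
  Q p.1 p'.1 * if h p.1 = h p'.1 ∧ p.2 = p'.2 then 1 else 0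

/-- The tridiagonal model as a real matrix. -/
def triReal (N : ℕ) (ξ : ℤ × ℕ → ℝ) : Matrix (Fin N) (Fin N) ℝ :=
  Matrix.of fun i j => triEntry ξ ((i : ℤ) + 1) ((j : ℤ) + 1)

lemma traceProd_triMat {ι : Type*} (s : Finset ι) (m : ι → ℕ) (ξ : ℤ × ℕ → ℝ) :
    traceProd s m (triMat N ξ) = ∏ i ∈ s, (triReal N ξ ^ m i).trace := by
  unfold traceProd
  refine Finset.prod_congr rfl fun i _ => ?_
  have h : Matrix.of (triMat N ξ) = Complex.ofRealHom.mapMatrix (triReal N ξ) := rfl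
  rw [h, ← map_pow, ← Complex.ofReal_re (triReal N ξ ^ m i).trace]
  congr 1
  simp [Matrix.trace, RingHom.mapMatrix_apply, Matrix.map_apply]

lemma sum_filter_fin_eq {H : ℤ} (hH : 2 * H ≤ 2 * N) (F : ℕ → ℝ) :
    ∑ j ∈ (Finset.univ : Finset (Fin (2 * N + 1))).filter
      (fun j : Fin (2 * N + 1) => 1 ≤ (j : ℕ) ∧ ((j : ℕ) : ℤ) ≤ 2 * H), F j =
      ∑ k ∈ Finset.range (2 * H).toNat, F (k + 1) := by
  symm
  refine Finset.sum_bij (fun k hk => ⟨k + 1, by have := Finset.mem_range.1 hk; omega⟩) ?_ ?_ ?_ ?_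
  · intro k hk
    have := Finset.mem_range.1 hk
    simp only [Finset.mem_filter, Finset.mem_univ, true_and]
    omega
  · intro k _ k' _ h
    simpa using h
  · intro j hj
    simp only [Finset.mem_filter, Finset.mem_univ, true_and] at hj
    exact ⟨j - 1, Finset.mem_range.2 (by omega), Fin.ext (by simp; omega)⟩
  · intro k _
    rfl

/-- The weight of a closed walk in the tridiagonal model. -/
lemma prod_triEntry (θ : Equiv.Perm (Fin n)) {h : Fin n → ℤ} (hh : ∀ i, h i ∈ Finset.Icc (1 : ℤ) N)
    (ξ : Fin n → ℤ × ℕ → ℝ) :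
    ∏ i, triEntry (ξ i) (h i) (h (θ i)) = if h ∈ motzN N θ then
      eval (fun p : Fin n × Fin (2 * N + 1) => ξ p.1 (h p.1, (p.2 : ℕ))) (fPoly N θ h) else 0 := by
  split_ifs with hm
  · simp only [fPoly, map_mul, map_prod, jSet, Finset.prod_filter]
    rw [← Finset.prod_mul_distrib]
    refine Finset.prod_congr rfl fun i _ => ?_
    have h1 := (Finset.mem_filter.1 hm).2 i
    have h2 := Finset.mem_Icc.1 (hh i)
    rw [abs_le] at h1
    unfold triEntry
    by_cases h0 : h (θ i) = h i
    · rw [if_pos h0, if_pos (by omega), if_neg (by omega)]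
      simp
    · rw [if_neg h0, if_neg (show ¬ h (θ i) = h i + 0 by omega)]
      by_cases h3 : h (θ i) = h i + 1
      · rw [if_pos h3, if_pos h3]
        simp only [map_one, one_mul, map_sum, smul_eval, map_pow, eval_X]
        rw [sum_filter_fin_eq (by omega) fun k => 1 / 2 * ξ i (h i, k) ^ 2]
        exact Finset.sum_congr rfl fun k _ => by ring
      · rw [if_neg h3, if_neg h3, if_pos (by omega)]
        simp
  · have : ∃ i, ¬ |h (θ i) - h i| ≤ 1 := by
      by_contra hcon
      push Not at hcon
      exact hm (Finset.mem_filter.2 ⟨Fintype.mem_piFinset.2 hh, hcon⟩)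
    obtain ⟨i, hi⟩ := this
    refine Finset.prod_eq_zero (Finset.mem_univ i) ?_
    rw [abs_le] at hi
    unfold triEntry
    rw [if_neg (by omega), if_neg (by omega), if_neg (by omega)]

lemma HasNormalMoments.integrable_eval_comp {Ω ι β : Type*} [MeasurableSpace Ω] [Fintype ι]
    [Fintype β] [DecidableEq β] {μ : Measure Ω} {Y : β → Ω → ℝ} (hY : HasNormalMoments μ Y) (ρ : ι → β)
    (p : MvPolynomial ι ℝ) : Integrable (fun ω => eval (fun a => Y (ρ a) ω) p) μ := by
  simpa using hY.integrable_eval_linear (fun a b => if ρ a = b then 1 else 0) p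

lemma HasNormalMoments.integral_eval_comp {Ω ι β : Type*} [MeasurableSpace Ω] [Fintype ι]
    [Fintype β] [DecidableEq β] {μ : Measure Ω} {Y : β → Ω → ℝ} (hY : HasNormalMoments μ Y) (ρ : ι → β)
    (p : MvPolynomial ι ℝ) : ∫ ω, eval (fun a => Y (ρ a) ω) p ∂μ =
      wick (fun a a' => if ρ a = ρ a' then 1 else 0) p := by
  have h := hY.integral_eval_linear (fun a b => if ρ a = b then 1 else 0) p
  simpa [eq_comm] using h

lemma hasNormalMoments_iidNormal {α : Type*} [Fintype α] {u : α → ℤ × ℕ}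
    (hu : Function.Injective u) : HasNormalMoments iidNormal fun a ξ => ξ (u a) :=
  hasNormalMoments_of_iIndepFun (fun _ => measurable_pi_apply _) (iIndepFun_iidNormal.precomp hu)
    fun a => iidNormal_map_eval (u a)

/-- Reading the point `i` in the copy labelled `b i` kills covariances between different labels,
which is multiplication of the covariance by the partition matrix of the kernel of `b`. -/
lemma integral_eval_copies {κ : Type*} [Fintype κ] {h : Fin n → ℤ}
    (hh : ∀ i, h i ∈ Finset.Icc (1 : ℤ) N) (b : Fin n → κ)
    (p : ZPoly n N) :
    Integrable (fun ω : κ → ℤ × ℕ → ℝ => eval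
      (fun p : Fin n × Fin (2 * N + 1) => ω (b p.1) (h p.1, (p.2 : ℕ))) p)
      (Measure.pi fun _ : κ => iidNormal) ∧
    ∫ ω : κ → ℤ × ℕ → ℝ, eval
      (fun p : Fin n × Fin (2 * N + 1) => ω (b p.1) (h p.1, (p.2 : ℕ))) p
      ∂(Measure.pi fun _ : κ => iidNormal) =
      wick (recoupledCov N h (partMatrix (Setoid.ker b))) p := by
  have hu : Function.Injective fun a : Finset.Icc (1 : ℤ) N × Fin (2 * N + 1) =>
      ((a.1 : ℤ), (a.2 : ℕ)) := fun a a' haa => by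
    simp only [Prod.mk.injEq] at haa
    exact Prod.ext (Subtype.ext haa.1) (Fin.ext haa.2)
  have hY := hasNormalMoments_pi_copies (κ := κ) (hasNormalMoments_iidNormal hu)
  let ρ : Fin n × Fin (2 * N + 1) → κ × Finset.Icc (1 : ℤ) N × Fin (2 * N + 1) := fun a =>
    (b a.1, ⟨h a.1, hh a.1⟩, a.2)
  refine ⟨hY.integrable_eval_comp ρ p, (hY.integral_eval_comp ρ p).trans ?_⟩
  refine congrArg (fun C => wick C p) ?_
  refine funext fun a => funext fun a' => ?_
  simp only [recoupledCov, partMatrix, ρ, Prod.mk.injEq, Subtype.mk.injEq]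
  have : (Setoid.ker b).r a.1 a'.1 ↔ b a.1 = b a'.1 := Iff.rfl
  simp only [this]
  split_ifs <;> simp_all

/-- Products of joint moments of traces as sums over Motzkin paths. -/
lemma prod_integral_trace {κ : Type*} [Fintype κ] (θ : Equiv.Perm (Fin n)) {f : Fin n → γ}
    (hs : Function.Surjective f) (hf : ∀ i j, f i = f j ↔ θ.SameCycle i j) {L : γ → ℕ}
    (hL : ∀ c, (Finset.univ.filter fun i => f i = c).card = L c) (b : γ → κ) :
    ∏ B : κ, ∫ ξ, ∏ c ∈ Finset.univ.filter (fun c => b c = B), (triReal N ξ ^ L c).trace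
      ∂iidNormal =
    ∑ h ∈ motzN N θ, wick (recoupledCov N h (partMatrix (Setoid.ker (b ∘ f)))) (fPoly N θ h) := by
  -- Independent copies, one per label, merge the product of expectations into a single expectation.
  rw [← integral_fintype_prod_eq_prod (μ := fun _ : κ => iidNormal) (f := fun B ξ =>
    ∏ c ∈ Finset.univ.filter (fun c => b c = B), (triReal N ξ ^ L c).trace)]
  have hstep : ∀ ω : κ → ℤ × ℕ → ℝ,
      ∏ B : κ, ∏ c ∈ Finset.univ.filter (fun c => b c = B), (triReal N (ω B) ^ L c).trace =
      ∑ h ∈ motzN N θ, eval (fun p : Fin n × Fin (2 * N + 1) =>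
        ω (b (f p.1)) (h p.1, (p.2 : ℕ))) (fPoly N θ h) := fun ω => by
    have h1 : ∀ B : κ, ∏ c ∈ Finset.univ.filter (fun c => b c = B), (triReal N (ω B) ^ L c).trace =
        ∏ c ∈ Finset.univ.filter (fun c => b c = B), (triReal N (ω (b c)) ^ L c).trace :=
      fun B => Finset.prod_congr rfl fun c hc => by rw [(Finset.mem_filter.1 hc).2]
    simp only [h1]
    have h3 := Finset.prod_fiberwise Finset.univ b fun c => (triReal N (ω (b c)) ^ L c).trace
    rw [h3, prod_trace_pow_eq_sum θ hs hf hL fun c => triReal N (ω (b c))]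
    have h2 : ∑ h ∈ motzN N θ, eval (fun p : Fin n × Fin (2 * N + 1) =>
        ω (b (f p.1)) (h p.1, (p.2 : ℕ))) (fPoly N θ h) =
        ∑ h ∈ Fintype.piFinset fun _ : Fin n => Finset.Icc (1 : ℤ) N,
          ∏ i, triEntry (ω (b (f i))) (h i) (h (θ i)) := by
      rw [Finset.sum_congr rfl fun h hh => prod_triEntry θ (Fintype.mem_piFinset.1 hh)
        fun i => ω (b (f i)), ← Finset.sum_filter]
      refine Finset.sum_congr ?_ fun _ _ => rfl
      ext h
      simp only [motzN, Finset.mem_filter]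
      tauto
    rw [h2]
    refine Finset.sum_bij (fun w _ i => ((w i : ℕ) : ℤ) + 1) ?_ ?_ ?_ ?_
    · intro w _
      refine Fintype.mem_piFinset.2 fun i => Finset.mem_Icc.2 ?_
      have := (w i).2
      omega
    · intro w _ w' _ hw
      ext i
      have := congrFun hw i
      omega
    · intro h hh
      have hh' := fun i => Finset.mem_Icc.1 (Fintype.mem_piFinset.1 hh i)
      refine ⟨fun i => ⟨(h i - 1).toNat, by have := hh' i; omega⟩, Finset.mem_univ _, ?_⟩
      ext i
      have := hh' i
      simp only
      omega
    · intro w _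
      rfl
  simp only [hstep]
  have hI : ∀ h ∈ motzN N θ, ∀ i, h i ∈ Finset.Icc (1 : ℤ) N := fun h hh =>
    Fintype.mem_piFinset.1 (Finset.mem_filter.1 hh).1
  rw [integral_finsetSum _ fun h hh =>
    (integral_eval_copies (hI h hh) (fun i => b (f i)) (fPoly N θ h)).1]
  exact Finset.sum_congr rfl fun h hh =>
    (integral_eval_copies (hI h hh) (fun i => b (f i)) (fPoly N θ h)).2

lemma numBlocks_ker_part {f : Fin n → γ} (hs : Function.Surjective f)
    (π : Finpartition (Finset.univ : Finset (γ))) :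
    numBlocks (Setoid.ker (π.part ∘ f)) = π.parts.card := by
  rw [numBlocks, Nat.card_congr (Setoid.quotientKerEquivRange _)]
  have : Set.range (π.part ∘ f) = (π.parts : Set (Finset (γ))) := by
    ext B
    constructor
    · rintro ⟨i, rfl⟩
      exact π.part_mem.2 (Finset.mem_univ _)
    · intro hB
      obtain ⟨c, hc⟩ := π.nonempty_of_mem_parts hB
      obtain ⟨i, rfl⟩ := hs c
      exact ⟨i, π.part_eq_of_mem hB hc⟩
  rw [this]
  simp

/-- Joint cumulants as sums over the partitions coarser than a given one. -/
lemma jointCumulant_eq_sum {Ω : Type*} [MeasurableSpace Ω] {P : Measure Ω}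
    [IsProbabilityMeasure P] {X : γ → Ω → ℝ} {f : Fin n → γ} (hs : Function.Surjective f)
    {Θ : Setoid (Fin n)} (hf : ∀ i j, f i = f j ↔ Θ.r i j) {W : Setoid (Fin n) → ℝ}
    (hW : ∀ b : γ → Finset γ, ∏ B : Finset γ, ∫ ω, ∏ c ∈ Finset.univ.filter (fun c => b c = B),
      X c ω ∂P = W (Setoid.ker (b ∘ f))) :
    jointCumulant P X = ∑ Ψ ∈ Finset.univ.filter (Θ ≤ ·), cumWeight (numBlocks Ψ) * W Ψ := by
  unfold jointCumulant
  refine Finset.sum_bij (fun π _ => Setoid.ker (π.part ∘ f)) ?_ ?_ ?_ ?_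
  · intro π _
    refine Finset.mem_filter.2 ⟨Finset.mem_univ _, fun i j hij => ?_⟩
    exact congrArg π.part ((hf i j).2 hij)
  · intro π _ π' _ h
    have hrel : ∀ c c', π.part c = π.part c' ↔ π'.part c = π'.part c' := fun c c' => by
      obtain ⟨i, rfl⟩ := hs c
      obtain ⟨j, rfl⟩ := hs c'
      have : (Setoid.ker (π.part ∘ f)).r i j ↔ (Setoid.ker (π'.part ∘ f)).r i j := by
        rw [show Setoid.ker (π.part ∘ f) = Setoid.ker (π'.part ∘ f) from h]
      exact this
    have hpart : ∀ c, π.part c = π'.part c := fun c => by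
      ext c'
      rw [π.mem_part_iff_part_eq_part (Finset.mem_univ _) (Finset.mem_univ _),
        π'.mem_part_iff_part_eq_part (Finset.mem_univ _) (Finset.mem_univ _), hrel]
    have hle : ∀ π π' : Finpartition (Finset.univ : Finset γ),
        (∀ c, π.part c = π'.part c) → π.parts ⊆ π'.parts := fun π π' h B hB => by
      obtain ⟨c, hc⟩ := π.nonempty_of_mem_parts hB
      rw [← π.part_eq_of_mem hB hc, h]
      exact π'.part_mem.2 (Finset.mem_univ _)
    exact Finpartition.ext ((hle _ _ hpart).antisymm (hle _ _ fun c => (hpart c).symm))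
  · intro Ψ hΨ
    have hΨ' := (Finset.mem_filter.1 hΨ).2
    choose g hg using hs
    refine ⟨Finpartition.ofSetoid (Setoid.comap g Ψ), Finset.mem_univ _, ?_⟩
    ext i j
    have h1 : ∀ i, Ψ.r i (g (f i)) := fun i => hΨ' ((hf _ _).1 (hg (f i)).symm)
    change (Finpartition.ofSetoid (Setoid.comap g Ψ)).part (f i) =
      (Finpartition.ofSetoid (Setoid.comap g Ψ)).part (f j) ↔ _
    rw [← Finpartition.mem_part_iff_part_eq_part _ (Finset.mem_univ _) (Finset.mem_univ _),
      Finpartition.mem_part_ofSetoid_iff_rel]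
    change Ψ.r (g (f j)) (g (f i)) ↔ Ψ.r i j
    exact ⟨fun h => Setoid.trans' _ (h1 i) (Setoid.trans' _ (Setoid.symm' _ h)
      (Setoid.symm' _ (h1 j))), fun h => Setoid.trans' _ (Setoid.symm' _ (h1 j))
      (Setoid.trans' _ (Setoid.symm' _ h) (h1 i))⟩
  · intro π _
    rw [numBlocks_ker_part hs, cumWeight, ← hW π.part]
    congr 1
    have hB : ∀ B ∈ π.parts, Finset.univ.filter (fun c => π.part c = B) = B := fun B hB => by
      ext c
      simp only [Finset.mem_filter, Finset.mem_univ, true_and]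
      exact ⟨fun h => h ▸ π.mem_part (Finset.mem_univ c), fun h => π.part_eq_of_mem hB h⟩
    -- Labels range over all subsets; one that is not a block labels nothing and contributes the
    -- integral of an empty product, namely `1`.
    rw [← Finset.prod_subset (Finset.subset_univ π.parts)]
    · exact Finset.prod_congr rfl fun B h => by rw [hB B h]
    · intro B _ hB
      have : Finset.univ.filter (fun c => π.part c = B) = ∅ := by
        refine Finset.filter_eq_empty_iff.2 fun c _ h => hB ?_
        rw [← h]
        exact π.part_mem.2 (Finset.mem_univ _)
      rw [this]
      simp

/-- Label the `θ`-orbits by the parts of `lam`, so that partitions of the labels become partitions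
coarser than `orb θ`; pass to the tridiagonal model and expand into walks. -/
lemma IsStandardGUE.frakM_eq {Ω : Type*} [MeasurableSpace Ω] {P : Measure Ω}
    [IsProbabilityMeasure P] {Ξ : Ω → Matrix (Fin N) (Fin N) ℂ} (hN : 0 < N)
    (hΞ : IsStandardGUE P Ξ) (lam : n.Partition) (θ : Equiv.Perm (Fin n))
    (hθ : θ.partition.parts = lam.parts) :
    frakM P Ξ lam = ∑ h ∈ motzN N θ, ∑ Ψ ∈ Finset.univ.filter (orb θ ≤ ·),
      cumWeight (numBlocks Ψ) * wick (recoupledCov N h (partMatrix Ψ)) (fPoly N θ h) := by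
  obtain ⟨f, hs, hf, hL⟩ := exists_label θ (L := lam.parts.sort (· ≥ ·))
    (by rw [Multiset.sort_eq, hθ])
  rw [Finset.sum_comm]
  simp only [← Finset.mul_sum]
  refine jointCumulant_eq_sum hs (Θ := orb θ) hf (W := fun Ψ => ∑ h ∈ motzN N θ,
    wick (recoupledCov N h (partMatrix Ψ)) (fPoly N θ h)) fun b => ?_
  simp only [hΞ.integral_traceProd hN, traceProd_triMat]
  convert prod_integral_trace (N := N) θ hs hf (fun c => by convert hL c) b

end CumulantFormula

section Interpolation

open MvPolynomial

variable {n N m : ℕ}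

/-! ### Derivatives along segments of partition matrices -/

/-- An off-diagonal bond comes from two ordered pairs, a diagonal one from a single pair; hence the
vanishing assumption. -/
lemma sum_sum_sym2 {α E : Type*} [Fintype α] [AddCommMonoid E] {F : Sym2 α → E}
    (hF : ∀ a, F s(a, a) = 0) : ∑ a, ∑ b, F s(a, b) = ∑ e, 2 • F e := by
  rw [← Fintype.sum_prod_type' (f := fun a b => F s(a, b)),
    ← Finset.sum_fiberwise Finset.univ (fun p : α × α => s(p.1, p.2))]
  refine Finset.sum_congr rfl fun e _ => ?_
  induction e using Sym2.ind with
  | _ a b =>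
  rw [Finset.sum_congr rfl fun p hp => congrArg F (Finset.mem_filter.1 hp).2, Finset.sum_const]
  by_cases hab : a = b
  · subst hab
    rw [hF, smul_zero, smul_zero]
  · have : (Finset.univ.filter fun p : α × α => s(p.1, p.2) = s(a, b)) = {(a, b), (b, a)} := by
      ext ⟨x, y⟩
      simp
    rw [this, Finset.card_pair (by simp [hab])]

/-- The bond operator restricted to the bonds on which `h` is constant. -/
def compatOp (N : ℕ) (h : Fin n → ℤ) (e : Sym2 (Fin n)) (g : ZPoly n N) : ZPoly n N :=
  if bondIn (Setoid.ker h) e then bondOp N e g else 0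

lemma bondOp_mk_apply (i i' : Fin n) (g : ZPoly n N) :
    bondOp N s(i, i') g = ∑ j, pderiv (i, j) (pderiv (i', j) g) := by
  change (∑ j, partialZ (i, j) * partialZ (i', j)) g = _
  rw [LinearMap.sum_apply]
  rfl

lemma recoupledCov_add_smul (h : Fin n → ℤ) (Q R : Fin n → Fin n → ℝ) (s : ℝ) :
    recoupledCov N h (Q + s • R) = recoupledCov N h Q + s • recoupledCov N h R := by
  funext p p'
  simp only [recoupledCov, Pi.add_apply, Pi.smul_apply, smul_eq_mul]
  ring

lemma continuous_recoupledCov (h : Fin n → ℤ) : Continuous (recoupledCov N h) := by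
  unfold recoupledCov
  fun_prop

/-- The matrix `[Ψ] - [Θ]` is the indicator of the newly joined pairs. The factor `½` turns ordered
pairs into bonds, and the covariances of `ζ^h` keep only those bonds along which `h` is constant. -/
lemma lap_recoupledCov (h : Fin n → ℤ) {Θ Ψ : Setoid (Fin n)} (hΘ : Θ ≤ Ψ) (g : ZPoly n N) :
    lap (recoupledCov N h (partMatrix Ψ - partMatrix Θ)) g =
      ∑ e ∈ Finset.univ.filter (fun e => bondIn Ψ e ∧ ¬ bondIn Θ e), compatOp N h e g := by
  rw [Finset.sum_filter]
  set F : Sym2 (Fin n) → ZPoly n N := fun e =>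
    if bondIn Ψ e ∧ ¬ bondIn Θ e then (1 / 2 : ℝ) • compatOp N h e g else 0 with hF
  have h0 : ∀ i, F s(i, i) = 0 := fun i => by
    have : bondIn Θ s(i, i) := bondIn_mk.2 (Setoid.refl' Θ i)
    simp [hF, this]
  have h1 : ∀ e, (if bondIn Ψ e ∧ ¬ bondIn Θ e then compatOp N h e g else 0) = 2 • F e := fun e => by
    simp only [hF]
    split_ifs
    · rw [two_nsmul, ← add_smul]
      norm_num
    · simp
  simp only [h1]
  rw [← sum_sum_sym2 h0, lap_apply, Fintype.sum_prod_type]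
  refine Finset.sum_congr rfl fun i _ => ?_
  simp only [Fintype.sum_prod_type]
  rw [Finset.sum_comm]
  refine Finset.sum_congr rfl fun i' _ => ?_
  simp only [hF, compatOp, bondIn_mk, bondOp_mk_apply, recoupledCov, Pi.sub_apply, partMatrix]
  have hk : (Setoid.ker h) i i' ↔ h i = h i' := Iff.rfl
  simp only [hk]
  by_cases hh : h i = h i'
  · by_cases hψ : Ψ.r i i'
    · by_cases hθ : Θ.r i i'
      · simp [hψ, hθ]
      · simp only [hh, hψ, hθ, if_true, if_false, true_and, not_false_iff, sub_zero,
          one_mul]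
        rw [Finset.smul_sum]
        refine Finset.sum_congr rfl fun j _ => ?_
        rw [Finset.sum_eq_single j (fun j' _ hj => by simp [hj.symm]) (by simp)]
        simp
    · have hθ : ¬ Θ.r i i' := fun hc => hψ (hΘ hc)
      simp [hψ, hθ]
  · simp [hh]

lemma hasDerivAt_wick_recoupledCov (h : Fin n → ℤ) (g : ZPoly n N) (Q : Fin n → Fin n → ℝ)
    {Θ Ψ : Setoid (Fin n)} (hΘ : Θ ≤ Ψ) (s : ℝ) :
    HasDerivAt (fun s : ℝ => wick (recoupledCov N h (Q + s • (partMatrix Ψ - partMatrix Θ))) g)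
      (∑ e ∈ Finset.univ.filter (fun e => bondIn Ψ e ∧ ¬ bondIn Θ e),
        wick (recoupledCov N h (Q + s • (partMatrix Ψ - partMatrix Θ))) (compatOp N h e g)) s := by
  simp only [recoupledCov_add_smul]
  rw [← map_sum, ← lap_recoupledCov h hΘ]
  exact hasDerivAt_wick _ _ _ _

/-! ### Products of bond operators along a sequence -/

lemma bondsOp_insert {Γ : Finset (Sym2 (Fin n))} {e : Sym2 (Fin n)} (he : e ∉ Γ) :
    bondsOp N (insert e Γ) = bondsOp N Γ * bondOp N e :=
  Finset.noncommProd_insert_of_notMem' _ _ _ _ he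

lemma image_fin_succ {α : Type*} [DecidableEq α] (e : Fin (m + 1) → α) :
    Finset.univ.image e = insert (e 0) (Finset.univ.image fun k => e (Fin.succ k)) := by
  ext x
  simp [Fin.exists_fin_succ, eq_comm]

lemma seqOp_zero (h : Fin n → ℤ) (e : Fin m → Sym2 (Fin n)) :
    seqOp (compatOp N h) m e 0 = 0 := by
  induction m with
  | zero => rfl
  | succ m ih =>
    rw [seqOp]
    have : compatOp N h (e 0) 0 = 0 := by simp [compatOp]
    rw [this, ih]

/-- Injectivity ensures that no bond is applied twice, so the successive operators multiply to the
operator of the set of bonds; one incompatible bond annihilates everything. -/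
lemma seqOp_compatOp (h : Fin n → ℤ) {e : Fin m → Sym2 (Fin n)} (he : Function.Injective e)
    (g : ZPoly n N) : seqOp (compatOp N h) m e g =
      if ∀ b ∈ Finset.univ.image e, bondIn (Setoid.ker h) b then
        bondsOp N (Finset.univ.image e) g else 0 := by
  induction m generalizing g with
  | zero =>
    simp [seqOp, bondsOp]
  | succ m ih =>
    have hnot : e 0 ∉ Finset.univ.image fun k => e (Fin.succ k) := by
      simp only [Finset.mem_image, Finset.mem_univ, true_and, not_exists]
      intro k hk
      exact Fin.succ_ne_zero k (he hk)
    rw [seqOp, image_fin_succ, bondsOp_insert hnot]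
    by_cases h0 : bondIn (Setoid.ker h) (e 0)
    · rw [compatOp, if_pos h0, ih (e := fun k => e k.succ) (he.comp (Fin.succ_injective m))]
      simp only [Finset.forall_mem_insert, h0, true_and]
      rfl
    · rw [compatOp, if_neg h0, seqOp_zero, if_neg]
      intro hc
      exact h0 (hc _ (Finset.mem_insert_self _ _))

/-! ### Positivity of the interpolating covariances -/

/-- It is the Gram matrix of the incidence matrix between points and fibres. -/
lemma posSemidef_indicator {ι β : Type*} [Fintype ι] [DecidableEq β] (ρ : ι → β) :
    (Matrix.of fun a a' : ι => if ρ a = ρ a' then (1 : ℝ) else 0).PosSemidef := by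
  let A : Matrix ι (Quotient (Setoid.ker ρ)) ℝ := Matrix.of fun a q =>
    if Quotient.mk (Setoid.ker ρ) a = q then 1 else 0
  have h : (Matrix.of fun a a' : ι => if ρ a = ρ a' then (1 : ℝ) else 0) = A * A.conjTranspose := by
    ext a a'
    have hq : Quotient.mk (Setoid.ker ρ) a = Quotient.mk (Setoid.ker ρ) a' ↔ ρ a = ρ a' :=
      Quotient.eq
    simp only [A, Matrix.mul_apply, Matrix.conjTranspose_apply, Matrix.of_apply, star_trivial,
      ite_mul, one_mul, zero_mul]
    rw [Finset.sum_ite_eq]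
    simp only [Finset.mem_univ, if_true, ← hq, eq_comm]
  rw [h]
  exact Matrix.posSemidef_self_mul_conjTranspose A

lemma posSemidef_recoupledCov_partMatrix (h : Fin n → ℤ) (Ψ : Setoid (Fin n)) :
    (Matrix.of (recoupledCov N h (partMatrix Ψ))).PosSemidef := by
  suffices heq : Matrix.of (recoupledCov N h (partMatrix Ψ)) = Matrix.of fun p p' =>
      if (Quotient.mk Ψ p.1, h p.1, p.2) = (Quotient.mk Ψ p'.1, h p'.1, p'.2) then (1 : ℝ) else 0 by
    rw [heq]
    exact posSemidef_indicator fun p : Fin n × Fin (2 * N + 1) => (Quotient.mk Ψ p.1, h p.1, p.2)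
  ext p p'
  simp only [Matrix.of_apply, recoupledCov, partMatrix, Prod.mk.injEq]
  have hq : Quotient.mk Ψ p.1 = Quotient.mk Ψ p'.1 ↔ Ψ.r p.1 p'.1 := Quotient.eq
  simp only [hq]
  split_ifs <;> simp_all

/-- Summation by parts gives `(c - t₀) B₀ + (t₀ - t₁) B₁ + ⋯`, a combination with nonnegative
coefficients. -/
lemma posSemidef_abel {ι : Type*} [Fintype ι] {B : Fin (m + 1) → Matrix ι ι ℝ}
    (hB : ∀ k, (B k).PosSemidef) {c : ℝ} {t : Fin m → ℝ} (ht : Antitone t) (h0 : ∀ α, 0 ≤ t α)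
    (hc : 0 ≤ c) (h1 : ∀ α, t α ≤ c) :
    (c • B 0 + ∑ α, t α • (B α.succ - B α.castSucc)).PosSemidef := by
  induction m generalizing c with
  | zero => simpa using (hB 0).smul hc
  | succ m ih =>
    have h := ih (B := fun k => B k.succ) (fun k => hB _) (t := fun α => t α.succ) (c := t 0)
      (fun a b hab => ht (Fin.succ_le_succ_iff.2 hab)) (fun α => h0 _) (h0 0)
      (fun α => ht (Fin.zero_le _))
    have h2 := ((hB 0).smul (sub_nonneg.2 (h1 0))).add h
    convert h2 using 1
    rw [Fin.sum_univ_succ]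
    simp only [Fin.castSucc_zero, Fin.succ_zero_eq_one, sub_smul, smul_sub, ← Fin.succ_castSucc]
    abel

lemma recoupledCov_interpMatrix (h : Fin n → ℤ) (Θ : Setoid (Fin n)) (e : Fin m → Sym2 (Fin n))
    (t : Fin m → ℝ) : Matrix.of (recoupledCov N h (interpMatrix Θ e t)) =
      (1 : ℝ) • Matrix.of (recoupledCov N h (partMatrix (joinBonds ((Finset.univ.filter
        fun β : Fin m => (β : ℕ) < ((0 : Fin (m + 1)) : ℕ)).image e) Θ))) +
      ∑ α : Fin m, t α • (Matrix.of (recoupledCov N h (partMatrix (joinBonds ((Finset.univ.filter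
          fun β : Fin m => (β : ℕ) < (α.succ : ℕ)).image e) Θ))) -
        Matrix.of (recoupledCov N h (partMatrix (joinBonds ((Finset.univ.filter
          fun β : Fin m => (β : ℕ) < (α.castSucc : ℕ)).image e) Θ)))) := by
  ext p p'
  simp only [Matrix.add_apply, Matrix.sum_apply, Matrix.smul_apply, Matrix.sub_apply,
    Matrix.of_apply, recoupledCov, interpMatrix, Pi.add_apply, Finset.sum_apply, Pi.smul_apply,
    Pi.sub_apply, smul_eq_mul, one_mul]
  have h0 : (Finset.univ.filter fun β : Fin m => (β : ℕ) < ((0 : Fin (m + 1)) : ℕ)) = ∅ := by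
    ext; simp
  rw [h0, Finset.image_empty, joinBonds_empty, add_mul, Finset.sum_mul]
  congr 1
  refine Finset.sum_congr rfl fun α _ => ?_
  simp only [Fin.val_succ, Fin.val_castSucc, Nat.lt_succ_iff, Fin.val_fin_le, Fin.val_fin_lt]
  ring

lemma posSemidef_recoupledCov_interpMatrix (h : Fin n → ℤ) (Θ : Setoid (Fin n))
    (e : Fin m → Sym2 (Fin n)) {t : Fin m → ℝ} (ht : t ∈ decSimplex m) :
    (Matrix.of (recoupledCov N h (interpMatrix Θ e t))).PosSemidef := by
  rw [recoupledCov_interpMatrix]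
  exact posSemidef_abel (B := fun k => Matrix.of (recoupledCov N h (partMatrix (joinBonds
    ((Finset.univ.filter fun β : Fin m => (β : ℕ) < (k : ℕ)).image e) Θ))))
    (fun k => posSemidef_recoupledCov_partMatrix h _) ht.2.antitone (fun α => (ht.1 α).1.le)
    zero_le_one fun α => (ht.1 α).2.le

/-! ### Integrals against the interpolating measures -/

lemma integral_zeta_mul_zeta {h : Fin n → ℤ} (hh : ∀ i, h i ∈ Finset.Icc (1 : ℤ) N)
    (p p' : Fin n × Fin (2 * N + 1)) : ∫ ξ, zeta N h p ξ * zeta N h p' ξ ∂iidNormal =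
      if h p.1 = h p'.1 ∧ p.2 = p'.2 then 1 else 0 := by
  have hu : Function.Injective fun a : Finset.Icc (1 : ℤ) N × Fin (2 * N + 1) =>
      ((a.1 : ℤ), (a.2 : ℕ)) := fun a a' haa => by
    simp only [Prod.mk.injEq] at haa
    exact Prod.ext (Subtype.ext haa.1) (Fin.ext haa.2)
  let ρ : Fin n × Fin (2 * N + 1) → Finset.Icc (1 : ℤ) N × Fin (2 * N + 1) := fun a =>
    (⟨h a.1, hh a.1⟩, a.2)
  have hI := (hasNormalMoments_iidNormal hu).integral_eval_comp ρ (X p * X p')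
  rw [wick_X_mul (C := fun a a' => if ρ a = ρ a' then 1 else 0)
    (fun a b => if_congr eq_comm rfl rfl)] at hI
  simp only [map_mul, eval_X, pderiv_X] at hI
  have h1 : ∀ b, wick (fun a a' => if ρ a = ρ a' then (1 : ℝ) else 0)
      (Pi.single (M := fun _ => ZPoly n N) b 1 p') = if b = p' then 1 else 0 := fun b => by
    by_cases hb : b = p'
    · subst hb
      rw [Pi.single_eq_same, wick_one, if_pos rfl]
    · rw [Pi.single_eq_of_ne (Ne.symm hb), map_zero, if_neg hb]
  simp only [h1, mul_ite, mul_one, mul_zero] at hI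
  rw [Finset.sum_ite_eq'] at hI
  simp only [Finset.mem_univ, if_true, ρ, Prod.mk.injEq, Subtype.mk.injEq] at hI
  exact hI

/-- Positive semidefiniteness is what guarantees that the Gaussian law has the prescribed
covariance. -/
lemma recoupledExp_eq_wick {h : Fin n → ℤ} (hh : ∀ i, h i ∈ Finset.Icc (1 : ℤ) N)
    {Q : Fin n → Fin n → ℝ} (hQ : (Matrix.of (recoupledCov N h Q)).PosSemidef) (g : ZPoly n N) :
    recoupledExp h Q g = wick (recoupledCov N h Q) g := by
  have h1 : (Matrix.of fun p p' : Fin n × Fin (2 * N + 1) =>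
      Q p.1 p'.1 * ∫ ξ, zeta N h p ξ * zeta N h p' ξ ∂iidNormal) =
      Matrix.of (recoupledCov N h Q) := by
    ext p p'
    simp only [Matrix.of_apply, integral_zeta_mul_zeta hh, recoupledCov]
  rw [recoupledExp, recoupledLaw, h1]
  exact integral_eval_multivariateGaussian hQ g

lemma isClosed_setOf_posSemidef {ι : Type*} [Fintype ι] :
    IsClosed {M : Matrix ι ι ℝ | M.PosSemidef} := by
  have : {M : Matrix ι ι ℝ | M.PosSemidef} = {M | M.IsHermitian} ∩
      ⋂ x : ι → ℝ, {M | 0 ≤ star x ⬝ᵥ M.mulVec x} := by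
    ext M
    simp only [Set.mem_ofPred_eq, Set.mem_inter_iff, Set.mem_iInter]
    exact Matrix.posSemidef_iff_dotProduct_mulVec
  rw [this]
  refine IsClosed.inter ?_ (isClosed_iInter fun x => ?_)
  · exact isClosed_eq (by fun_prop) continuous_id
  · exact isClosed_le continuous_const (by fun_prop)

/-- Integration against `ℙ_Γ^Θ` of a function which is continuous on the support. -/
lemma integral_bkarMeasure {Θ : Setoid (Fin n)} {Γ : Finset (Sym2 (Fin n))}
    {F : (Fin n → Fin n → ℝ) → ℝ} {G : (Fin n → Fin n → ℝ) → ℝ} (hG : Continuous G)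
    {S : Set (Fin n → Fin n → ℝ)} (hS : IsClosed S) (hFG : ∀ Q ∈ S, F Q = G Q)
    (hmem : ∀ (e : Fin (numBlocks Θ - 1) → Sym2 (Fin n)), ∀ t ∈ decSimplex (numBlocks Θ - 1),
      interpMatrix Θ e t ∈ S) :
    ∫ Q, F Q ∂bkarMeasure Θ Γ = ∑ e ∈ (Finset.univ : Finset (Fin (numBlocks Θ - 1) →
      Sym2 (Fin n))).filter (fun e => Finset.univ.image e = Γ),
      ∫ t in decSimplex (numBlocks Θ - 1), G (interpMatrix Θ e t) := by
  have hms : MeasurableSet (decSimplex (numBlocks Θ - 1)) := by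
    rw [← simplexBelow_one]
    exact measurableSet_simplexBelow _ _
  have hci := fun e => continuous_interpMatrix Θ (m := numBlocks Θ - 1) e
  -- `F` is controlled only on `S`, but the simplex is mapped into `S`, so `F` may be replaced by
  -- the continuous `G` almost everywhere.
  have hae : ∀ e, ∀ᵐ Q ∂(((volume : Measure (Fin (numBlocks Θ - 1) → ℝ)).restrict
      (decSimplex (numBlocks Θ - 1))).map (interpMatrix Θ e)), G Q = F Q := fun e => by
    have h1 : ∀ᵐ Q ∂(((volume : Measure (Fin (numBlocks Θ - 1) → ℝ)).restrict
        (decSimplex (numBlocks Θ - 1))).map (interpMatrix Θ e)), Q ∈ S := by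
      refine (ae_map_iff (p := (· ∈ S)) (hci e).measurable.aemeasurable hS.measurableSet).2 ?_
      exact (ae_restrict_iff' hms).2 (Filter.Eventually.of_forall (hmem e))
    exact h1.mono fun Q hQ => (hFG Q hQ).symm
  have hInt : ∀ e, Integrable G (((volume : Measure (Fin (numBlocks Θ - 1) → ℝ)).restrict
      (decSimplex (numBlocks Θ - 1))).map (interpMatrix Θ e)) := fun e => by
    rw [integrable_map_measure hG.aestronglyMeasurable (hci e).measurable.aemeasurable]
    exact integrableOn_simplexBelow (u := 1) (hG.comp (hci e))
  unfold bkarMeasure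
  rw [integral_finsetSum_measure fun e _ => (hInt e).congr (hae e)]
  refine Finset.sum_congr rfl fun e _ => ?_
  rw [← integral_congr_ae (hae e), integral_map (hci e).measurable.aemeasurable
    hG.aestronglyMeasurable]

end Interpolation

section Degree

open MvPolynomial

variable {n N : ℕ} {θ σ : Equiv.Perm (Fin n)} {h : Fin n → ℤ}

/-! ### Degree considerations -/

/-- All derivatives of order `d` in the variables with first index `i` vanish. -/
def DegLT (i : Fin n) : ℕ → ZPoly n N → Prop
  | 0, p => p = 0
  | d + 1, p => ∀ j, DegLT i d (pderiv (i, j) p)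

lemma DegLT.zero (i : Fin n) (d : ℕ) : DegLT i d (0 : ZPoly n N) := by
  induction d with
  | zero => rfl
  | succ d ih => exact fun j => by rwa [map_zero]

lemma DegLT.add {i : Fin n} {d : ℕ} {p q : ZPoly n N} (hp : DegLT i d p) (hq : DegLT i d q) :
    DegLT i d (p + q) := by
  induction d generalizing p q with
  | zero =>
    rw [DegLT] at *
    rw [hp, hq, add_zero]
  | succ d ih => exact fun j => by rw [map_add]; exact ih (hp j) (hq j)

lemma DegLT.sum {i : Fin n} {d : ℕ} {κ : Type*} {s : Finset κ} {p : κ → ZPoly n N}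
    (hp : ∀ k ∈ s, DegLT i d (p k)) : DegLT i d (∑ k ∈ s, p k) :=
  Finset.sum_induction p (DegLT i d) (fun _ _ => DegLT.add) (DegLT.zero i d) hp

lemma DegLT.pderiv {i : Fin n} {d : ℕ} {p : ZPoly n N} (hp : DegLT i d p)
    (a : Fin n × Fin (2 * N + 1)) : DegLT i d (MvPolynomial.pderiv a p) := by
  induction d generalizing p with
  | zero =>
    rw [DegLT] at *
    rw [hp, map_zero]
  | succ d ih => exact fun j => by rw [pderiv_comm]; exact ih (hp j)

lemma DegLT.mono {i : Fin n} {d d' : ℕ} {p : ZPoly n N} (hp : DegLT i d p) (hd : d ≤ d') :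
    DegLT i d' p := by
  induction d' generalizing d p with
  | zero =>
    obtain rfl : d = 0 := by omega
    exact hp
  | succ d' ih =>
    rcases d with _ | d
    · rw [show p = 0 from hp]
      exact DegLT.zero i _
    · exact fun j => ih (hp j) (by omega)

lemma DegLT.bondOp_of_mem {i : Fin n} {d : ℕ} {p : ZPoly n N} (hp : DegLT i (d + 1) p)
    {e : Sym2 (Fin n)} (he : i ∈ e) : DegLT i d (bondOp N e p) := by
  obtain ⟨x, rfl⟩ := Sym2.mem_iff_exists.1 he
  rw [bondOp_mk_apply]
  refine DegLT.sum fun j _ => ?_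
  rw [pderiv_comm]
  exact (hp j).pderiv _

lemma DegLT.bondOp {i : Fin n} {d : ℕ} {p : ZPoly n N} (hp : DegLT i d p) (e : Sym2 (Fin n)) :
    DegLT i d (bondOp N e p) := by
  induction e using Sym2.ind with
  | _ x y =>
  rw [bondOp_mk_apply]
  exact DegLT.sum fun j _ => (hp.pderiv _).pderiv _

/-- Every bond at `i` takes a derivative in a variable of `i`, so the degree there drops by at least
the number of such bonds. -/
lemma DegLT.bondsOp {i : Fin n} (Γ : Finset (Sym2 (Fin n))) {d : ℕ} {p : ZPoly n N}
    (hp : DegLT i d p) : DegLT i (d - (Γ.filter (i ∈ ·)).card) (bondsOp N Γ p) := by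
  induction Γ using Finset.induction_on generalizing p d with
  | empty =>
    have : TriGUE.bondsOp N (∅ : Finset (Sym2 (Fin n))) = 1 := Finset.noncommProd_empty _ _
    simpa [this] using hp
  | insert e Γ he ih =>
    rw [bondsOp_insert he]
    change DegLT i _ (TriGUE.bondsOp N Γ (TriGUE.bondOp N e p))
    by_cases hi : i ∈ e
    · have hcard : ((insert e Γ).filter (i ∈ ·)).card = (Γ.filter (i ∈ ·)).card + 1 := by
        rw [Finset.filter_insert, if_pos hi, Finset.card_insert_of_notMem (by simp [he])]
      rw [hcard]
      rcases d with _ | d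
      · rw [show p = 0 from hp, map_zero, map_zero]
        exact DegLT.zero i _
      · have := ih (hp.bondOp_of_mem hi)
        rwa [Nat.add_sub_add_right]
    · rw [Finset.filter_insert, if_neg hi]
      exact ih (hp.bondOp e)

lemma DegLT.bondsOp_eq_zero {i : Fin n} {Γ : Finset (Sym2 (Fin n))} {d : ℕ} {p : ZPoly n N}
    (hp : DegLT i d p) (hd : d ≤ (Γ.filter (i ∈ ·)).card) : TriGUE.bondsOp N Γ p = 0 := by
  have := hp.bondsOp Γ
  rwa [Nat.sub_eq_zero_of_le hd] at this

/-- The factor of `f^h` in the variables with first index `i`. -/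
def fFactor (N : ℕ) (θ : Equiv.Perm (Fin n)) (h : Fin n → ℤ) (i : Fin n) : ZPoly n N :=
  (if h (θ i) = h i + 0 then X (i, 0) else 1) *
    if h (θ i) = h i + 1 then
      ∑ j ∈ (Finset.univ : Finset (Fin (2 * N + 1))).filter
          (fun j : Fin (2 * N + 1) => 1 ≤ (j : ℕ) ∧ ((j : ℕ) : ℤ) ≤ 2 * h i),
        (1 / 2 : ℝ) • (X (i, j) : ZPoly n N) ^ 2
    else 1

lemma fPoly_eq_prod : fPoly N θ h = ∏ i, fFactor N θ h i := by
  unfold fFactor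
  rw [Finset.prod_mul_distrib, ← Finset.prod_filter, ← Finset.prod_filter]
  rfl

lemma pderiv_X_of_ne_fst {i i' : Fin n} (hi : i' ≠ i) (j j' : Fin (2 * N + 1)) :
    pderiv (i, j) (X (i', j') : ZPoly n N) = 0 :=
  pderiv_X_of_ne fun hc => hi (congrArg Prod.fst hc)

lemma pderiv_fFactor_of_ne {i i' : Fin n} (hi : i' ≠ i) (j : Fin (2 * N + 1)) :
    pderiv (i, j) (fFactor N θ h i') = 0 := by
  unfold fFactor
  split_ifs <;>
    simp [pderiv_X_of_ne_fst hi]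

/-- Isolates the variables of one point, so that degrees in them can be read off from a single
factor. -/
lemma pderiv_fPoly (i : Fin n) : ∃ r : ZPoly n N, fPoly N θ h = fFactor N θ h i * r ∧
    ∀ j, pderiv (i, j) r = 0 := by
  refine ⟨∏ i' ∈ Finset.univ.erase i, fFactor N θ h i', ?_, fun j => ?_⟩
  · rw [fPoly_eq_prod, Finset.mul_prod_erase _ _ (Finset.mem_univ i)]
  · refine Finset.prod_induction (fFactor N θ h) (fun p => pderiv (i, j) p = 0) ?_ ?_ ?_
    · intro a b ha hb
      rw [pderiv_mul, ha, hb, zero_mul, mul_zero, add_zero]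
    · exact pderiv_one
    · intro i' hi'
      exact pderiv_fFactor_of_ne (Finset.ne_of_mem_erase hi') j

lemma DegLT.mul {i : Fin n} {d : ℕ} {p r : ZPoly n N} (hp : DegLT i d p)
    (hr : ∀ j, MvPolynomial.pderiv (i, j) r = 0) : DegLT i d (p * r) := by
  induction d generalizing p with
  | zero =>
    rw [DegLT] at *
    rw [hp, zero_mul]
  | succ d ih =>
    intro j
    rw [pderiv_mul, hr, mul_zero, add_zero]
    exact ih (hp j)

lemma degLT_one_C (i : Fin n) (c : ℝ) : DegLT i 1 (C c : ZPoly n N) := fun j => by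
  rw [pderiv_C]
  exact DegLT.zero i 0

lemma degLT_two_smul_X (i : Fin n) (c : ℝ) (j : Fin (2 * N + 1)) :
    DegLT i 2 (c • X (i, j) : ZPoly n N) := fun j' => by
  rw [Derivation.map_smul, pderiv_X, Pi.single_apply]
  split_ifs
  · rw [← C_1, smul_eq_C_mul, ← C_mul]
    exact degLT_one_C i _
  · rw [smul_zero]
    exact DegLT.zero i 1

lemma degLT_three_X_sq (i : Fin n) (j : Fin (2 * N + 1)) :
    DegLT i 3 ((1 / 2 : ℝ) • (X (i, j) : ZPoly n N) ^ 2) := fun j' => by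
  have : pderiv (i, j') ((1 / 2 : ℝ) • (X (i, j) : ZPoly n N) ^ 2) =
      if j = j' then (1 : ℝ) • X (i, j) else 0 := by
    rw [Derivation.map_smul, pderiv_pow]
    split_ifs with hj
    · subst hj
      rw [pderiv_X_self, smul_eq_C_mul, one_smul]
      simp only [Nat.cast_ofNat, mul_one, Nat.add_one_sub_one, pow_one]
      rw [← mul_assoc]
      have : (C (1 / 2) * 2 : ZPoly n N) = 1 := by
        rw [show (2 : ZPoly n N) = C 2 from (map_ofNat C 2).symm, ← C_mul]
        norm_num
      rw [this, one_mul]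
    · rw [pderiv_X_of_ne (by simpa using hj), mul_zero, smul_zero]
  rw [this]
  split_ifs
  · exact degLT_two_smul_X i _ j
  · exact DegLT.zero i 2

/-- The factor of `i` is quadratic for an up step, linear for a level step and constant for a down
step. This general bound limits the vertices of a contributing tree to degree two. -/
lemma degLT_three_fPoly (i : Fin n) : DegLT i 3 (fPoly N θ h) := by
  obtain ⟨r, hr, hr0⟩ := pderiv_fPoly (N := N) (θ := θ) (h := h) i
  rw [hr]
  refine DegLT.mul ?_ hr0
  unfold fFactor
  by_cases h0 : h (θ i) = h i + 0
  · rw [if_pos h0, if_neg (by omega), mul_one, ← one_smul ℝ (X (i, 0) : ZPoly n N)]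
    exact (degLT_two_smul_X i 1 0).mono (by omega)
  · rw [if_neg h0, one_mul]
    split_ifs
    · exact DegLT.sum fun j _ => degLT_three_X_sq i j
    · rw [← C_1]
      exact (degLT_one_C i 1).mono (by omega)

lemma degLT_two_fPoly {i : Fin n} (hi : h (θ i) = h i) : DegLT i 2 (fPoly N θ h) := by
  obtain ⟨r, hr, hr0⟩ := pderiv_fPoly (N := N) (θ := θ) (h := h) i
  rw [hr]
  refine DegLT.mul ?_ hr0
  unfold fFactor
  rw [if_pos (by omega), if_neg (by omega), mul_one, ← one_smul ℝ (X (i, 0) : ZPoly n N)]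
  exact degLT_two_smul_X i 1 0

lemma degLT_one_fPoly {i : Fin n} (h0 : h (θ i) ≠ h i) (h1 : h (θ i) ≠ h i + 1) :
    DegLT i 1 (fPoly N θ h) := by
  obtain ⟨r, hr, hr0⟩ := pderiv_fPoly (N := N) (θ := θ) (h := h) i
  rw [hr]
  refine DegLT.mul ?_ hr0
  unfold fFactor
  rw [if_neg (by omega), if_neg (by omega), mul_one, ← C_1]
  exact degLT_one_C i 1

lemma pderiv_fPoly_of_ne_zero {i : Fin n} (hi : h (θ i) = h i) {j : Fin (2 * N + 1)} (hj : j ≠ 0) :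
    pderiv (i, j) (fPoly N θ h) = 0 := by
  obtain ⟨r, hr, hr0⟩ := pderiv_fPoly (N := N) (θ := θ) (h := h) i
  rw [hr, pderiv_mul, hr0, mul_zero, add_zero]
  unfold fFactor
  rw [if_pos (by omega), if_neg (by omega), mul_one, pderiv_X_of_ne (by simpa using hj.symm),
    zero_mul]

lemma pderiv_zero_fPoly {i : Fin n} (hi : h (θ i) ≠ h i) :
    pderiv (i, 0) (fPoly N θ h) = 0 := by
  obtain ⟨r, hr, hr0⟩ := pderiv_fPoly (N := N) (θ := θ) (h := h) i
  rw [hr, pderiv_mul, hr0, mul_zero, add_zero]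
  unfold fFactor
  rw [if_neg (by omega), one_mul]
  split_ifs
  · rw [map_sum, Finset.sum_eq_zero, zero_mul]
    intro j hj
    have hj0 : j ≠ 0 := fun hc => by
      rw [hc] at hj
      simp at hj
    rw [Derivation.map_smul, pderiv_pow, pderiv_X_of_ne (by simpa using hj0), mul_zero, smul_zero]
  · rw [pderiv_one, zero_mul]

/-- A level step involves only the variable with `j = 0`, the other steps never do, and each term of
the bond operator differentiates at both ends with the same `j`. -/
lemma bondOp_fPoly_eq_zero {i i' : Fin n} (hi : h (θ i) = h i) (hi' : h (θ i') ≠ h i') :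
    bondOp N s(i, i') (fPoly N θ h) = 0 := by
  rw [bondOp_mk_apply]
  refine Finset.sum_eq_zero fun j _ => ?_
  by_cases hj : j = 0
  · rw [hj, pderiv_zero_fPoly hi', map_zero]
  · rw [pderiv_comm, pderiv_fPoly_of_ne_zero hi hj, map_zero]

lemma bondsOp_eq_zero_of_mem {Γ : Finset (Sym2 (Fin n))} {e : Sym2 (Fin n)} (he : e ∈ Γ)
    {p : ZPoly n N} (hp : bondOp N e p = 0) : bondsOp N Γ p = 0 := by
  rw [← Finset.insert_erase he, bondsOp_insert (Finset.notMem_erase e Γ), Module.End.mul_apply,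
    hp, map_zero]

/-- If `D^Γ f^h ≠ 0` then the increments of `h` agree along the bonds of `Γ`. -/
lemma increment_eq_of_mem (hh : ∀ i, |h (θ i) - h i| ≤ 1) {Γ : Finset (Sym2 (Fin n))}
    (h0 : bondsOp N Γ (fPoly N θ h) ≠ 0) {i i' : Fin n} (he : s(i, i') ∈ Γ) :
    h (θ i) - h i = h (θ i') - h i' := by
  have key : ∀ i i', s(i, i') ∈ Γ → h (θ i) - h i = 0 → h (θ i') - h i' = 0 := by
    intro i i' he hi
    by_contra hc
    exact h0 (bondsOp_eq_zero_of_mem he (bondOp_fPoly_eq_zero (by omega) (by omega)))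
  have key2 : ∀ i i', s(i, i') ∈ Γ → h (θ i) - h i ≠ -1 := by
    intro i i' he hi
    refine h0 ((degLT_one_fPoly (i := i) (by omega) (by omega)).bondsOp_eq_zero ?_)
    exact Finset.card_pos.2 ⟨_, Finset.mem_filter.2 ⟨he, Sym2.mem_mk_left _ _⟩⟩
  have he' : s(i', i) ∈ Γ := by rwa [Sym2.eq_swap]
  have a1 := key _ _ he
  have a2 := key _ _ he'
  have a3 := key2 _ _ he
  have a4 := key2 _ _ he'
  have b1 := abs_le.1 (hh i)
  have b2 := abs_le.1 (hh i')
  omega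

end Degree

/-! ### Goulden-Jackson pairs and Motzkin conditions versus compatible trees -/

section Membership

variable {n N : ℕ} {θ σ : Equiv.Perm (Fin n)} {h : Fin n → ℤ} {A : Finset (Fin n)}

lemma IsTransversal.exists_bond (hA : IsTransversal σ A) {i : Fin n} (hi : σ i ≠ i) :
    ∃ x, s(i, x) ∈ forestOf σ A := by
  by_cases hiA : i ∈ A
  · refine ⟨σ⁻¹ i, mem_forestOf.2 (Or.inr ⟨fun hc => ?_, by simp⟩)⟩
    have := hA.eq_of_sameCycle hc hiA
      (by simpa using sameCycle_apply_self σ (σ⁻¹ i))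
    exact hi (Equiv.Perm.inv_eq_iff_eq.1 this).symm
  · exact ⟨σ i, mem_forestOf.2 (Or.inl ⟨hiA, rfl⟩)⟩

/-- The orbit has at least three points. If `a` is its cut point, the path starts at `σ a`, so `σ²
a` is an interior vertex with bonds on both sides. -/
lemma IsTransversal.exists_two_bonds (hA : IsTransversal σ A) {i : Fin n} (hi : (σ ^ 2) i ≠ i) :
    ∃ x, σ.SameCycle i x ∧ 2 ≤ ((forestOf σ A).filter (x ∈ ·)).card := by
  obtain ⟨a, ha, hia⟩ := hA.exists_mem i
  have ha2 : σ (σ a) ≠ a := fun hc => by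
    obtain ⟨k, rfl⟩ := hia.symm
    apply hi
    rw [← Equiv.Perm.mul_apply, ((Commute.refl σ).pow_left 2 |>.zpow_right k).eq,
      Equiv.Perm.mul_apply]
    exact congrArg _ hc
  have ha1 : σ a ≠ a := fun hc => ha2 (by rw [hc, hc])
  have hsa : ∀ x, σ.SameCycle a x → x ≠ a → x ∉ A := fun x hx hne hc =>
    hne (hA.eq_of_sameCycle ha hc hx).symm
  have s1 : σ.SameCycle a (σ a) := Equiv.Perm.sameCycle_apply_right.2 (Equiv.Perm.SameCycle.refl _ _)
  have s2 : σ.SameCycle a (σ (σ a)) := Equiv.Perm.sameCycle_apply_right.2 s1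
  refine ⟨σ (σ a), hia.trans s2, ?_⟩
  have hne : s(σ (σ a), σ a) ≠ s(σ (σ a), σ (σ (σ a))) := fun hc => by
    rw [Sym2.congr_right] at hc
    exact ha2 (σ.injective hc.symm)
  rw [← Finset.card_pair hne]
  refine Finset.card_le_card fun e he => ?_
  rcases Finset.mem_insert.1 he with rfl | he
  · exact Finset.mem_filter.2 ⟨mem_forestOf.2 (Or.inr ⟨hsa _ s1 ha1, rfl⟩), Sym2.mem_mk_left _ _⟩
  · rw [Finset.mem_singleton.1 he]
    exact Finset.mem_filter.2 ⟨mem_forestOf.2 (Or.inl ⟨hsa _ s2 ha2, rfl⟩), Sym2.mem_mk_left _ _⟩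

lemma sum_increment_orbit (θ : Equiv.Perm (Fin n)) (h : Fin n → ℤ) (i : Fin n) :
    ∑ j ∈ Finset.univ.filter (fun j => θ.SameCycle i j), (h ∘ θ - h) j = 0 := by
  simp only [Pi.sub_apply, Function.comp_apply]
  rw [Finset.sum_sub_distrib, sub_eq_zero]
  refine Finset.sum_bij (fun j _ => θ j) ?_ (fun _ _ _ _ hab => θ.injective hab) ?_
    fun _ _ => rfl
  · intro j hj
    simpa using hj
  · intro j hj
    exact ⟨θ⁻¹ j, by simpa using hj, by simp⟩

/-- The side conditions on `σ` and `h` hold when `D^Γ f^h ≠ 0` for a compatible tree `Γ`. -/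
lemma IsTransversal.mem_gj_and_mem_tildeMotzN (hn : 0 < n) (hA : IsTransversal σ A)
    (hh : h ∈ motzN N θ) (hF : IsForestOver (forestOf σ A) (orb θ))
    (htop : joinBonds (forestOf σ A) (orb θ) = ⊤)
    (hc : ∀ e ∈ forestOf σ A, bondIn (Setoid.ker h) e)
    (h0 : bondsOp N (forestOf σ A) (fPoly N θ h) ≠ 0) :
    σ ∈ gj θ ∧ h ∈ tildeMotzN N θ σ := by
  have habs := (Finset.mem_filter.1 hh).2
  constructor
  · refine Finset.mem_filter.2 ⟨Finset.mem_univ _, ?_, ?_⟩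
    · have h1 := hA.card_forestOf
      have h2 := hA.numBlocks_orb
      have h3 : numBlocks (joinBonds (forestOf σ A) (orb θ)) + (forestOf σ A).card =
        numBlocks (orb θ) := hF
      rw [htop, numBlocks_top hn] at h3
      omega
    · rw [hA.orb_mul_eq hF, htop, numBlocks_top hn]
  · have hσ : h ∘ σ = h := by
      have := orb_le_iff.1 (hA.orb_le_of_forestOf (Ψ := Setoid.ker h) fun i j hij =>
        bondIn_mk.1 (hc _ hij))
      exact funext fun i => (this i).symm
    have hg : ∀ i j, σ.SameCycle i j → (h ∘ θ - h) i = (h ∘ θ - h) j := fun i j hij =>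
      hA.orb_le_of_forestOf (Ψ := Setoid.ker (h ∘ θ - h))
        (fun i j hij => increment_eq_of_mem habs h0 hij) hij
    refine Finset.mem_filter.2 ⟨hh, hσ, habs, sum_increment_orbit θ h, ?_, ?_, ?_⟩
    · exact funext fun i => (hg i (σ i) (sameCycle_apply_self σ i)).symm
    · intro i hi hs
      obtain ⟨x, hx⟩ := hA.exists_bond (Equiv.Perm.mem_support.1 hs)
      simp only [Pi.sub_apply, Function.comp_apply] at hi
      refine h0 ((degLT_one_fPoly (i := i) (by omega) (by omega)).bondsOp_eq_zero ?_)
      exact Finset.card_pos.2 ⟨_, Finset.mem_filter.2 ⟨hx, Sym2.mem_mk_left _ _⟩⟩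
    · intro i hi hs
      obtain ⟨x, hix, hx⟩ := hA.exists_two_bonds (Equiv.Perm.mem_support.1 hs)
      -- The increment is constant on `σ`-orbits, so a zero at `i` is a zero at the interior vertex,
      -- where `f^h` has degree one but two bonds act.
      rw [hg i x hix] at hi
      simp only [Pi.sub_apply, Function.comp_apply] at hi
      exact h0 ((degLT_two_fPoly (i := x) (by omega)).bondsOp_eq_zero hx)

/-- Goulden-Jackson pairs give compatible trees. -/
lemma IsTransversal.joinBonds_eq_top_and_bondIn (hA : IsTransversal σ A) (hσ : σ ∈ gj θ)
    (hh : h ∈ tildeMotzN N θ σ) : joinBonds (forestOf σ A) (orb θ) = ⊤ ∧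
      ∀ e ∈ forestOf σ A, bondIn (Setoid.ker h) e := by
  constructor
  · have h1 : orb (θ * σ) = ⊤ := eq_top_of_numBlocks_eq_one (Finset.mem_filter.1 hσ).2.2
    refine top_le_iff.1 (h1 ▸ orb_le_iff.2 fun i => ?_)
    have h2 : (joinBonds (forestOf σ A) (orb θ)).r i (σ i) :=
      orb_le_iff.1 (hA.orb_le_joinBonds (orb θ)) i
    have h3 : (joinBonds (forestOf σ A) (orb θ)).r (σ i) (θ (σ i)) :=
      orb_le_iff.1 (le_joinBonds _ (orb θ)) (σ i)
    exact Setoid.trans' _ h2 h3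
  · intro e he
    have hs : h ∘ σ = h := (Finset.mem_filter.1 hh).2.1
    induction e using Sym2.ind with
    | _ i j =>
    rw [bondIn_mk]
    rcases mem_forestOf.1 he with ⟨-, rfl⟩ | ⟨-, rfl⟩
    · exact (congrFun hs i).symm
    · exact congrFun hs j

end Membership

/-! ### Matching the tree expansion with the sum over cycle-cuttings -/

section Assembly

variable {n N : ℕ} {θ : Equiv.Perm (Fin n)} {h : Fin n → ℤ}

/-- The contribution of a sequence of bonds to the expansion of the cumulant. -/
def treeTerm (N : ℕ) (θ : Equiv.Perm (Fin n)) (h : Fin n → ℤ)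
    (e : Fin (numBlocks (orb θ) - 1) → Sym2 (Fin n)) : ℝ :=
  ∫ t in decSimplex (numBlocks (orb θ) - 1), wick (recoupledCov N h (interpMatrix (orb θ) e t))
    (bondsOp N (Finset.univ.image e) (fPoly N θ h))

/-- The sequences of bonds which contribute. -/
def IsCompatTree (θ : Equiv.Perm (Fin n)) (h : Fin n → ℤ) (Γ : Finset (Sym2 (Fin n))) : Prop :=
  joinBonds Γ (orb θ) = ⊤ ∧ ∀ b ∈ Γ, bondIn (Setoid.ker h) b

lemma isForestOver_of_joinBonds_eq_top (hn : 0 < n) {Θ : Setoid (Fin n)}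
    {e : Fin (numBlocks Θ - 1) → Sym2 (Fin n)} (he : joinBonds (Finset.univ.image e) Θ = ⊤) :
    IsForestOver (Finset.univ.image e) Θ := by
  have h1 := numBlocks_le_joinBonds_add_card (Finset.univ.image e) Θ
  have h2 : (Finset.univ.image e).card ≤ numBlocks Θ - 1 := by
    simpa using Finset.card_image_le (s := Finset.univ) (f := e)
  have h3 := numBlocks_pos hn Θ
  rw [he, numBlocks_top hn] at h1
  rw [IsForestOver, he, numBlocks_top hn]
  omega

/-- The forest formula with `Q = 0` and `u = 1`. A spanning set listed by `k - 1` bonds has no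
repetition, so the successive operators form `D^Γ`. -/
lemma sum_cumWeight_wick_eq (hn : 0 < n) (h : Fin n → ℤ) :
    ∑ Ψ ∈ Finset.univ.filter (orb θ ≤ ·),
      cumWeight (numBlocks Ψ) * wick (recoupledCov N h (partMatrix Ψ)) (fPoly N θ h) =
    ∑ e, if IsCompatTree θ h (Finset.univ.image e) then treeTerm N θ h e else 0 := by
  have hpos := numBlocks_pos hn (orb θ)
  have hB := sum_cumWeight_eq_sum_trees (V := ZPoly n N)
    (φ := fun g Q => wick (recoupledCov N h Q) g) (D := compatOp N h) hn
    (fun g => (continuous_wick g).comp (continuous_recoupledCov h))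
    (fun g Q Θ Ψ hΘ s => hasDerivAt_wick_recoupledCov h g Q hΘ s)
    (numBlocks (orb θ) - 1) (orb θ) (by omega) (fPoly N θ h) 0 (u := 1) zero_le_one
  simp only [zero_add, one_smul, add_sub_cancel, simplexBelow_one] at hB
  rw [hB]
  refine Finset.sum_congr rfl fun e _ => ?_
  by_cases htop : joinBonds (Finset.univ.image e) (orb θ) = ⊤
  · have hF := isForestOver_of_joinBonds_eq_top hn htop
    have hinj : Function.Injective e := by
      rw [IsForestOver, htop, numBlocks_top hn] at hF
      have : (Finset.univ.image e).card =
          (Finset.univ : Finset (Fin (numBlocks (orb θ) - 1))).card := by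
        rw [Finset.card_univ, Fintype.card_fin]
        omega
      simpa [Set.injOn_univ] using Finset.card_image_iff.1 this
    rw [if_pos htop, seqOp_compatOp h hinj]
    by_cases hc : ∀ b ∈ Finset.univ.image e, bondIn (Setoid.ker h) b
    · rw [if_pos hc, if_pos ⟨htop, hc⟩, treeTerm]
    · rw [if_neg hc, if_neg fun hcon => hc hcon.2]
      simp
  · rw [if_neg htop, if_neg fun hcon => htop hcon.1]

lemma integral_recoupledExp_eq (hh : h ∈ motzN N θ) (Γ : Finset (Sym2 (Fin n))) (c : ℝ) :
    ∫ Q, c * recoupledExp h Q (bondsOp N Γ (fPoly N θ h)) ∂bkarMeasure (orb θ) Γ =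
      ∑ e, if Finset.univ.image e = Γ then c * treeTerm N θ h e else 0 := by
  have hI : ∀ i, h i ∈ Finset.Icc (1 : ℤ) N := Fintype.mem_piFinset.1 (Finset.mem_filter.1 hh).1
  have hclosed : IsClosed {Q : Fin n → Fin n → ℝ |
      (Matrix.of (recoupledCov N h Q)).PosSemidef} :=
    isClosed_setOf_posSemidef.preimage (continuous_recoupledCov h)
  rw [integral_bkarMeasure (G := fun Q => c * wick (recoupledCov N h Q)
      (bondsOp N Γ (fPoly N θ h)))
    (continuous_const.mul ((continuous_wick _).comp (continuous_recoupledCov h))) hclosed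
    (fun Q hQ => by rw [recoupledExp_eq_wick hI hQ])
    (fun e t ht => posSemidef_recoupledCov_interpMatrix h (orb θ) e ht), Finset.sum_filter]
  refine Finset.sum_congr rfl fun e _ => ?_
  split_ifs with he
  · rw [integral_const_mul, treeTerm, he]
  · rfl

/-- The cycle-cuttings with a given linear forest have total weight one. -/
lemma sum_weight_eq (hn : 0 < n) (hh : h ∈ motzN N θ)
    {e : Fin (numBlocks (orb θ) - 1) → Sym2 (Fin n)}
    (h0 : bondsOp N (Finset.univ.image e) (fPoly N θ h) ≠ 0) :
    (∑ x ∈ Finset.univ.filter (fun x : Equiv.Perm (Fin n) × Finset (Fin n) =>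
      (x.1 ∈ gj θ ∧ h ∈ tildeMotzN N θ x.1) ∧
        (IsCycleCutting x.1 x.2 ∧ linForest x.1 x.2 = Finset.univ.image e)),
      (2 : ℝ)⁻¹ ^ x.2.card) = if IsCompatTree θ h (Finset.univ.image e) then 1 else 0 := by
  split_ifs with hT
  · have hF := isForestOver_of_joinBonds_eq_top hn hT.1
    obtain ⟨σ₀, A₀, hA₀, hΓ⟩ := exists_transversal_of_isForestOver hF fun i => by
      by_contra hc
      -- A vertex with three bonds would annihilate `f^h`, so the tree consists of paths at the
      -- level of points and comes from a transversal.
      exact h0 ((degLT_three_fPoly i).bondsOp_eq_zero (by omega))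
    rw [← sum_cycleCuttings hA₀, hΓ]
    refine Finset.sum_congr ?_ fun _ _ => rfl
    ext ⟨σ, A⟩
    simp only [Finset.mem_filter, Finset.mem_univ, true_and, and_iff_right_iff_imp]
    rintro ⟨hcut, hlin⟩
    rw [linForest_eq_forestOf] at hlin
    exact hcut.isTransversal.mem_gj_and_mem_tildeMotzN hn hh (hlin ▸ hF) (hlin ▸ hT.1)
      (hlin ▸ hT.2) (hlin ▸ h0)
  · refine Finset.sum_eq_zero fun x hx => absurd ?_ hT
    obtain ⟨⟨hσ, hm⟩, hcut, hlin⟩ := (Finset.mem_filter.1 hx).2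
    rw [linForest_eq_forestOf] at hlin
    rw [← hlin]
    exact hcut.isTransversal.joinBonds_eq_top_and_bondIn hσ hm

/-- Expand each measure over enumerations and exchange sums: a fixed path and enumeration then
receives the total weight of all cycle-cuttings with that linear forest. -/
lemma sum_cuttings_eq (hn : 0 < n) :
    ∑ σ ∈ gj θ, ∑ A ∈ Finset.univ.filter (fun A : Finset (Fin n) => IsCycleCutting σ A),
      ∑ h ∈ tildeMotzN N θ σ, ∫ Q, (2 : ℝ)⁻¹ ^ A.card *
          recoupledExp h Q (bondsOp N (linForest σ A) (fPoly N θ h))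
        ∂bkarMeasure (orb θ) (linForest σ A) =
    ∑ h ∈ motzN N θ, ∑ e,
      if IsCompatTree θ h (Finset.univ.image e) then treeTerm N θ h e else 0 := by
  have hterm : ∀ (σ : Equiv.Perm (Fin n)) (A : Finset (Fin n)),
      ∑ h ∈ tildeMotzN N θ σ, ∫ Q, (2 : ℝ)⁻¹ ^ A.card *
          recoupledExp h Q (bondsOp N (linForest σ A) (fPoly N θ h))
        ∂bkarMeasure (orb θ) (linForest σ A) =
      ∑ h ∈ motzN N θ, ∑ e, if h ∈ tildeMotzN N θ σ ∧ linForest σ A = Finset.univ.image e then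
        (2 : ℝ)⁻¹ ^ A.card * treeTerm N θ h e else 0 := fun σ A => by
    have hsub : tildeMotzN N θ σ = (motzN N θ).filter (· ∈ tildeMotzN N θ σ) := by
      ext h
      simp only [tildeMotzN, Finset.mem_filter]
      tauto
    conv_lhs => rw [hsub, Finset.sum_filter]
    refine Finset.sum_congr rfl fun h hh => ?_
    split_ifs with ht
    · rw [integral_recoupledExp_eq hh]
      refine Finset.sum_congr rfl fun e _ => ?_
      simp only [ht, true_and, eq_comm]
    · simp [ht]
  simp only [hterm]
  have hpair : ∀ F : Equiv.Perm (Fin n) → Finset (Fin n) → ℝ,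
      ∑ σ ∈ gj θ, ∑ A ∈ Finset.univ.filter (fun A : Finset (Fin n) => IsCycleCutting σ A), F σ A =
      ∑ x : Equiv.Perm (Fin n) × Finset (Fin n),
        if x.1 ∈ gj θ ∧ IsCycleCutting x.1 x.2 then F x.1 x.2 else 0 := fun F => by
    rw [Fintype.sum_prod_type, ← Finset.sum_subset (Finset.subset_univ (gj θ))]
    · refine Finset.sum_congr rfl fun σ hσ => ?_
      rw [Finset.sum_filter]
      simp only [hσ, true_and]
    · intro σ _ hσ
      simp [hσ]
  rw [hpair]
  have hpush : ∀ x : Equiv.Perm (Fin n) × Finset (Fin n),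
      (if x.1 ∈ gj θ ∧ IsCycleCutting x.1 x.2 then
        ∑ h ∈ motzN N θ, ∑ e, if h ∈ tildeMotzN N θ x.1 ∧
          linForest x.1 x.2 = Finset.univ.image e then
          (2 : ℝ)⁻¹ ^ x.2.card * treeTerm N θ h e else 0 else 0) =
      ∑ h ∈ motzN N θ, ∑ e, if (x.1 ∈ gj θ ∧ h ∈ tildeMotzN N θ x.1) ∧
        (IsCycleCutting x.1 x.2 ∧ linForest x.1 x.2 = Finset.univ.image e) then
        (2 : ℝ)⁻¹ ^ x.2.card * treeTerm N θ h e else 0 := fun x => by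
    split_ifs with hx
    · simp only [hx.1, hx.2, true_and]
    · symm
      refine Finset.sum_eq_zero fun h _ => Finset.sum_eq_zero fun e _ => if_neg ?_
      tauto
  simp only [hpush]
  rw [Finset.sum_comm]
  refine Finset.sum_congr rfl fun h hh => ?_
  rw [Finset.sum_comm]
  refine Finset.sum_congr rfl fun e _ => ?_
  rw [← Finset.sum_filter, ← Finset.sum_mul]
  -- A tree that is no linear forest has weight zero and not one, but then its term vanishes as
  -- well.
  by_cases h0 : bondsOp N (Finset.univ.image e) (fPoly N θ h) = 0
  · have : treeTerm N θ h e = 0 := by simp [treeTerm, h0]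
    simp [this]
  · rw [sum_weight_eq hn hh h0]
    simp

end Assembly

end TriGUE

end

theorem mainTheorem5 {Ω : Type*} [MeasurableSpace Ω] (P : Measure Ω) [IsProbabilityMeasure P]
    {n N : ℕ} (hn : 0 < n) (hN : 0 < N)
    (Ξ : Ω → Matrix (Fin N) (Fin N) ℂ) (hΞ : TriGUE.IsStandardGUE P Ξ)
    (lam : n.Partition) (θ : Equiv.Perm (Fin n)) (hθ : θ.partition.parts = lam.parts) :
    TriGUE.frakM P Ξ lam =
      ∑ σ ∈ TriGUE.gj θ,
        ∑ A ∈ Finset.univ.filter (fun A : Finset (Fin n) => TriGUE.IsCycleCutting σ A),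
          ∑ h ∈ TriGUE.tildeMotzN N θ σ,
            ∫ Q, (2 : ℝ)⁻¹ ^ A.card *
                TriGUE.recoupledExp h Q
                  (TriGUE.bondsOp N (TriGUE.linForest σ A) (TriGUE.fPoly N θ h))
              ∂TriGUE.bkarMeasure (TriGUE.orb θ) (TriGUE.linForest σ A) := by
  rw [hΞ.frakM_eq hN lam θ hθ, TriGUE.sum_cuttings_eq hn]
  exact Finset.sum_congr rfl fun h _ => TriGUE.sum_cumWeight_wick_eq hn h
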